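/- Throughout, "space" means simplicial set, $\mathcal S_*$ is the category of based spaces, a cofibration in $\mathcal S_*$ is a map whose underlying map of simplicial sets is a monomorphism, $S^1=\Delta^1/\partial\Delta^1$, and for a finite set $M$, $S^M$ is the $M$-fold smash power of $S^1$. Write $\mathbf n=\{1,\dots,n\}$ and $\mathbf k\sqcup\mathbf l=\mathbf{k+l}$ (concatenation). A *symmetric spectrum* $X$ consists of based $\Sigma_n$-spaces $X(\mathbf n)=X_n$ $(n\ge 0)$ and based maps $X_n\wedge S^1\to X_{n+1}$ such that all iterated structure maps $X_n\wedge S^{\mathbf m}\to X_{n+m}$ are $\Sigma_n\times\Sigma_m$-equivariant; a bijection $\mathbf k\sqcup M\cong\mathbf n$ then gives a generalized structure map $X(\mathbf k)\wedge S^M\to X(\mathbf n)$. For a finite group $G$, a *$G$-symmetric spectrum* is a $G$-object in symmetric spectra. The smash product has levels $(E\wedge F)_n=\operatorname{colim}_{\alpha:\mathbf k\sqcup\mathbf k'\to\mathbf n}E(\mathbf k)\wedge F(\mathbf k')\wedge S^{\mathbf n-\operatorname{im}\alpha}$, the colimit being over the category of injections $\alpha$. With $\overline{\mathbb S}$ the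 truncated sphere spectrum ($\overline{\mathbb S}_0=*$, $\overline{\mathbb S}_n=S^{\mathbf n}$ for $n\ge 1$), put $L_n(X)=(X\wedge\overline{\mathbb S})_n$, with its canonical map to $X(\mathbf n)$. For a finite group $K$, a map of based $K$-spaces is a *$K$-fibration* (*$K$-equivalence*) if it induces a Kan fibration (weak equivalence) on $H$-fixed points for all $H\le K$, and a *$K$-cofibration* if it has the left lifting property with respect to all $K$-fibrations that are $K$-equivalences. A map $f:X\to Y$ of $G$-symmetric spectra is a *$G$-flat cofibration* if for all $n\ge 0$ the map $\nu_n(f):X(\mathbf n)\cup_{L_n(X)}L_n(Y)\to Y(\mathbf n)$ is a $G\times\Sigma_n$-cofibration; $X$ is *$G$-flat* if $*\to X$ is a $G$-flat cofibration. For symmetric spectra ($G$ trivial) one says *flat*. **(1)** A map $f:X\to Y$ of symmetric spectra is a flat cofibration if and only if * (0) $f_0:X(\mathbf 0)\to Y(\mathbf 0)$ is a cofibration, * (a) for all $k,l\ge 0$ the map $X(\mathbf k\sqcup\mathbf l)\cup_{X(\mathbf k)\wedge S^{\mathbf l}}Y(\mathbf k)\wedge S^{\mathbf l}\to Y(\mathbf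 k\sqcup\mathbf l)$ is a cofibration, and * (b) for all $k,l,m\ge 0$, writing $\mathbf N=\mathbf k\sqcup\mathbf l\sqcup\mathbf m$, the square $$\begin{array}{ccc}X(\mathbf N)\cup_{X(\mathbf l)\wedge S^{\mathbf k\sqcup\mathbf m}}Y(\mathbf l)\wedge S^{\mathbf k\sqcup\mathbf m}&\to&X(\mathbf N)\cup_{X(\mathbf l\sqcup\mathbf m)\wedge S^{\mathbf k}}Y(\mathbf l\sqcup\mathbf m)\wedge S^{\mathbf k}\\ \downarrow&&\downarrow\\ X(\mathbf N)\cup_{X(\mathbf k\sqcup\mathbf l)\wedge S^{\mathbf m}}Y(\mathbf k\sqcup\mathbf l)\wedge S^{\mathbf m}&\to&Y(\mathbf N)\end{array}$$ is a pullback. **(2)** If $Y$ is a flat symmetric spectrum and $X\subset Y$ is a subspectrum, then the inclusion $X\to Y$ is a flat cofibration if and only if for all $k,l\ge 0$ the intersection of the images of $X(\mathbf k\sqcup\mathbf l)$ and $Y(\mathbf k)\wedge S^{\mathbf l}$ in $Y(\mathbf k\sqcup\mathbf l)$ equals the image of $X(\mathbf k)\wedge S^{\mathbf l}$. **(3)**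 Let $G$ be a finite group, $X$ a $G$-flat $G$-symmetric spectrum and $S$ a finite $G$-set of cardinality $n$. Let $G$ act on the power $X^{\times S}$ by $(gx)_s=g\,x_{g^{-1}s}$, and let $X^{\times S}_{\le n-1}\subset X^{\times S}$ be the subspectrum given levelwise by the base point and by those tuples in which two entries with different indices coincide or one entry is the base point. Then $X^{\times S}$ is $G$-flat and the inclusion $X^{\times S}_{\le n-1}\to X^{\times S}$ is a $G$-flat cofibration of $G$-symmetric spectra. **(4)** In particular, for the sphere spectrum $\mathbb S$ with trivial $G$-action, $\mathbb S^{\times S}$ is $G$-flat and $\mathbb S^{\times S}_{\le n-1}\to\mathbb S^{\times S}$ is a $G$-flat cofibration. -/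

import Mathlib

open CategoryTheory CategoryTheory.Limits Opposite

universe u v

namespace SymSp

/-! ### Based simplicial sets -/

/-- Two elements of `B ⊔ C` are identified in the pushout of `f` and `g`. -/
def pointedPushoutRel {A B C : Pointed.{u}} (f : A ⟶ B) (g : A ⟶ C) (x y : B.X ⊕ C.X) : Prop :=
  ∃ a : A.X, x = Sum.inl (f.toFun a) ∧ y = Sum.inr (g.toFun a)

/-- The pushout of pointed types. -/
def pointedPushout {A B C : Pointed.{u}} (f : A ⟶ B) (g : A ⟶ C) : Pointed.{u} :=
  ⟨Quot (pointedPushoutRel f g), Quot.mk _ (Sum.inl B.point)⟩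

theorem pointed_isPushout {A B C : Pointed.{u}} (f : A ⟶ B) (g : A ⟶ C) :
    IsPushout f g
      (show B ⟶ pointedPushout f g from ⟨fun b => Quot.mk _ (Sum.inl b), rfl⟩)
      (show C ⟶ pointedPushout f g from ⟨fun c => Quot.mk _ (Sum.inr c), by
        refine (Quot.sound ⟨A.point, ?_, ?_⟩).symm
        · rw [f.map_point]
        · rw [g.map_point]⟩) := by
  refine ⟨⟨?_⟩, ⟨PushoutCocone.IsColimit.mk _ (fun s =>
    ⟨Quot.lift (Sum.elim s.inl.toFun s.inr.toFun) ?_, s.inl.map_point⟩) ?_ ?_ ?_⟩⟩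
  · apply Pointed.Hom.ext
    funext a
    exact Quot.sound ⟨a, rfl, rfl⟩
  · rintro _ _ ⟨a, rfl, rfl⟩
    exact congrFun (congrArg Pointed.Hom.toFun s.condition) a
  · intro s; rfl
  · intro s; rfl
  · intro s m h1 h2
    apply Pointed.Hom.ext
    funext x
    induction x using Quot.ind with
    | mk x =>
      cases x with
      | inl b => exact congrFun (congrArg Pointed.Hom.toFun h1) b
      | inr b => exact congrFun (congrArg Pointed.Hom.toFun h2) b

instance : HasPushouts Pointed.{u} :=
  have (A B C : Pointed.{u}) (f : A ⟶ B) (g : A ⟶ C) : HasPushout f g :=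
    (pointed_isPushout f g).hasPushout
  hasPushouts_of_hasColimit_span _

/-- The category `S_*` of based simplicial sets ("based spaces"). -/
abbrev BSSet : Type (u + 1) := SimplicialObject Pointed.{u}

instance : HasPushouts BSSet.{u} :=
  inferInstanceAs (HasPushouts (SimplexCategoryᵒᵖ ⥤ Pointed.{u}))

/-- The functor forgetting the base point. -/
abbrev forgetBase : BSSet.{u} ⥤ SSet.{u} := (Functor.whiskeringRight _ _ _).obj (forget Pointed)

/-- The base point, as a simplex of a given dimension. -/
abbrev pt (X : BSSet.{u}) (p : SimplexCategoryᵒᵖ) : X.obj p := (X.obj p).point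

/-- The action of a simplicial operator on simplices. -/
abbrev rst (X : BSSet.{u}) {p q : SimplexCategoryᵒᵖ} (φ : p ⟶ q) (x : X.obj p) : X.obj q :=
  Pointed.Hom.toFun (X.map φ) x

/-- The action of a morphism of based simplicial sets on simplices. -/
abbrev ap {X Y : BSSet.{u}} (f : X ⟶ Y) {p : SimplexCategoryᵒᵖ} (x : X.obj p) : Y.obj p :=
  Pointed.Hom.toFun (f.app p) x

section basic

variable {X Y Z : BSSet.{u}} {p q r : SimplexCategoryᵒᵖ}

theorem rst_pt (φ : p ⟶ q) : rst X φ (pt X p) = pt X q := (X.map φ).map_point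

theorem rst_id (x : X.obj p) : rst X (𝟙 p) x = x := by
  simp only [rst, X.map_id]; rfl

theorem rst_comp (φ : p ⟶ q) (ψ : q ⟶ r) (x : X.obj p) :
    rst X (φ ≫ ψ) x = rst X ψ (rst X φ x) := by
  simp only [rst, X.map_comp]; rfl

theorem ap_pt (f : X ⟶ Y) : ap f (pt X p) = pt Y p := (f.app p).map_point

theorem ap_rst (f : X ⟶ Y) (φ : p ⟶ q) (x : X.obj p) :
    ap f (rst X φ x) = rst Y φ (ap f x) :=
  congrFun (congrArg Pointed.Hom.toFun (f.naturality φ)) x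

theorem ap_id (x : X.obj p) : ap (𝟙 X) x = x := rfl

theorem ap_comp (f : X ⟶ Y) (g : Y ⟶ Z) (x : X.obj p) : ap (f ≫ g) x = ap g (ap f x) := rfl

theorem hom_ext {f g : X ⟶ Y} (h : ∀ p (x : X.obj p), ap f x = ap g x) : f = g := by
  apply NatTrans.ext
  funext p
  apply Pointed.Hom.ext
  funext x
  exact h p x

/-- A morphism of based simplicial sets from its values on simplices. -/
def mkHom (F : ∀ p, X.obj p → Y.obj p) (hpt : ∀ p, F p (pt X p) = pt Y p)
    (hnat : ∀ {p q} (φ : p ⟶ q) (x : X.obj p), F q (rst X φ x) = rst Y φ (F p x)) : X ⟶ Y where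
  app p := ⟨F p, hpt p⟩
  naturality p q φ := by
    apply Pointed.Hom.ext
    funext x
    exact hnat φ x

/-- A based simplicial set from its sets of simplices, base points and operators. -/
def mkBSSet (T : SimplexCategoryᵒᵖ → Type u) (b : ∀ p, T p)
    (res : ∀ {p q : SimplexCategoryᵒᵖ}, (p ⟶ q) → T p → T q)
    (hb : ∀ {p q : SimplexCategoryᵒᵖ} (φ : p ⟶ q), res φ (b p) = b q)
    (hid : ∀ {p} (x : T p), res (𝟙 p) x = x)
    (hcomp : ∀ {p q r : SimplexCategoryᵒᵖ} (φ : p ⟶ q) (ψ : q ⟶ r) (x : T p),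
      res (φ ≫ ψ) x = res ψ (res φ x)) : BSSet.{u} where
  obj p := ⟨T p, b p⟩
  map φ := ⟨res φ, hb φ⟩
  map_id p := by
    apply Pointed.Hom.ext
    funext x
    exact hid x
  map_comp φ ψ := by
    apply Pointed.Hom.ext
    funext x
    exact hcomp φ ψ x

end basic

/-! ### Quotients, smash products, spheres -/

/-- The relation on `T₊` collapsing `W` to the base point. -/
def collapseSetoid {T : Type u} (W : Set T) : Setoid (Option T) where
  r a b := a = b ∨ ((∀ t ∈ a, t ∈ W) ∧ ∀ t ∈ b, t ∈ W)
  iseqv := by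
    refine ⟨fun a => Or.inl rfl, ?_, ?_⟩
    · rintro a b (h | h)
      · exact Or.inl h.symm
      · exact Or.inr ⟨h.2, h.1⟩
    · rintro a b c (rfl | h) (rfl | h')
      · exact Or.inl rfl
      · exact Or.inr h'
      · exact Or.inr h
      · exact Or.inr ⟨h.1, h'.2⟩

/-- The pointed set `T / W = T₊ / W₊`. -/
def Collapse {T : Type u} (W : Set T) : Type u := Quotient (collapseSetoid W)

namespace Collapse

variable {T T' P : Type u} {W : Set T}

/-- The class of an element. -/
def mk (W : Set T) (t : T) : Collapse W := Quotient.mk (collapseSetoid W) (some t)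

/-- The base point. -/
def base (W : Set T) : Collapse W := Quotient.mk (collapseSetoid W) none

theorem mk_eq_base {t : T} (h : t ∈ W) : mk W t = base W := by
  refine Quotient.sound (Or.inr ⟨?_, ?_⟩)
  · rintro _ ⟨rfl⟩; exact h
  · rintro _ ⟨⟩

/-- A function on `T` which is constant on `W` descends to `T / W`. -/
def lift (F : T → P) (b : P) (h : ∀ t ∈ W, F t = b) : Collapse W → P :=
  Quotient.lift (fun a : Option T => a.elim b F) (by
    have key : ∀ a : Option T, (∀ t ∈ a, t ∈ W) → a.elim b F = b := by
      rintro (_ | t) ht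
      · rfl
      · exact h t (ht t rfl)
    rintro a a' (rfl | h')
    · rfl
    · exact (key a h'.1).trans (key a' h'.2).symm)

theorem lift_mk (F : T → P) (b : P) (h : ∀ t ∈ W, F t = b) (t : T) : lift F b h (mk W t) = F t :=
  rfl

theorem lift_base (F : T → P) (b : P) (h : ∀ t ∈ W, F t = b) : lift F b h (base W) = b := rfl

theorem ind {C : Collapse W → Prop} (hb : C (base W)) (hm : ∀ t, C (mk W t)) (a) : C a := by
  induction a using Quotient.ind with
  | _ a =>
    cases a with
    | none => exact hb
    | some t => exact hm t

theorem mk_eq_base_iff {t : T} : mk W t = base W ↔ t ∈ W := by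
  refine ⟨fun h => ?_, mk_eq_base⟩
  rcases Quotient.exact h with h | h
  · cases h
  · exact h.1 t rfl

end Collapse

/-- The based simplicial set `K / W`, for a subcomplex `W` of a simplicial set `K`. -/
def quot (K : SSet.{u}) (W : K.Subcomplex) : BSSet.{u} :=
  mkBSSet (fun p => Collapse (W.obj p)) (fun p => Collapse.base (W.obj p))
    (fun φ => Collapse.lift (fun t => Collapse.mk _ (K.map φ t)) (Collapse.base _)
      (fun _ ht => Collapse.mk_eq_base (W.map φ ht)))
    (fun _ => rfl)
    (fun x => by
      induction x using Collapse.ind with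
      | hb => rfl
      | hm t => simp [Collapse.lift_mk])
    (fun φ ψ x => by
      induction x using Collapse.ind with
      | hb => rfl
      | hm t => simp [Collapse.lift_mk])

/-- The simplicial circle `S¹ = Δ¹ / ∂Δ¹`. -/
def circle : BSSet.{u} := quot (SSet.stdSimplex.obj (SimplexCategory.mk 1)) (SSet.boundary 1)

/-- The product of (underlying simplicial sets of) based simplicial sets. -/
def prodSSet (A B : BSSet.{u}) : SSet.{u} where
  obj p := A.obj p × B.obj p
  map φ := ↾ fun x => (rst A φ x.1, rst B φ x.2)
  map_id p := by
    apply ConcreteCategory.hom_ext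
    rintro ⟨a, b⟩
    exact Prod.ext (rst_id a) (rst_id b)
  map_comp φ ψ := by
    apply ConcreteCategory.hom_ext
    rintro ⟨a, b⟩
    exact Prod.ext (rst_comp φ ψ a) (rst_comp φ ψ b)

/-- The wedge `A ∨ B ⊆ A × B`. -/
def wedge (A B : BSSet.{u}) : (prodSSet A B).Subcomplex where
  obj p := {x : (A.obj p × B.obj p) | x.1 = pt A p ∨ x.2 = pt B p}
  map φ := by
    rintro ⟨a, b⟩ (h | h)
    · exact Or.inl ((congrArg (rst A φ) h).trans (rst_pt φ))
    · exact Or.inr ((congrArg (rst B φ) h).trans (rst_pt φ))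

/-- The smash product `A ∧ B = (A × B) / (A ∨ B)`. -/
def smash (A B : BSSet.{u}) : BSSet.{u} := quot (prodSSet A B) (wedge A B)

/-- The simplex `a ∧ b` of `A ∧ B`. -/
def smk {A B : BSSet.{u}} {p : SimplexCategoryᵒᵖ} (a : A.obj p) (b : B.obj p) :
    (smash A B).obj p :=
  Collapse.mk ((wedge A B).obj p) (a, b)

section smash

variable {A B C A' B' : BSSet.{u}} {p q : SimplexCategoryᵒᵖ}

theorem smk_pt_left (b : B.obj p) : smk (pt A p) b = pt (smash A B) p :=
  Collapse.mk_eq_base (Or.inl rfl)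

theorem smk_pt_right (a : A.obj p) : smk a (pt B p) = pt (smash A B) p :=
  Collapse.mk_eq_base (Or.inr rfl)

theorem rst_smk (φ : p ⟶ q) (a : A.obj p) (b : B.obj p) :
    rst (smash A B) φ (smk a b) = smk (rst A φ a) (rst B φ b) := rfl

theorem smash_ind {M : (smash A B).obj p → Prop} (h : ∀ a b, M (smk a b)) (x) : M x := by
  induction x using Collapse.ind with
  | hb =>
    have := h (pt A p) (pt B p)
    rw [smk_pt_left] at this
    exact this
  | hm t => exact h t.1 t.2

/-- Based maps out of a smash product. -/
def smashDesc (F : ∀ p, A.obj p → B.obj p → C.obj p)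
    (h₁ : ∀ p (b : B.obj p), F p (pt A p) b = pt C p)
    (h₂ : ∀ p (a : A.obj p), F p a (pt B p) = pt C p)
    (hnat : ∀ {p q : SimplexCategoryᵒᵖ} (φ : p ⟶ q) (a : A.obj p) (b : B.obj p),
      F q (rst A φ a) (rst B φ b) = rst C φ (F p a b)) : smash A B ⟶ C :=
  mkHom
    (fun p => Collapse.lift (W := (wedge A B).obj p)
      (fun t : A.obj p × B.obj p => F p t.1 t.2) (pt C p) (by
        rintro ⟨a, b⟩ (h | h)
        · obtain rfl : a = pt A p := h
          exact h₁ p b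
        · obtain rfl : b = pt B p := h
          exact h₂ p a))
    (fun _ => rfl)
    (fun {p q} φ x => by
      induction x using smash_ind with
      | h a b => exact hnat φ a b)

theorem smashDesc_smk (F : ∀ p, A.obj p → B.obj p → C.obj p) (h₁) (h₂) (hnat)
    (a : A.obj p) (b : B.obj p) :
    ap (smashDesc F h₁ h₂ hnat : smash A B ⟶ C) (smk a b) = F p a b := rfl

/-- The smash product of morphisms. -/
def smashMap (f : A ⟶ A') (g : B ⟶ B') : smash A B ⟶ smash A' B' :=
  smashDesc (fun _ a b => smk (ap f a) (ap g b))
    (fun p b => by rw [ap_pt, smk_pt_left])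
    (fun p a => by rw [ap_pt, smk_pt_right])
    (fun φ a b => by rw [ap_rst, ap_rst, rst_smk])

theorem smashMap_smk (f : A ⟶ A') (g : B ⟶ B') (a : A.obj p) (b : B.obj p) :
    ap (smashMap f g) (smk a b) = smk (ap f a) (ap g b) := rfl

end smash

/-- The `M`-fold power of the simplicial circle. -/
def circlePow (M : Type) : SSet.{u} where
  obj p := M → circle.{u}.obj p
  map φ := ↾ fun t i => rst circle φ (t i)
  map_id p := by
    apply ConcreteCategory.hom_ext
    intro t
    exact funext fun i => rst_id (t i)
  map_comp φ ψ := by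
    apply ConcreteCategory.hom_ext
    intro t
    exact funext fun i => rst_comp φ ψ (t i)

/-- Tuples at least one of whose entries is the base point. -/
def fatWedge (M : Type) : (circlePow.{u} M).Subcomplex where
  obj p := {t : (M → circle.{u}.obj p) | ∃ i, t i = pt circle p}
  map φ := by
    rintro t ⟨i, hi⟩
    exact ⟨i, (congrArg (rst circle φ) hi).trans (rst_pt φ)⟩

/-- The sphere `S^M`, the `M`-fold smash power of the circle. -/
def sphere (M : Type) : BSSet.{u} := quot (circlePow M) (fatWedge M)

section sphere

variable {M M' : Type} {p q : SimplexCategoryᵒᵖ}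

/-- The simplex of `S^M` given by a tuple of simplices of the circle. -/
def sph (t : M → circle.{u}.obj p) : (sphere.{u} M).obj p := Collapse.mk ((fatWedge M).obj p) t

theorem sph_eq_pt {t : M → circle.{u}.obj p} {i : M} (h : t i = pt circle p) :
    sph t = pt (sphere M) p := Collapse.mk_eq_base ⟨i, h⟩

theorem rst_sph (φ : p ⟶ q) (t : M → circle.{u}.obj p) :
    rst (sphere M) φ (sph t) = sph (fun i => rst circle φ (t i)) := rfl

/-- Functions out of `(S^M)_p`. -/
def sphLift {P : Type u} (F : (M → circle.{u}.obj p) → P) (b : P)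
    (h : ∀ t i, t i = pt circle p → F t = b) : (sphere.{u} M).obj p → P :=
  Collapse.lift (W := (fatWedge M).obj p) F b (by
    rintro t ⟨i, hi⟩
    exact h t i hi)

theorem sphLift_sph {P : Type u} (F : (M → circle.{u}.obj p) → P) (b : P) (h)
    (t : M → circle.{u}.obj p) : sphLift F b h (sph t) = F t := rfl

theorem sphLift_pt {P : Type u} (F : (M → circle.{u}.obj p) → P) (b : P) (h) :
    sphLift F b h (pt (sphere M) p) = b := rfl

theorem sph_ind {C : (sphere.{u} M).obj p → Prop} (hb : C (pt _ p)) (hm : ∀ t, C (sph t)) (x) :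
    C x := by
  induction x using Collapse.ind with
  | hb => exact hb
  | hm t => exact hm t

/-- Based maps out of `S^M`. -/
def sphDesc {C : BSSet.{u}} (F : ∀ p, (M → circle.{u}.obj p) → C.obj p)
    (h : ∀ p t i, t i = pt circle p → F p t = pt C p)
    (hnat : ∀ {p q : SimplexCategoryᵒᵖ} (φ : p ⟶ q) (t : M → circle.{u}.obj p),
      F q (fun i => rst circle φ (t i)) = rst C φ (F p t)) : sphere.{u} M ⟶ C :=
  mkHom (fun p => sphLift (F p) (pt C p) (h p)) (fun _ => rfl)
    (fun {p q} φ x => by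
      induction x using sph_ind with
      | hb => exact (rst_pt φ).symm
      | hm t => exact hnat φ t)

end sphere

/-! ### Symmetric spectra -/

/-- The iterated structure map `X_n ∧ S^m → X_{n+m}` on a simplex `x ∧ (t_0 ∧ ⋯ ∧ t_{m-1})`. -/
def iter {L : ℕ → BSSet.{u}} (σ : ∀ n, smash (L n) circle ⟶ L (n + 1)) {n : ℕ}
    {p : SimplexCategoryᵒᵖ} : ∀ (m : ℕ), (L n).obj p → (Fin m → circle.{u}.obj p) →
      ((L (n + m)).obj p)
  | 0, x, _ => x
  | m + 1, x, t => ap (σ (n + m)) (smk (iter σ m x (fun i => t i.castSucc)) (t (Fin.last m)))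

/-- The block permutation of `n + m` letters given by permutations of `n` and of `m` letters. -/
def blockPerm {n m : ℕ} (g : Equiv.Perm (Fin n)) (h : Equiv.Perm (Fin m)) :
    Equiv.Perm (Fin (n + m)) :=
  finSumFinEquiv.permCongr (Equiv.Perm.sumCongr g h)

/-- Symmetric spectra (the value at the standard set with `n` elements is `X_n`): based `Σ_n`-spaces `X_n` and structure maps `X_n ∧ S¹ → X_{n+1}` such that
the iterated structure maps `X_n ∧ S^m → X_{n+m}` are `Σ_n × Σ_m`-equivariant. -/
structure SymSpectrum where
  lvl : ∀ n : ℕ, Action BSSet.{u} (Equiv.Perm (Fin n))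
  σ : ∀ n, smash (lvl n).V circle ⟶ (lvl (n + 1)).V
  equivariant : ∀ {n m : ℕ} {p : SimplexCategoryᵒᵖ} (g : Equiv.Perm (Fin n))
    (h : Equiv.Perm (Fin m)) (x : (lvl n).V.obj p) (t : Fin m → circle.{u}.obj p),
    iter (L := fun n => (lvl n).V) σ m (ap ((lvl n).ρ g) x) (fun i => t (h⁻¹ i)) =
      ap ((lvl (n + m)).ρ (blockPerm g h)) (iter (L := fun n => (lvl n).V) σ m x t)

/-- The `p`-simplices of `X_n`. -/
abbrev SymSpectrum.el (E : SymSpectrum.{u}) (n : ℕ) (p : SimplexCategoryᵒᵖ) : Type u :=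
  ((E.lvl n).V.obj p).X

/-- Morphisms of symmetric spectra. -/
@[ext]
structure SymSpectrum.Hom (E F : SymSpectrum.{u}) where
  f : ∀ n, E.lvl n ⟶ F.lvl n
  comm : ∀ n, E.σ n ≫ (f (n + 1)).hom = smashMap (f n).hom (𝟙 circle) ≫ F.σ n

theorem smashMap_id (A B : BSSet.{u}) : smashMap (𝟙 A) (𝟙 B) = 𝟙 (smash A B) :=
  hom_ext fun p x => by
    induction x using smash_ind with
    | h a b => rfl

theorem smashMap_comp {A A' A'' B B' B'' : BSSet.{u}} (f : A ⟶ A') (f' : A' ⟶ A'') (g : B ⟶ B')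
    (g' : B' ⟶ B'') : smashMap (f ≫ f') (g ≫ g') = smashMap f g ≫ smashMap f' g' :=
  hom_ext fun p x => by
    induction x using smash_ind with
    | h a b => rfl

instance : Category SymSpectrum.{u} where
  Hom := SymSpectrum.Hom
  id E := ⟨fun n => 𝟙 (E.lvl n), fun n => by
    simp [smashMap_id]⟩
  comp {E F H} a b := ⟨fun n => a.f n ≫ b.f n, fun n => by
    have := smashMap_comp (a.f n).hom (b.f n).hom (𝟙 circle) (𝟙 circle)
    rw [Category.comp_id] at this
    rw [Action.comp_hom, Action.comp_hom, this, ← Category.assoc, a.comm, Category.assoc, b.comm,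
      Category.assoc]⟩
  id_comp a := SymSpectrum.Hom.ext (funext fun n => Category.id_comp (a.f n))
  comp_id a := SymSpectrum.Hom.ext (funext fun n => Category.comp_id (a.f n))
  assoc a b c := SymSpectrum.Hom.ext (funext fun n => Category.assoc (a.f n) (b.f n) (c.f n))

/-- The effect of a morphism of symmetric spectra on simplices. -/
abbrev SymSpectrum.Hom.ev {E F : SymSpectrum.{u}} (a : E ⟶ F) {n : ℕ} {p : SimplexCategoryᵒᵖ}
    (x : E.el n p) : F.el n p :=
  ap (SymSpectrum.Hom.f a n).hom x


theorem smash_sph_ext {M : Type} {A C : BSSet.{u}} {f g : smash A (sphere M) ⟶ C}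
    (h : ∀ p (x : A.obj p) (t : M → circle.{u}.obj p),
      ap f (smk x (sph t)) = ap g (smk x (sph t))) : f = g :=
  hom_ext fun p x => by
    induction x using smash_ind with
    | h a s =>
      induction s using sph_ind with
      | hb => rw [smk_pt_right, ap_pt, ap_pt]
      | hm t => exact h p a t

namespace SymSpectrum

variable {E F : SymSpectrum.{u}} {p q : SimplexCategoryᵒᵖ}

/-- The action of a permutation on a simplex of `E_n`. -/
abbrev act (E : SymSpectrum.{u}) {n : ℕ} (g : Equiv.Perm (Fin n)) (x : E.el n p) : E.el n p :=
  ap ((E.lvl n).ρ g) x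

theorem act_one {n : ℕ} (x : E.el n p) : E.act 1 x = x := by
  have h : (E.lvl n).ρ 1 = 𝟙 (E.lvl n).V := Action.ρ_one _
  simp only [act, h]
  rfl

theorem act_mul {n : ℕ} (g h : Equiv.Perm (Fin n)) (x : E.el n p) :
    E.act (g * h) x = E.act g (E.act h x) := by
  have h : (E.lvl n).ρ (g * h) = (E.lvl n).ρ h ≫ (E.lvl n).ρ g := map_mul _ _ _
  simp only [act, h]
  rfl

theorem ev_act (a : E ⟶ F) {n : ℕ} (g : Equiv.Perm (Fin n)) (x : E.el n p) :
    SymSpectrum.Hom.ev a (E.act g x) = F.act g (SymSpectrum.Hom.ev a x) :=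
  congrArg (fun m : (E.lvl n).V ⟶ (F.lvl n).V => ap m x) ((SymSpectrum.Hom.f a n).comm g)

/-- The iterated structure map `E_n ∧ S^m → E_{n+m}` on simplices. -/
def it (E : SymSpectrum.{u}) {n : ℕ} (m : ℕ) (x : E.el n p) (t : Fin m → circle.{u}.obj p) :
    E.el (n + m) p :=
  iter (L := fun n => (E.lvl n).V) E.σ m x t

theorem it_succ {n m : ℕ} (x : E.el n p) (t : Fin (m + 1) → circle.{u}.obj p) :
    E.it (m + 1) x t =
      ap (E.σ (n + m)) (smk (E.it m x (fun i => t i.castSucc)) (t (Fin.last m))) := rfl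

theorem it_pt {n : ℕ} : ∀ (m : ℕ) (t : Fin m → circle.{u}.obj p),
    E.it m (pt (E.lvl n).V p) t = pt (E.lvl (n + m)).V p
  | 0, _ => rfl
  | m + 1, t => by
    rw [it_succ, it_pt m, smk_pt_left]
    exact ap_pt _

theorem it_eq_pt {n : ℕ} : ∀ (m : ℕ) (x : E.el n p) (t : Fin m → circle.{u}.obj p) (i : Fin m),
    t i = pt circle p → E.it m x t = pt (E.lvl (n + m)).V p
  | 0, _, _, i, _ => i.elim0
  | m + 1, x, t, i, hi => by
    rw [it_succ]
    induction i using Fin.lastCases with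
    | last =>
      rw [hi, smk_pt_right]
      exact ap_pt _
    | cast i =>
      rw [it_eq_pt m x (fun i => t i.castSucc) i hi, smk_pt_left]
      exact ap_pt _

theorem rst_it {n : ℕ} (φ : p ⟶ q) : ∀ (m : ℕ) (x : E.el n p) (t : Fin m → circle.{u}.obj p),
    E.it m (rst _ φ x) (fun i => rst _ φ (t i)) = rst _ φ (E.it m x t)
  | 0, _, _ => rfl
  | m + 1, x, t => by
    rw [it_succ, it_succ, rst_it φ m x (fun i => t i.castSucc), ← rst_smk, ap_rst]
    rfl

theorem ev_it (a : E ⟶ F) {n : ℕ} : ∀ (m : ℕ) (x : E.el n p) (t : Fin m → circle.{u}.obj p),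
    SymSpectrum.Hom.ev a (E.it m x t) = F.it m (SymSpectrum.Hom.ev a x) t
  | 0, _, _ => rfl
  | m + 1, x, t => by
    rw [it_succ, it_succ, ← ev_it a m x]
    exact congrArg (fun f => ap f (smk (E.it m x fun i => t i.castSucc) (t (Fin.last m))))
      (SymSpectrum.Hom.comm a (n + m))

/-- The map `E_m → E_n` induced by a bijection from `m` letters to `n` letters (so `m = n`). -/
def relabel (E : SymSpectrum.{u}) {m n : ℕ} (e : Fin m ≃ Fin n) (x : E.el m p) : E.el n p :=
  have h : m = n := by simpa using Fintype.card_congr e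
  E.act ((finCongr h).symm.trans e) (h ▸ x)

theorem relabel_self {n : ℕ} (e : Fin n ≃ Fin n) (x : E.el n p) : E.relabel e x = E.act e x := rfl

theorem relabel_trans {l m n : ℕ} (e : Fin l ≃ Fin m) (e' : Fin m ≃ Fin n) (x : E.el l p) :
    E.relabel (e.trans e') x = E.relabel e' (E.relabel e x) := by
  obtain rfl : l = m := by simpa using Fintype.card_congr e
  obtain rfl : l = n := by simpa using Fintype.card_congr e'
  exact act_mul e' e x

theorem relabel_pt {m n : ℕ} (e : Fin m ≃ Fin n) :
    E.relabel e (pt (E.lvl m).V p) = pt (E.lvl n).V p := by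
  obtain rfl : m = n := by simpa using Fintype.card_congr e
  exact ap_pt _

theorem rst_relabel {m n : ℕ} (e : Fin m ≃ Fin n) (φ : p ⟶ q) (x : E.el m p) :
    E.relabel e (rst _ φ x) = rst _ φ (E.relabel e x) := by
  obtain rfl : m = n := by simpa using Fintype.card_congr e
  exact ap_rst _ φ x

theorem ev_relabel (a : E ⟶ F) {m n : ℕ} (e : Fin m ≃ Fin n) (x : E.el m p) :
    SymSpectrum.Hom.ev a (E.relabel e x) = F.relabel e (SymSpectrum.Hom.ev a x) := by
  obtain rfl : m = n := by simpa using Fintype.card_congr e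
  exact ev_act a _ x

theorem relabel_refl {n : ℕ} (x : E.el n p) : E.relabel (Equiv.refl _) x = x := act_one x

theorem it_act_right {n m : ℕ} (h : Equiv.Perm (Fin m)) (x : E.el n p)
    (t : Fin m → circle.{u}.obj p) :
    E.it m x (fun i => t (h⁻¹ i)) = E.act (blockPerm 1 h) (E.it m x t) := by
  have h1 : E.it m (E.act 1 x) (fun i => t (h⁻¹ i)) = E.act (blockPerm 1 h) (E.it m x t) :=
    E.equivariant 1 h x t
  rwa [act_one] at h1

theorem it_relabel {k l m : ℕ} (e : Fin k ≃ Fin l) (x : E.el k p)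
    (t : Fin m → circle.{u}.obj p) :
    E.it m (E.relabel e x) t =
      E.relabel (finSumFinEquiv.symm.trans
        ((Equiv.sumCongr e (Equiv.refl _)).trans finSumFinEquiv)) (E.it m x t) := by
  obtain rfl : k = l := by simpa using Fintype.card_congr e
  exact E.equivariant e 1 x t

theorem it_it {n r : ℕ} (x : E.el n p) (a : Fin r → circle.{u}.obj p) :
    ∀ (m : ℕ) (b : Fin m → circle.{u}.obj p),
      E.it m (E.it r x a) b =
        E.relabel (finCongr (Nat.add_assoc n r m).symm) (E.it (r + m) x (Fin.append a b))
  | 0, b => by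
    have : Fin.append a b = a := by
      funext i
      exact Fin.append_left a b i
    rw [this]
    exact (relabel_refl (E.it r x a)).symm
  | m + 1, b => by
    have h1 : (fun i : Fin (r + m) => Fin.append a b i.castSucc) =
        Fin.append a (fun i => b i.castSucc) := by
      funext i
      induction i using Fin.addCases with
      | left i =>
        rw [Fin.append_left]
        exact Fin.append_left a b i
      | right i =>
        rw [Fin.append_right]
        exact Fin.append_right a b i.castSucc
    have h2 : Fin.append a b (Fin.last (r + m)) = b (Fin.last m) :=
      Fin.append_right a b (Fin.last m)
    have key : ∀ {k l : ℕ} (h : k = l) (h' : k + 1 = l + 1) (y : E.el k p)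
        (c : circle.{u}.obj p),
        ap (E.σ l) (smk (E.relabel (finCongr h) y) c) =
          E.relabel (finCongr h') (ap (E.σ k) (smk y c)) := by
      rintro k _ rfl h' y c
      exact (congrArg (fun z => ap (E.σ k) (smk z c)) (relabel_refl y)).trans
        (relabel_refl _).symm
    have ih := it_it x a m (fun i => b i.castSucc)
    calc E.it (m + 1) (E.it r x a) b
        = ap (E.σ (n + r + m)) (smk (E.it m (E.it r x a) fun i => b i.castSucc)
            (b (Fin.last m))) := rfl
      _ = E.relabel (finCongr (Nat.add_assoc n r (m + 1)).symm)
            (ap (E.σ (n + (r + m))) (smk (E.it (r + m) x (Fin.append a fun i => b i.castSucc))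
              (b (Fin.last m)))) := by
          rw [ih]
          exact key _ _ _ _
      _ = _ := by
          rw [← h1, ← h2]
          rfl

/-- The composite `E_k ∧ S^r → E_{k+r} → E_n` of an iterated structure map and the relabelling
along a bijection. -/
def push (E : SymSpectrum.{u}) {k r n : ℕ} (τ : Fin k ⊕ Fin r ≃ Fin n) (x : E.el k p)
    (t : Fin r → circle.{u}.obj p) : E.el n p :=
  E.relabel (finSumFinEquiv.symm.trans τ) (E.it r x t)

theorem push_perm {k r n : ℕ} (τ : Fin k ⊕ Fin r ≃ Fin n) (h : Equiv.Perm (Fin r))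
    (x : E.el k p) (t : Fin r → circle.{u}.obj p) :
    E.push ((Equiv.sumCongr (Equiv.refl _) h).trans τ) x t = E.push τ x (fun i => t (h⁻¹ i)) := by
  unfold push
  rw [it_act_right, ← relabel_self, ← relabel_trans]
  congr 1
  ext i
  simp [blockPerm, Equiv.permCongr_apply]

theorem push_congr {k r r' n : ℕ} (τ : Fin k ⊕ Fin r ≃ Fin n) (τ' : Fin k ⊕ Fin r' ≃ Fin n)
    (x : E.el k p) (t : Fin r → circle.{u}.obj p) (t' : Fin r' → circle.{u}.obj p)
    (h₁ : ∀ i, τ (Sum.inl i) = τ' (Sum.inl i))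
    (h₂ : ∀ j j', τ (Sum.inr j) = τ' (Sum.inr j') → t j = t' j') :
    E.push τ x t = E.push τ' x t' := by
  obtain rfl : r = r' := by
    have := Fintype.card_congr (τ.trans τ'.symm)
    simpa using this
  have hex : ∀ j, ∃ j', τ (Sum.inr j) = τ' (Sum.inr j') := by
    intro j
    obtain ⟨i | j', hj⟩ := τ'.surjective (τ (Sum.inr j))
    · rw [← h₁] at hj
      exact absurd (τ.injective hj) (by simp)
    · exact ⟨j', hj.symm⟩
  choose ρ hρ using hex
  have hinj : Function.Injective ρ := by
    intro i j hij
    have : τ (Sum.inr i) = τ (Sum.inr j) := by rw [hρ, hρ, hij]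
    simpa using τ.injective this
  let e : Equiv.Perm (Fin r) := Equiv.ofBijective ρ (Finite.injective_iff_bijective.1 hinj)
  have hτ : τ = (Equiv.sumCongr (Equiv.refl _) e).trans τ' := by
    ext (i | j)
    · simp [h₁]
    · simp [hρ, e]
  rw [hτ, push_perm]
  congr 1
  funext i
  refine h₂ _ _ ?_
  rw [hρ]
  congr 2
  exact e.apply_symm_apply i

theorem push_push {k r l m n : ℕ} (τ : Fin k ⊕ Fin r ≃ Fin l) (θ : Fin l ⊕ Fin m ≃ Fin n)
    (x : E.el k p) (a : Fin r → circle.{u}.obj p) (b : Fin m → circle.{u}.obj p) :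
    E.push θ (E.push τ x a) b =
      E.push ((Equiv.sumCongr (Equiv.refl _) finSumFinEquiv.symm).trans
        ((Equiv.sumAssoc _ _ _).symm.trans ((Equiv.sumCongr τ (Equiv.refl _)).trans θ))) x
        (Fin.append a b) := by
  unfold push
  rw [it_relabel, it_it, ← relabel_trans, ← relabel_trans]
  congr 1
  ext i
  congr 1
  induction i using Fin.addCases with
  | left i =>
    have : (finCongr (Nat.add_assoc k r m).symm) (Fin.castAdd (r + m) i) =
      Fin.castAdd m (Fin.castAdd r i) := rfl
    simp [this]
  | right i =>
    induction i using Fin.addCases with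
    | left i =>
      have : (finCongr (Nat.add_assoc k r m).symm) (Fin.natAdd k (Fin.castAdd m i)) =
        Fin.castAdd m (Fin.natAdd k i) := rfl
      simp [this]
    | right i =>
      have : (finCongr (Nat.add_assoc k r m).symm) (Fin.natAdd k (Fin.natAdd r i)) =
        Fin.natAdd (k + r) i := by
          ext
          simp [Nat.add_assoc]
      simp [this]

/-- The generalized structure map `E(k) ∧ S^M → E(k ⊔ M) ≅ E(n)` on simplices, for a finite set `M`
and a bijection `k ⊔ M ≅ n`; by `genEl_eq_push` it does not depend on the chosen numbering
of `M`. -/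
noncomputable def genEl (E : SymSpectrum.{u}) {k n : ℕ} {M : Type} [Finite M]
    (τ : Fin k ⊕ M ≃ Fin n) (x : E.el k p) (t : M → circle.{u}.obj p) : E.el n p :=
  E.push ((Equiv.sumCongr (Equiv.refl _) (Finite.equivFin M).symm).trans τ) x
    (fun i => t ((Finite.equivFin M).symm i))

section genEl

variable {k l n : ℕ} {M M' : Type} [Finite M] [Finite M']

theorem genEl_eq_push {r : ℕ} (ψ : Fin r ≃ M) (τ : Fin k ⊕ M ≃ Fin n) (x : E.el k p)
    (t : M → circle.{u}.obj p) :
    E.genEl τ x t = E.push ((Equiv.sumCongr (Equiv.refl _) ψ).trans τ) x (fun i => t (ψ i)) := by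
  refine push_congr _ _ _ _ _ (fun i => rfl) (fun j j' h => ?_)
  have := τ.injective h
  simp only [Equiv.sumCongr_apply, Sum.map_inr, Sum.inr.injEq] at this
  rw [this]

theorem genEl_congr (τ : Fin k ⊕ M ≃ Fin n) (τ' : Fin k ⊕ M' ≃ Fin n) (x : E.el k p)
    (t : M → circle.{u}.obj p) (t' : M' → circle.{u}.obj p)
    (h₁ : ∀ i, τ (Sum.inl i) = τ' (Sum.inl i))
    (h₂ : ∀ j j', τ (Sum.inr j) = τ' (Sum.inr j') → t j = t' j') :
    E.genEl τ x t = E.genEl τ' x t' :=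
  push_congr _ _ _ _ _ h₁ (fun _ _ h => h₂ _ _ h)

theorem genEl_genEl (τ : Fin k ⊕ M ≃ Fin l) (θ : Fin l ⊕ M' ≃ Fin n) (x : E.el k p)
    (a : M → circle.{u}.obj p) (b : M' → circle.{u}.obj p) :
    E.genEl θ (E.genEl τ x a) b =
      E.genEl ((Equiv.sumAssoc _ _ _).symm.trans ((Equiv.sumCongr τ (Equiv.refl _)).trans θ)) x
        (Sum.elim a b) := by
  rw [genEl_eq_push (finSumFinEquiv.symm.trans (Equiv.sumCongr (Finite.equivFin M).symm
    (Finite.equivFin M').symm))]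
  unfold genEl
  rw [push_push]
  refine push_congr _ _ _ _ _ (fun i => rfl) (fun j j' h => ?_)
  have h' : j = j' := by
    have h3 := θ.injective h
    induction j using Fin.addCases with
    | left i =>
      induction j' using Fin.addCases with
      | left i' => simpa using h3
      | right i' => simp at h3
    | right i =>
      induction j' using Fin.addCases with
      | left i' => simp at h3
      | right i' => simpa using h3
  subst h'
  induction j using Fin.addCases with
  | left i => simp
  | right i => simp

theorem genEl_pt (τ : Fin k ⊕ M ≃ Fin n) (t : M → circle.{u}.obj p) :
    E.genEl τ (pt _ p) t = pt _ p := by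
  unfold genEl push
  rw [it_pt, relabel_pt]

theorem genEl_eq_pt (τ : Fin k ⊕ M ≃ Fin n) (x : E.el k p) (t : M → circle.{u}.obj p) (i : M)
    (hi : t i = pt circle p) : E.genEl τ x t = pt _ p := by
  unfold genEl push
  rw [it_eq_pt _ _ _ (Finite.equivFin M i) (by simpa using hi), relabel_pt]

theorem rst_genEl (τ : Fin k ⊕ M ≃ Fin n) (φ : p ⟶ q) (x : E.el k p)
    (t : M → circle.{u}.obj p) :
    E.genEl τ (rst _ φ x) (fun i => rst _ φ (t i)) = rst _ φ (E.genEl τ x t) := by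
  unfold genEl push
  rw [← rst_relabel, ← rst_it]

theorem ev_genEl (a : E ⟶ F) (τ : Fin k ⊕ M ≃ Fin n) (x : E.el k p)
    (t : M → circle.{u}.obj p) :
    SymSpectrum.Hom.ev a (E.genEl τ x t) = F.genEl τ (SymSpectrum.Hom.ev a x) t := by
  unfold genEl push
  rw [ev_relabel, ev_it]

theorem act_genEl (g : Equiv.Perm (Fin n)) (τ : Fin k ⊕ M ≃ Fin n) (x : E.el k p)
    (t : M → circle.{u}.obj p) :
    E.act g (E.genEl τ x t) = E.genEl (τ.trans g) x t := by
  unfold genEl push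
  rw [← relabel_self, ← relabel_trans]
  rfl

/-- The generalized structure map `E(k) ∧ S^M → E(n)` for a bijection `k ⊔ M ≅ n`. -/
noncomputable def gen (E : SymSpectrum.{u}) (τ : Fin k ⊕ M ≃ Fin n) :
    smash (E.lvl k).V (sphere M) ⟶ (E.lvl n).V :=
  smashDesc (fun _ x => sphLift (fun t => E.genEl τ x t) (pt _ _) (fun _ i hi =>
      genEl_eq_pt τ x _ i hi))
    (fun p s => by
      induction s using sph_ind with
      | hb => rfl
      | hm t => exact genEl_pt τ t)
    (fun _ _ => rfl)
    (fun φ x s => by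
      induction s using sph_ind with
      | hb => exact (rst_pt φ).symm
      | hm t => exact rst_genEl τ φ x t)

theorem gen_smk (τ : Fin k ⊕ M ≃ Fin n) (x : E.el k p) (t : M → circle.{u}.obj p) :
    ap (E.gen τ) (smk x (sph t)) = E.genEl τ x t := rfl

theorem gen_nat (a : E ⟶ F) (τ : Fin k ⊕ M ≃ Fin n) :
    E.gen τ ≫ (SymSpectrum.Hom.f a n).hom =
      smashMap (SymSpectrum.Hom.f a k).hom (𝟙 (sphere M)) ≫ F.gen τ :=
  smash_sph_ext fun _ x t => ev_genEl a τ x t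

end genEl

end SymSpectrum


/-! ### Subspectra, the sphere spectrum, powers -/

/-- A subspectrum: subsets of simplices in every level closed under all the structure. -/
structure SubSpectrum (E : SymSpectrum.{u}) where
  carrier : ∀ (n : ℕ) (p : SimplexCategoryᵒᵖ), Set (E.el n p)
  pt_mem : ∀ n p, pt (E.lvl n).V p ∈ carrier n p
  rst_mem : ∀ {n : ℕ} {p q : SimplexCategoryᵒᵖ} (φ : p ⟶ q) {x : E.el n p},
    x ∈ carrier n p → rst (E.lvl n).V φ x ∈ carrier n q
  act_mem : ∀ {n : ℕ} {p : SimplexCategoryᵒᵖ} (g : Equiv.Perm (Fin n)) {x : E.el n p},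
    x ∈ carrier n p → E.act g x ∈ carrier n p
  σ_mem : ∀ {n : ℕ} {p : SimplexCategoryᵒᵖ} {x : E.el n p} (c : circle.{u}.obj p),
    x ∈ carrier n p → ap (E.σ n) (smk x c) ∈ carrier (n + 1) p

namespace SubSpectrum

variable {E : SymSpectrum.{u}} (A : SubSpectrum E)

/-- The levels of a subspectrum. -/
def lvl (n : ℕ) : Action BSSet.{u} (Equiv.Perm (Fin n)) where
  V := mkBSSet (fun p => {x : E.el n p // x ∈ A.carrier n p}) (fun p => ⟨_, A.pt_mem n p⟩)
    (fun φ x => ⟨_, A.rst_mem φ x.2⟩)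
    (fun φ => Subtype.ext (rst_pt φ)) (fun x => Subtype.ext (rst_id x.1))
    (fun φ ψ x => Subtype.ext (rst_comp φ ψ x.1))
  ρ :=
    { toFun g := mkHom (fun _ x => ⟨E.act g x.1, A.act_mem g x.2⟩)
        (fun _ => Subtype.ext (ap_pt _)) (fun φ x => Subtype.ext (ap_rst _ φ x.1))
      map_one' := hom_ext fun _ x => Subtype.ext (E.act_one x.1)
      map_mul' g h := hom_ext fun _ x => Subtype.ext (E.act_mul g h x.1) }

/-- The structure maps of a subspectrum. -/
def str (n : ℕ) : smash (A.lvl n).V circle ⟶ (A.lvl (n + 1)).V :=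
  smashDesc (fun _ x c => ⟨ap (E.σ n) (smk x.1 c), A.σ_mem c x.2⟩)
    (fun _ c => Subtype.ext ((congrArg (ap (E.σ n)) (smk_pt_left c)).trans (ap_pt _)))
    (fun _ x => Subtype.ext ((congrArg (ap (E.σ n)) (smk_pt_right x.1)).trans (ap_pt _)))
    (fun φ x c => Subtype.ext (ap_rst (E.σ n) φ (smk x.1 c)))

theorem iter_val {n : ℕ} {p : SimplexCategoryᵒᵖ} : ∀ (m : ℕ) (x : (A.lvl n).V.obj p)
    (t : Fin m → circle.{u}.obj p),
    (iter (L := fun n => (A.lvl n).V) A.str m x t).1 = E.it m x.1 t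
  | 0, _, _ => rfl
  | m + 1, x, t =>
    congrArg (fun y => ap (E.σ (n + m)) (smk y (t (Fin.last m))))
      (iter_val m x (fun i => t i.castSucc))

/-- A subspectrum, as a symmetric spectrum. -/
def toSpectrum : SymSpectrum.{u} where
  lvl := A.lvl
  σ := A.str
  equivariant {_ m _} g h x t := Subtype.ext (by
    refine (A.iter_val m _ _).trans ((E.equivariant g h x.1 t).trans ?_)
    exact congrArg (E.act (blockPerm g h)) (A.iter_val m x t).symm)

/-- The inclusion of a subspectrum. -/
def ι : A.toSpectrum ⟶ E where
  f n :=
    { hom := mkHom (fun _ x => x.1) (fun _ => rfl) (fun _ _ => rfl)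
      comm := fun _ => rfl }
  comm n := hom_ext fun _ x => by
    induction x using smash_ind with
    | h a b => rfl

end SubSpectrum

/-- The trivial symmetric spectrum, all of whose levels are a point. -/
def pointSpectrum : SymSpectrum.{u} where
  lvl _ := Action.trivial _ (mkBSSet (fun _ => PUnit) (fun _ => ⟨⟩) (fun _ _ => ⟨⟩)
    (fun _ => rfl) (fun _ => rfl) (fun _ _ _ => rfl))
  σ _ := smashDesc (fun _ _ _ => PUnit.unit) (fun _ _ => rfl) (fun _ _ => rfl) (fun _ _ _ => rfl)
  equivariant _ _ _ _ := rfl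

/-- The unique morphism from the trivial spectrum. -/
def fromPoint (E : SymSpectrum.{u}) : pointSpectrum.{u} ⟶ E where
  f n :=
    { hom := mkHom (fun p _ => pt (E.lvl n).V p) (fun _ => rfl) (fun φ _ => (rst_pt φ).symm)
      comm := fun g => hom_ext fun _ _ => (ap_pt ((E.lvl n).ρ g)).symm }
  comm n := hom_ext fun _ x => by
    induction x using smash_ind with
    | h a b => exact ((congrArg (ap (E.σ n)) (smk_pt_left b)).trans (ap_pt _)).symm

/-- The based `Σ_n`-space `S^n`, with `(g t)_i = t_{g⁻¹ i}`. -/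
def sphereLvl (n : ℕ) : Action BSSet.{u} (Equiv.Perm (Fin n)) where
  V := sphere (Fin n)
  ρ :=
    { toFun g := sphDesc (fun _ t => sph (fun i => t (g⁻¹ i))) (fun _ t i hi =>
        sph_eq_pt (i := g i) (by simpa using hi)) (fun _ _ => rfl)
      map_one' := hom_ext fun _ x => by
        induction x using sph_ind with
        | hb => rfl
        | hm t => rfl
      map_mul' g h := hom_ext fun _ x => by
        induction x using sph_ind with
        | hb => rfl
        | hm t =>
          refine congrArg sph (funext fun i => ?_)
          rw [mul_inv_rev]
          rfl }

/-- The isomorphism `S^n ∧ S¹ → S^{n+1}`. -/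
def sphereStr (n : ℕ) : smash (sphereLvl.{u} n).V circle ⟶ (sphereLvl.{u} (n + 1)).V :=
  smashDesc (C := sphere.{u} (Fin (n + 1)))
    (fun p s c => sphLift (fun t => sph (Fin.snoc (α := fun _ => (circle.{u}.obj p).X) t c))
      (pt _ _) (fun t i hi => sph_eq_pt (i := i.castSucc) (by simpa using hi)) s)
    (fun _ _ => rfl)
    (fun _ s => by
      induction s using sph_ind with
      | hb => rfl
      | hm t => exact sph_eq_pt (i := Fin.last n) (by simp))
    (fun {p q} φ s c => by
      induction s using sph_ind with
      | hb => exact (rst_pt φ).symm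
      | hm t =>
        refine congrArg sph (funext fun i => ?_)
        change Fin.snoc (α := fun _ => (circle.{u}.obj q).X) (fun i => rst circle φ (t i))
            (rst circle φ c) i =
          rst circle φ (Fin.snoc (α := fun _ => (circle.{u}.obj p).X) t c i)
        induction i using Fin.lastCases with
        | last => rw [Fin.snoc_last, Fin.snoc_last]
        | cast i => rw [Fin.snoc_castSucc, Fin.snoc_castSucc])

theorem sphere_iter {n : ℕ} {p : SimplexCategoryᵒᵖ} (t : Fin n → circle.{u}.obj p) :
    ∀ (m : ℕ) (s : Fin m → circle.{u}.obj p),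
    iter (L := fun n => (sphereLvl n).V) sphereStr m (sph t) s = sph (Fin.append t s)
  | 0, s => by
    refine congrArg sph (funext fun i => ?_)
    exact (Fin.append_left t s i).symm
  | m + 1, s => by
    have ih := sphere_iter t m (fun i => s i.castSucc)
    refine (congrArg (fun y => ap (sphereStr (n + m)) (smk y (s (Fin.last m)))) ih).trans ?_
    refine congrArg sph (funext fun i => ?_)
    induction i using Fin.lastCases with
    | last =>
      rw [Fin.snoc_last]
      exact (Fin.append_right t s (Fin.last m)).symm
    | cast i =>
      rw [Fin.snoc_castSucc]
      induction i using Fin.addCases with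
      | left i =>
        rw [Fin.append_left]
        exact (Fin.append_left t s i).symm
      | right i =>
        rw [Fin.append_right]
        exact (Fin.append_right t s i.castSucc).symm

theorem iter_base {L : ℕ → BSSet.{u}} (σ : ∀ n, smash (L n) circle ⟶ L (n + 1)) {n : ℕ}
    {p : SimplexCategoryᵒᵖ} : ∀ (m : ℕ) (t : Fin m → circle.{u}.obj p),
    iter σ m (pt (L n) p) t = pt (L (n + m)) p
  | 0, _ => rfl
  | m + 1, t => by
    have := iter_base σ (n := n) m (fun i => t i.castSucc)
    refine (congrArg (fun y => ap (σ (n + m)) (smk y (t (Fin.last m)))) this).trans ?_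
    exact (congrArg (ap (σ (n + m))) (smk_pt_left _)).trans (ap_pt _)

/-- The sphere spectrum `𝕊`. -/
def sphereSpectrum : SymSpectrum.{u} where
  lvl := sphereLvl
  σ := sphereStr
  equivariant {n m p} g h x s := by
    induction x using sph_ind with
    | hb =>
      refine (iter_base sphereStr m (fun i => s (h⁻¹ i))).trans ?_
      exact ((congrArg (ap ((sphereLvl (n + m)).ρ (blockPerm g h)))
        (iter_base sphereStr m s)).trans (ap_pt _)).symm
    | hm t =>
      rw [sphere_iter]
      refine (sphere_iter (fun i => t (g⁻¹ i)) m (fun i => s (h⁻¹ i))).trans ?_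
      refine congrArg sph (funext fun i => ?_)
      have hb : (blockPerm g h)⁻¹ = blockPerm g⁻¹ h⁻¹ := rfl
      rw [hb]
      induction i using Fin.addCases with
      | left i => simp [blockPerm, Equiv.permCongr_apply]
      | right i => simp [blockPerm, Equiv.permCongr_apply]

/-- The truncated sphere spectrum, with level `0` a point and level `n ≥ 1` equal to `S^n`. -/
def truncSphere : SubSpectrum sphereSpectrum.{u} where
  carrier n p := {x | n = 0 → x = pt (sphereSpectrum.lvl n).V p}
  pt_mem _ _ _ := rfl
  rst_mem φ _ hx h := (congrArg (rst _ φ) (hx h)).trans (rst_pt φ)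
  act_mem g _ hx h := (congrArg (sphereSpectrum.act g) (hx h)).trans (ap_pt _)
  σ_mem _ _ h := absurd h (Nat.succ_ne_zero _)

section power

variable (E : SymSpectrum.{u}) (S : Type)

/-- The levels of the power `E^S`. -/
def powerLvl (n : ℕ) : Action BSSet.{u} (Equiv.Perm (Fin n)) where
  V := mkBSSet (fun p => S → E.el n p) (fun p _ => pt (E.lvl n).V p)
    (fun φ x s => rst _ φ (x s))
    (fun φ => funext fun _ => rst_pt φ) (fun x => funext fun s => rst_id (x s))
    (fun φ ψ x => funext fun s => rst_comp φ ψ (x s))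
  ρ :=
    { toFun g := mkHom (fun _ x s => E.act g (x s))
        (fun _ => funext fun _ => ap_pt _) (fun φ x => funext fun s => ap_rst _ φ (x s))
      map_one' := hom_ext fun _ x => funext fun s => E.act_one (x s)
      map_mul' g h := hom_ext fun _ x => funext fun s => E.act_mul g h (x s) }

/-- The structure maps of the power `E^S`. -/
def powerStr (n : ℕ) : smash (powerLvl E S n).V circle ⟶ (powerLvl E S (n + 1)).V :=
  smashDesc (fun _ x c s => ap (E.σ n) (smk (x s) c))
    (fun _ c => funext fun _ => (congrArg (ap (E.σ n)) (smk_pt_left c)).trans (ap_pt _))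
    (fun _ x => funext fun s => (congrArg (ap (E.σ n)) (smk_pt_right (x s))).trans (ap_pt _))
    (fun φ x c => funext fun s => ap_rst (E.σ n) φ (smk (x s) c))

theorem power_iter {n : ℕ} {p : SimplexCategoryᵒᵖ} (s : S) : ∀ (m : ℕ)
    (x : (powerLvl E S n).V.obj p) (t : Fin m → circle.{u}.obj p),
    iter (L := fun n => (powerLvl E S n).V) (powerStr E S) m x t s = E.it m (x s) t
  | 0, _, _ => rfl
  | m + 1, x, t =>
    congrArg (fun y => ap (E.σ (n + m)) (smk y (t (Fin.last m))))
      (power_iter s m x (fun i => t i.castSucc))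

/-- The product `E^S` of copies of `E` indexed by a set `S`. -/
def power : SymSpectrum.{u} where
  lvl := powerLvl E S
  σ := powerStr E S
  equivariant {n m p} g h x t := funext fun s => by
    refine (power_iter E S s m _ _).trans ((E.equivariant g h (x s) t).trans ?_)
    exact congrArg (E.act (blockPerm g h)) (power_iter E S s m x t).symm

/-- The subspectrum of `E^S` of those tuples in which two entries coincide or one entry is the base
point (together with the base point of `E^S`, which is such a tuple unless `S` is empty). -/
def fatDiagonal : SubSpectrum (power E S) where
  carrier n p := {x : S → E.el n p | x = (fun _ => pt (E.lvl n).V p) ∨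
    (∃ s s', s ≠ s' ∧ x s = x s') ∨ ∃ s, x s = pt (E.lvl n).V p}
  pt_mem _ _ := Or.inl rfl
  rst_mem φ x := by
    rintro (h | ⟨s, s', hs, h⟩ | ⟨s, h⟩)
    · exact Or.inl (funext fun s => (congrArg (rst _ φ) (congrFun h s)).trans (rst_pt φ))
    · exact Or.inr (Or.inl ⟨s, s', hs, congrArg (rst _ φ) h⟩)
    · exact Or.inr (Or.inr ⟨s, (congrArg (rst _ φ) h).trans (rst_pt φ)⟩)
  act_mem g x := by
    rintro (h | ⟨s, s', hs, h⟩ | ⟨s, h⟩)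
    · exact Or.inl (funext fun s => (congrArg (E.act g) (congrFun h s)).trans (ap_pt _))
    · exact Or.inr (Or.inl ⟨s, s', hs, congrArg (E.act g) h⟩)
    · exact Or.inr (Or.inr ⟨s, (congrArg (E.act g) h).trans (ap_pt _)⟩)
  σ_mem {n p _} c := by
    have key : ∀ y : E.el n p, y = pt (E.lvl n).V p →
        ap (E.σ n) (smk y c) = pt (E.lvl (n + 1)).V p := by
      rintro _ rfl
      exact (congrArg (ap (E.σ n)) (smk_pt_left c)).trans (ap_pt _)
    rintro (h | ⟨s, s', hs, h⟩ | ⟨s, h⟩)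
    · exact Or.inl (funext fun s => key _ (congrFun h s))
    · exact Or.inr (Or.inl ⟨s, s', hs, congrArg (fun y => ap (E.σ n) (smk y c)) h⟩)
    · exact Or.inr (Or.inr ⟨s, key _ h⟩)

end power

/-! ### Smash products and latching objects -/

/-- The bijection `A ⊔ (B ∖ γ(A)) ≅ B` given by an injection `γ : A → B`. -/
noncomputable def split {A B : Type} (γ : A ↪ B) : A ⊕ {b : B // b ∉ Set.range γ} ≃ B :=
  Equiv.ofBijective (Sum.elim γ Subtype.val) (by
    constructor
    · rintro (a | ⟨b, hb⟩) (a' | ⟨b', hb'⟩) h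
      · exact congrArg Sum.inl (γ.injective h)
      · exact absurd ⟨a, h⟩ hb'
      · exact absurd ⟨a', h.symm⟩ hb
      · exact congrArg Sum.inr (Subtype.ext h)
    · intro b
      by_cases hb : b ∈ Set.range γ
      · obtain ⟨a, rfl⟩ := hb
        exact ⟨Sum.inl a, rfl⟩
      · exact ⟨Sum.inr ⟨b, hb⟩, rfl⟩)

/-- A `p`-simplex `x ∧ y ∧ z` of `E(k) ∧ F(k') ∧ S^{n - α}`, where `α : k ⊔ k' → n` is injective. -/
structure SmashRep (E F : SymSpectrum.{u}) (n : ℕ) (p : SimplexCategoryᵒᵖ) : Type u where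
  k : ℕ
  k' : ℕ
  α : Fin k ⊕ Fin k' ↪ Fin n
  x : E.el k p
  y : F.el k' p
  z : {i : Fin n // i ∉ Set.range α} → circle.{u}.obj p

namespace SmashRep

variable {E E' F : SymSpectrum.{u}} {n : ℕ} {p q : SimplexCategoryᵒᵖ}

/-- The simplex `x ∧ y ∧ z` is the base point because some factor is. -/
def IsBase (r : SmashRep E F n p) : Prop :=
  r.x = pt _ p ∨ r.y = pt _ p ∨ ∃ i, r.z i = pt circle p

/-- A morphism `(γ, γ')` from `α = β ∘ (γ ⊔ γ')` to `β` sends `x ∧ y ∧ z` to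
`E(γ)(x ∧ z|) ∧ F(γ')(y ∧ z|) ∧ z|`, the coordinates of `z` being distributed according to
`n - α ≅ (l - γ) ⊔ (l' - γ') ⊔ (n - β)`. -/
noncomputable def move {k k' l l' : ℕ} (γ : Fin k ↪ Fin l) (γ' : Fin k' ↪ Fin l')
    (β : Fin l ⊕ Fin l' ↪ Fin n) (x : E.el k p) (y : F.el k' p)
    (z : {i : Fin n // i ∉ Set.range ((γ.sumMap γ').trans β)} → circle.{u}.obj p) :
    SmashRep E F n p where
  k := l
  k' := l'
  α := β
  x := E.genEl (split γ) x (fun j => z ⟨β (Sum.inl j.1), by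
    rintro ⟨i | i, hi⟩
    · have := β.injective hi
      exact j.2 ⟨i, Sum.inl.inj this⟩
    · have := β.injective hi
      cases this⟩)
  y := F.genEl (split γ') y (fun j => z ⟨β (Sum.inr j.1), by
    rintro ⟨i | i, hi⟩
    · have := β.injective hi
      cases this
    · have := β.injective hi
      exact j.2 ⟨i, Sum.inr.inj this⟩⟩)
  z := fun i => z ⟨i.1, by
    rintro ⟨j, hj⟩
    exact i.2 ⟨_, hj⟩⟩

/-- The identifications made in the colimit. -/
inductive Rel : SmashRep E F n p → SmashRep E F n p → Prop
  | base (r r' : SmashRep E F n p) : r.IsBase → r'.IsBase → Rel r r'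
  | move {k k' l l' : ℕ} (γ : Fin k ↪ Fin l) (γ' : Fin k' ↪ Fin l')
      (β : Fin l ⊕ Fin l' ↪ Fin n) (x : E.el k p) (y : F.el k' p)
      (z : {i : Fin n // i ∉ Set.range ((γ.sumMap γ').trans β)} → circle.{u}.obj p) :
      Rel ⟨k, k', (γ.sumMap γ').trans β, x, y, z⟩ (move γ γ' β x y z)

/-- A representative of the base point. -/
def basePt : SmashRep E F n p where
  k := 0
  k' := 0
  α := ⟨Sum.elim Fin.elim0 Fin.elim0, by rintro (i | i) <;> exact i.elim0⟩
  x := pt _ p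
  y := pt _ p
  z := fun _ => pt circle p

theorem basePt_isBase : (basePt : SmashRep E F n p).IsBase := Or.inl rfl

/-- Simplicial operators. -/
def res (φ : p ⟶ q) (r : SmashRep E F n p) : SmashRep E F n q where
  k := r.k
  k' := r.k'
  α := r.α
  x := rst _ φ r.x
  y := rst _ φ r.y
  z := fun i => rst _ φ (r.z i)

theorem res_isBase (φ : p ⟶ q) {r : SmashRep E F n p} (h : r.IsBase) : (res φ r).IsBase := by
  rcases h with h | h | ⟨i, h⟩
  · exact Or.inl ((congrArg (rst _ φ) h).trans (rst_pt φ))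
  · exact Or.inr (Or.inl ((congrArg (rst _ φ) h).trans (rst_pt φ)))
  · exact Or.inr (Or.inr ⟨i, (congrArg (rst _ φ) h).trans (rst_pt φ)⟩)

theorem res_rel (φ : p ⟶ q) {r r' : SmashRep E F n p} (h : Rel r r') :
    Rel (res φ r) (res φ r') := by
  cases h with
  | base _ _ h h' => exact Rel.base _ _ (res_isBase φ h) (res_isBase φ h')
  | move γ γ' β x y z =>
    have := Rel.move γ γ' β (rst _ φ x) (rst _ φ y) (fun i => rst _ φ (z i))
    unfold move at this
    rw [E.rst_genEl (split γ) φ x, F.rst_genEl (split γ') φ y] at this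
    exact this

/-- Permutations of `n`. -/
def perm (g : Equiv.Perm (Fin n)) (r : SmashRep E F n p) : SmashRep E F n p where
  k := r.k
  k' := r.k'
  α := r.α.trans g.toEmbedding
  x := r.x
  y := r.y
  z := fun i => r.z ⟨g⁻¹ i.1, by
    rintro ⟨j, hj⟩
    exact i.2 ⟨j, by simp [hj]⟩⟩

theorem perm_isBase (g : Equiv.Perm (Fin n)) {r : SmashRep E F n p} (h : r.IsBase) :
    (perm g r).IsBase := by
  rcases h with h | h | ⟨i, h⟩
  · exact Or.inl h
  · exact Or.inr (Or.inl h)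
  · refine Or.inr (Or.inr ⟨⟨g i.1, ?_⟩, ?_⟩)
    · rintro ⟨j, hj⟩
      exact i.2 ⟨j, g.injective hj⟩
    · simpa [perm] using h

theorem perm_rel (g : Equiv.Perm (Fin n)) {r r' : SmashRep E F n p} (h : Rel r r') :
    Rel (perm g r) (perm g r') := by
  cases h with
  | base _ _ h h' => exact Rel.base _ _ (perm_isBase g h) (perm_isBase g h')
  | move γ γ' β x y z =>
    have := Rel.move γ γ' (β.trans g.toEmbedding) x y
      (fun i => z ⟨g⁻¹ i.1, by
        rintro ⟨j, hj⟩
        exact i.2 ⟨j, by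
          have h2 : β ((γ.sumMap γ') j) = g⁻¹ i.1 := hj
          exact (congrArg g h2).trans (g.apply_symm_apply _)⟩⟩)
    simp only [move, Function.Embedding.trans_apply, Equiv.coe_toEmbedding,
      Equiv.Perm.inv_def, Equiv.symm_apply_apply] at this
    exact this

/-- Functoriality in the first spectrum. -/
def mapLeft (a : E ⟶ E') (r : SmashRep E F n p) : SmashRep E' F n p where
  k := r.k
  k' := r.k'
  α := r.α
  x := SymSpectrum.Hom.ev a r.x
  y := r.y
  z := r.z

theorem mapLeft_isBase (a : E ⟶ E') {r : SmashRep E F n p} (h : r.IsBase) :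
    (mapLeft a r).IsBase := by
  rcases h with h | h | h
  · exact Or.inl ((congrArg (SymSpectrum.Hom.ev a) h).trans (ap_pt _))
  · exact Or.inr (Or.inl h)
  · exact Or.inr (Or.inr h)

theorem mapLeft_rel (a : E ⟶ E') {r r' : SmashRep E F n p} (h : Rel r r') :
    Rel (mapLeft a r) (mapLeft a r') := by
  cases h with
  | base _ _ h h' => exact Rel.base _ _ (mapLeft_isBase a h) (mapLeft_isBase a h')
  | move γ γ' β x y z =>
    have := Rel.move γ γ' β (SymSpectrum.Hom.ev a x) y z
    unfold move at this
    rw [← SymSpectrum.ev_genEl a (split γ) x] at this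
    exact this

end SmashRep

/-- The `n`-th level of the smash product `E ∧ F`, as a based `Σ_n`-space: the colimit of
`E(k) ∧ F(k') ∧ S^{n - α}` over the category of injections `α : k ⊔ k' → n`. -/
def smashLevel (E F : SymSpectrum.{u}) (n : ℕ) : Action BSSet.{u} (Equiv.Perm (Fin n)) where
  V := mkBSSet (fun p => Quot (SmashRep.Rel (E := E) (F := F) (n := n) (p := p)))
    (fun _ => Quot.mk _ SmashRep.basePt)
    (fun φ => Quot.map (SmashRep.res φ) (fun _ _ => SmashRep.res_rel φ))
    (fun φ => Quot.sound (.base _ _ (SmashRep.res_isBase φ SmashRep.basePt_isBase)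
      SmashRep.basePt_isBase))
    (fun x => by
      induction x using Quot.ind with
      | mk r =>
        refine congrArg (Quot.mk _) ?_
        cases r
        simp only [SmashRep.res, rst_id])
    (fun φ ψ x => by
      induction x using Quot.ind with
      | mk r =>
        refine congrArg (Quot.mk _) ?_
        cases r
        simp only [SmashRep.res, rst_comp]
        rfl)
  ρ :=
    { toFun g := mkHom (fun _ => Quot.map (SmashRep.perm g) (fun _ _ => SmashRep.perm_rel g))
        (fun _ => Quot.sound (.base _ _ (SmashRep.perm_isBase g SmashRep.basePt_isBase)
          SmashRep.basePt_isBase))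
        (fun φ x => by
          induction x using Quot.ind with
          | mk r => rfl)
      map_one' := hom_ext fun _ x => by
        induction x using Quot.ind with
        | mk r => rfl
      map_mul' g h := hom_ext fun _ x => by
        induction x using Quot.ind with
        | mk r =>
          refine congrArg (Quot.mk _) ?_
          cases r
          simp only [SmashRep.perm, mul_inv_rev]
          rfl }

/-- The functor `E ↦ E_n` to based `Σ_n`-spaces. -/
def level (n : ℕ) : SymSpectrum.{u} ⥤ Action BSSet.{u} (Equiv.Perm (Fin n)) where
  obj E := E.lvl n
  map a := SymSpectrum.Hom.f a n

/-- The `n`-th latching object `L_n(E) = (E ∧ 𝕊̄)_n`, where `𝕊̄` is the truncated sphere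
spectrum. -/
def latching (n : ℕ) : SymSpectrum.{u} ⥤ Action BSSet.{u} (Equiv.Perm (Fin n)) where
  obj E := smashLevel E truncSphere.toSpectrum n
  map {E E'} a :=
    { hom := mkHom (fun _ => Quot.map (SmashRep.mapLeft a) (fun _ _ => SmashRep.mapLeft_rel a))
        (fun _ => Quot.sound (.base _ _ (SmashRep.mapLeft_isBase a SmashRep.basePt_isBase)
          SmashRep.basePt_isBase))
        (fun φ x => by
          induction x using Quot.ind with
          | mk r =>
            refine congrArg (Quot.mk _) ?_
            cases r
            simp only [SmashRep.mapLeft, SmashRep.res, SymSpectrum.Hom.ev, ap_rst]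
            rfl)
      comm := fun g => hom_ext fun _ x => by
        induction x using Quot.ind with
        | mk r => rfl }
  map_id E := Action.hom_ext _ _ (hom_ext fun _ x => by
    induction x using Quot.ind with
    | mk r => rfl)
  map_comp a b := Action.hom_ext _ _ (hom_ext fun _ x => by
    induction x using Quot.ind with
    | mk r => rfl)

/-- The generalized structure map of the sphere spectrum on tuples. -/
theorem sphereSpectrum_genEl {k n : ℕ} {M : Type} [Finite M] {p : SimplexCategoryᵒᵖ}
    (τ : Fin k ⊕ M ≃ Fin n) (t : Fin k → circle.{u}.obj p) (s : M → circle.{u}.obj p) :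
    sphereSpectrum.{u}.genEl τ (sph t : (sphere (Fin k)).obj p) s =
      (sph (fun i => Sum.elim t s (τ.symm i)) : (sphere (Fin n)).obj p) := by
  have key : ∀ {m n : ℕ} (e : Fin m ≃ Fin n) (v : Fin m → circle.{u}.obj p),
      sphereSpectrum.{u}.relabel e (sph v : (sphere (Fin m)).obj p) =
        (sph (fun i => v (e.symm i)) : (sphere (Fin n)).obj p) := by
    intro m n e v
    obtain rfl : m = n := by simpa using Fintype.card_congr e
    rfl
  have h : sphereSpectrum.{u}.it (n := k) (Nat.card M) (sph t : (sphere (Fin k)).obj p)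
      (fun i => s ((Finite.equivFin M).symm i)) = _ := sphere_iter t _ _
  unfold SymSpectrum.genEl SymSpectrum.push
  rw [h]
  refine (key _ _).trans (congrArg sph (funext fun i => ?_))
  obtain ⟨j, rfl⟩ := τ.surjective i
  cases j with
  | inl j => simp
  | inr j => simp

namespace SmashRep

variable {E : SymSpectrum.{u}} {n : ℕ} {p q : SimplexCategoryᵒᵖ}

/-- The bijection `k ⊔ (k' ⊔ (n - α)) ≅ n` given by an injection `α : k ⊔ k' → n`. -/
noncomputable def split₃ {k k' : ℕ} (α : Fin k ⊕ Fin k' ↪ Fin n) :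
    Fin k ⊕ (Fin k' ⊕ {i : Fin n // i ∉ Set.range α}) ≃ Fin n :=
  (Equiv.sumAssoc _ _ _).symm.trans (split α)

/-- The map `E(k) ∧ 𝕊̄(k') ∧ S^{n - α} → E(n)` given by the inclusion `𝕊̄(k') → S^{k'}` and the
generalized structure map of `E`. -/
noncomputable def toLevel (r : SmashRep E truncSphere.toSpectrum n p) : E.el n p :=
  sphLift (fun t => E.genEl (split₃ r.α) r.x (Sum.elim t r.z)) (pt _ p)
    (fun _ i hi => SymSpectrum.genEl_eq_pt _ _ _ (Sum.inl i) hi)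
    (SymSpectrum.Hom.ev truncSphere.ι r.y)

theorem toLevel_isBase {r : SmashRep E truncSphere.toSpectrum n p} (h : r.IsBase) :
    r.toLevel = pt _ p := by
  unfold toLevel
  have hs : ∀ (F : (Fin r.k' → circle.{u}.obj p) → E.el n p) (hF)
      (_ : ∀ t, F t = pt (E.lvl n).V p) (s : (sphere (Fin r.k')).obj p),
      sphLift F (pt _ p) hF s = pt _ p := by
    intro F hF hF' s
    induction s using sph_ind with
    | hb => rfl
    | hm t => exact hF' t
  rcases h with h | h | ⟨i, h⟩
  · exact hs _ _ (fun t => by rw [h]; exact SymSpectrum.genEl_pt _ _) _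
  · rw [h]
    exact sphLift_pt _ _ _
  · exact hs _ _ (fun t => SymSpectrum.genEl_eq_pt _ _ _ (Sum.inr i) h) _

theorem toLevel_rel {r r' : SmashRep E truncSphere.toSpectrum n p} (h : Rel r r') :
    r.toLevel = r'.toLevel := by
  cases h with
  | base _ _ h h' => rw [toLevel_isBase h, toLevel_isBase h']
  | @move k k' l l' γ γ' β x y z =>
    unfold toLevel move
    simp only [SymSpectrum.ev_genEl]
    generalize SymSpectrum.Hom.ev truncSphere.ι y = y
    change (sphere.{u} (Fin k')).obj p at y
    induction y using sph_ind with
    | hb =>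
      rw [sphLift_pt]
      exact (congrArg (sphLift _ _ _)
        (SymSpectrum.genEl_pt (E := sphereSpectrum) (split γ') _)).symm
    | hm t =>
      rw [sphLift_sph]
      refine Eq.symm ((congrArg _ (sphereSpectrum_genEl (split γ') t _)).trans ?_)
      rw [sphLift_sph, SymSpectrum.genEl_genEl]
      refine SymSpectrum.genEl_congr _ _ _ _ _ (fun i => rfl) ?_
      rintro (⟨j, hj⟩ | j | ⟨j, hj⟩) (i | ⟨i, hi⟩) h
      · have h' : β (Sum.inl j) = β (Sum.inr (γ' i)) := h
        cases β.injective h'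
      · have h' : β (Sum.inl j) = i := h
        subst h'
        rfl
      · have h' : β (Sum.inr j) = β (Sum.inr (γ' i)) := h
        obtain rfl : j = γ' i := Sum.inr.inj (β.injective h')
        have h2 : (split γ').symm (γ' i) = Sum.inl i := (split γ').symm_apply_apply (Sum.inl i)
        simp [h2]
      · have h' : β (Sum.inr j) = i := h
        subst h'
        have hj : j ∉ Set.range γ' := by
          rintro ⟨m, rfl⟩
          exact hi ⟨Sum.inr m, rfl⟩
        have h2 : (split γ').symm j = Sum.inr ⟨j, hj⟩ :=
          (split γ').symm_apply_apply (Sum.inr ⟨j, hj⟩)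
        simp [h2]
      · have h' : j = β (Sum.inr (γ' i)) := h
        exact absurd ⟨_, h'.symm⟩ hj
      · have h' : j = i := h
        subst h'
        rfl

theorem toLevel_res (φ : p ⟶ q) (r : SmashRep E truncSphere.toSpectrum n p) :
    (res φ r).toLevel = rst _ φ r.toLevel := by
  cases r with
  | mk k k' α x y z =>
    unfold toLevel res
    simp only [SymSpectrum.Hom.ev, ap_rst]
    generalize ap (SymSpectrum.Hom.f truncSphere.ι k').hom y = y
    change (sphere.{u} (Fin k')).obj p at y
    induction y using sph_ind with
    | hb => exact (rst_pt φ).symm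
    | hm t =>
      refine Eq.trans ?_ (SymSpectrum.rst_genEl (split₃ α) φ x (Sum.elim t z))
      refine SymSpectrum.genEl_congr _ _ _ _ _ (fun _ => rfl) ?_
      intro j j' h
      obtain rfl : j = j' := Sum.inr.inj ((split₃ α).injective h)
      cases j <;> rfl

theorem toLevel_perm (g : Equiv.Perm (Fin n)) (r : SmashRep E truncSphere.toSpectrum n p) :
    (perm g r).toLevel = E.act g r.toLevel := by
  cases r with
  | mk k k' α x y z =>
    unfold toLevel perm
    simp only
    generalize SymSpectrum.Hom.ev truncSphere.ι y = y
    change (sphere.{u} (Fin k')).obj p at y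
    induction y using sph_ind with
    | hb => exact (ap_pt _).symm
    | hm t =>
      refine Eq.trans ?_ (SymSpectrum.act_genEl g (split₃ α) x (Sum.elim t z)).symm
      refine SymSpectrum.genEl_congr _ _ _ _ _ (fun _ => rfl) ?_
      rintro (j | ⟨j, hj⟩) (i | ⟨i, hi⟩) h
      · have h' : g (α (Sum.inr j)) = g (α (Sum.inr i)) := h
        obtain rfl : j = i := Sum.inr.inj (α.injective (g.injective h'))
        rfl
      · have h' : g (α (Sum.inr j)) = g i := h
        exact absurd ⟨_, g.injective h'⟩ hi
      · have h' : j = g (α (Sum.inr i)) := h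
        exact absurd ⟨_, h'.symm⟩ hj
      · have h' : j = g i := h
        subst h'
        simp

theorem toLevel_mapLeft {E' : SymSpectrum.{u}} (a : E ⟶ E')
    (r : SmashRep E truncSphere.toSpectrum n p) :
    (mapLeft a r).toLevel = SymSpectrum.Hom.ev a r.toLevel := by
  cases r with
  | mk k k' α x y z =>
    unfold toLevel mapLeft
    simp only
    generalize SymSpectrum.Hom.ev truncSphere.ι y = y
    change (sphere.{u} (Fin k')).obj p at y
    induction y using sph_ind with
    | hb => exact (ap_pt _).symm
    | hm t => exact (SymSpectrum.ev_genEl a (split₃ α) x (Sum.elim t z)).symm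

end SmashRep

/-- The latching maps `ν_n(E) : L_n(E) → E_n`. -/
noncomputable def latchingMap (n : ℕ) : latching.{u} n ⟶ level n where
  app E :=
    { hom := mkHom (fun _ => Quot.lift SmashRep.toLevel (fun _ _ => SmashRep.toLevel_rel))
        (fun _ => SmashRep.toLevel_isBase SmashRep.basePt_isBase)
        (fun φ x => by
          induction x using Quot.ind with
          | mk r => exact SmashRep.toLevel_res φ r)
      comm := fun g => hom_ext fun _ x => by
        induction x using Quot.ind with
        | mk r => exact SmashRep.toLevel_perm g r }
  naturality E E' a := Action.hom_ext _ _ (hom_ext fun _ x => by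
    induction x using Quot.ind with
    | mk r => exact SmashRep.toLevel_mapLeft a r)

/-- For a natural transformation `ν : L ⟶ U` and a morphism `f : X ⟶ Y`, the induced morphism
`U(X) ∪_{L(X)} L(Y) ⟶ U(Y)`. -/
noncomputable def relLatchingMap {C D : Type*} [Category* C] [Category* D] [HasPushouts D]
    {L U : C ⥤ D} (ν : L ⟶ U) {X Y : C} (f : X ⟶ Y) :
    pushout (ν.app X) (L.map f) ⟶ U.obj Y :=
  pushout.desc (U.map f) (ν.app Y) (ν.naturality f).symm

/-! ### Equivariant cofibrations -/

section equivariant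

variable {K : Type v} [Group K]

/-- The simplicial set of `H`-fixed points of a based `K`-space. -/
def fixedPoints (X : Action BSSet.{u} K) (H : Subgroup K) : (forgetBase.obj X.V).Subcomplex where
  obj p := {x : X.V.obj p | ∀ h ∈ H, ap (X.ρ h) x = x}
  map φ x hx h hh := (ap_rst (X.ρ h) φ x).trans (congrArg (rst X.V φ) (hx h hh))

/-- The map `f^H` on `H`-fixed points. -/
def fixedPointsMap {X Y : Action BSSet.{u} K} (f : X ⟶ Y) (H : Subgroup K) :
    (fixedPoints X H : SSet.{u}) ⟶ (fixedPoints Y H : SSet.{u}) where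
  app p := ↾ fun x => ⟨ap f.hom x.1, fun h hh => by
    have h1 : ap f.hom (ap (X.ρ h) x.1) = ap (Y.ρ h) (ap f.hom x.1) :=
      congrArg (fun m : X.V ⟶ Y.V => ap m x.1) (f.comm h)
    exact h1.symm.trans (congrArg (ap f.hom) (x.2 h hh))⟩
  naturality p q φ := by
    apply ConcreteCategory.hom_ext
    intro x
    exact Subtype.ext (ap_rst f.hom φ x.1)

/-- Kan fibrations of simplicial sets. -/
def kanFibrations : MorphismProperty SSet.{u} := SSet.modelCategoryQuillen.J.rlp

/-- Weak equivalences of simplicial sets: the composites of an anodyne extension followed by a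
trivial Kan fibration (a map with the right lifting property with respect to the inclusions of the
boundaries of simplices). In the Kan-Quillen model structure every weak equivalence factors as an
acyclic cofibration (that is, an anodyne extension) followed by an acyclic fibration (that is, a
trivial Kan fibration), and conversely such a composite is a weak equivalence. -/
def weakEquivalences : MorphismProperty SSet.{u} :=
  SSet.anodyneExtensions.comp SSet.modelCategoryQuillen.I.rlp

/-- `K`-fibrations: `f^H` is a Kan fibration for all subgroups `H`. -/
def IsEquivariantFibration {X Y : Action BSSet.{u} K} (f : X ⟶ Y) : Prop :=
  ∀ H : Subgroup K, kanFibrations (fixedPointsMap f H)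

/-- `K`-equivalences: `f^H` is a weak equivalence for all subgroups `H`. -/
def IsEquivariantEquivalence {X Y : Action BSSet.{u} K} (f : X ⟶ Y) : Prop :=
  ∀ H : Subgroup K, weakEquivalences (fixedPointsMap f H)

/-- `K`-cofibrations of based `K`-spaces: the maps with the left lifting property with respect to
all acyclic `K`-fibrations. -/
def IsEquivariantCofibration {X Y : Action BSSet.{u} K} (f : X ⟶ Y) : Prop :=
  ∀ ⦃Z W : Action BSSet.{u} K⦄ (q : Z ⟶ W),
    IsEquivariantFibration q → IsEquivariantEquivalence q → HasLiftingProperty f q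

end equivariant

/-- Cofibrations of based spaces: the underlying map of simplicial sets is a monomorphism. -/
def IsCofibration {X Y : BSSet.{u}} (f : X ⟶ Y) : Prop := Mono (forgetBase.map f)

/-! ### Flat cofibrations -/

/-- Flat cofibrations of symmetric spectra: `ν_n(f) : X_n ∪_{L_n X} L_n Y → Y_n` is a
`Σ_n`-cofibration for all `n`. -/
def IsFlatCofibration {X Y : SymSpectrum.{u}} (f : X ⟶ Y) : Prop :=
  ∀ n, IsEquivariantCofibration (relLatchingMap (latchingMap n) f)

/-- Flat symmetric spectra. -/
def IsFlat (X : SymSpectrum.{u}) : Prop := IsFlatCofibration (fromPoint X)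

/-- A `G`-object in `H`-objects is a `G × H`-object. -/
def uncurryAction (V : Type*) [Category* V] (G H : Type*) [Group G] [Group H] :
    Action (Action V H) G ⥤ Action V (G × H) where
  obj A :=
    { V := A.V.V
      ρ :=
        { toFun gh := A.V.ρ gh.2 ≫ Action.Hom.hom (A.ρ gh.1)
          map_one' := by
            have h1 : A.V.ρ (1 : G × H).2 = 𝟙 A.V.V := Action.ρ_one _
            have h2 : A.ρ (1 : G × H).1 = 𝟙 A.V := Action.ρ_one _
            rw [h1, h2]
            exact Category.id_comp _
          map_mul' a b := by
            have h1 : A.V.ρ (a * b).2 = A.V.ρ b.2 ≫ A.V.ρ a.2 := map_mul A.V.ρ a.2 b.2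
            have h2 : A.ρ (a * b).1 = A.ρ b.1 ≫ A.ρ a.1 := map_mul A.ρ a.1 b.1
            have h3 : A.V.ρ a.2 ≫ Action.Hom.hom (A.ρ b.1) =
              Action.Hom.hom (A.ρ b.1) ≫ A.V.ρ a.2 := Action.Hom.comm (A.ρ b.1) a.2
            rw [h1, h2]
            change (A.V.ρ b.2 ≫ A.V.ρ a.2) ≫ Action.Hom.hom (A.ρ b.1) ≫ Action.Hom.hom (A.ρ a.1) =
              (A.V.ρ b.2 ≫ Action.Hom.hom (A.ρ b.1)) ≫ A.V.ρ a.2 ≫ Action.Hom.hom (A.ρ a.1)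
            rw [Category.assoc, Category.assoc, reassoc_of% h3] } }
  map {A B} f :=
    { hom := f.hom.hom
      comm := fun g => by
        have h1 : A.V.ρ g.2 ≫ f.hom.hom = f.hom.hom ≫ B.V.ρ g.2 := f.hom.comm g.2
        have h2 : Action.Hom.hom (A.ρ g.1) ≫ f.hom.hom = f.hom.hom ≫ Action.Hom.hom (B.ρ g.1) :=
          congrArg Action.Hom.hom (f.comm g.1)
        change (A.V.ρ g.2 ≫ Action.Hom.hom (A.ρ g.1)) ≫ f.hom.hom =
          f.hom.hom ≫ B.V.ρ g.2 ≫ Action.Hom.hom (B.ρ g.1)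
        rw [Category.assoc, h2, reassoc_of% h1] }

/-- `G`-symmetric spectra: `G`-objects in symmetric spectra. -/
abbrev GSymSpectrum (G : Type v) [Group G] := Action SymSpectrum.{u} G

section G

variable {G : Type v} [Group G]

/-- The functor sending a `G`-symmetric spectrum `X` to the based `G × Σ_n`-space `X_n`. -/
def levelG (G : Type v) [Group G] (n : ℕ) :
    GSymSpectrum.{u} G ⥤ Action BSSet.{u} (G × Equiv.Perm (Fin n)) :=
  (level n).mapAction G ⋙ uncurryAction BSSet G (Equiv.Perm (Fin n))

/-- The functor sending a `G`-symmetric spectrum `X` to the based `G × Σ_n`-space `L_n(X)`. -/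
def latchingG (G : Type v) [Group G] (n : ℕ) :
    GSymSpectrum.{u} G ⥤ Action BSSet.{u} (G × Equiv.Perm (Fin n)) :=
  (latching n).mapAction G ⋙ uncurryAction BSSet G (Equiv.Perm (Fin n))

/-- The latching maps of `G`-symmetric spectra; the underlying maps are those of the underlying
symmetric spectra. -/
noncomputable def latchingMapG (G : Type v) [Group G] (n : ℕ) :
    latchingG.{u} G n ⟶ levelG G n :=
  Functor.whiskerRight
    (show (latching n).mapAction G ⟶ (level n).mapAction G from
      { app := fun X =>
          { hom := (latchingMap n).app X.V
            comm := fun g => (latchingMap n).naturality (X.ρ g) }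
        naturality := fun _ _ f => Action.hom_ext _ _ ((latchingMap n).naturality f.hom) })
    (uncurryAction BSSet G (Equiv.Perm (Fin n)))

/-- `G`-flat cofibrations of `G`-symmetric spectra: `ν_n(f) : X_n ∪_{L_n X} L_n Y → Y_n` is a
`G × Σ_n`-cofibration for all `n`. -/
def IsGFlatCofibration {X Y : GSymSpectrum.{u} G} (f : X ⟶ Y) : Prop :=
  ∀ n, IsEquivariantCofibration (relLatchingMap (latchingMapG G n) f)

/-- The morphism from the trivial `G`-symmetric spectrum. -/
def fromPointG (X : GSymSpectrum.{u} G) : Action.trivial G pointSpectrum.{u} ⟶ X where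
  hom := fromPoint X.V
  comm g := SymSpectrum.Hom.ext (funext fun _ => Action.hom_ext _ _ (hom_ext fun _ _ =>
    (ap_pt (SymSpectrum.Hom.f (X.ρ g) _).hom).symm))

/-- `G`-flat `G`-symmetric spectra. -/
def IsGFlat (X : GSymSpectrum.{u} G) : Prop := IsGFlatCofibration (fromPointG X)

variable (X : GSymSpectrum.{u} G) (S : Type) [MulAction G S]

theorem ρ_one_ev {n : ℕ} {p : SimplexCategoryᵒᵖ} (x : X.V.el n p) :
    SymSpectrum.Hom.ev (X.ρ 1 : X.V ⟶ X.V) x = x := by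
  have h : X.ρ 1 = 𝟙 X.V := Action.ρ_one _
  rw [h]
  rfl

theorem ρ_mul_ev (g h : G) {n : ℕ} {p : SimplexCategoryᵒᵖ} (x : X.V.el n p) :
    SymSpectrum.Hom.ev (X.ρ (g * h) : X.V ⟶ X.V) x =
      SymSpectrum.Hom.ev (X.ρ g : X.V ⟶ X.V) (SymSpectrum.Hom.ev (X.ρ h : X.V ⟶ X.V) x) := by
  have h : X.ρ (g * h) = (X.ρ h : X.V ⟶ X.V) ≫ (X.ρ g : X.V ⟶ X.V) := map_mul X.ρ g h
  rw [h]
  rfl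

/-- The action of `g` on `X^S`: `(g x)_s = g (x_{g⁻¹ s})`. -/
def powerAct (g : G) : power X.V S ⟶ power X.V S where
  f n :=
    { hom := mkHom (fun _ x s => SymSpectrum.Hom.ev (X.ρ g : X.V ⟶ X.V) (x (g⁻¹ • s)))
        (fun _ => funext fun _ => ap_pt _)
        (fun φ x => funext fun s => ap_rst _ φ (x (g⁻¹ • s)))
      comm := fun h => hom_ext fun _ x => funext fun s =>
        SymSpectrum.ev_act (X.ρ g : X.V ⟶ X.V) h (x (g⁻¹ • s)) }
  comm n := hom_ext fun _ x => by
    induction x using smash_ind with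
    | h a c => exact funext fun s =>
        congrArg (fun m => ap m (smk (a (g⁻¹ • s)) c)) (SymSpectrum.Hom.comm (X.ρ g) n)

/-- The `G`-symmetric spectrum `X^S` for a `G`-set `S`. -/
def powerG : GSymSpectrum.{u} G where
  V := power X.V S
  ρ :=
    { toFun := powerAct X S
      map_one' := SymSpectrum.Hom.ext (funext fun _ => Action.hom_ext _ _ (hom_ext fun _ x =>
        funext fun s => (ρ_one_ev X _).trans
          (congrArg x (show (1 : G)⁻¹ • s = s by rw [inv_one, one_smul]))))
      map_mul' g h := SymSpectrum.Hom.ext (funext fun _ => Action.hom_ext _ _ (hom_ext fun _ x =>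
        funext fun s => (ρ_mul_ev X g h _).trans (by
          rw [mul_inv_rev, mul_smul]
          rfl))) }

theorem powerAct_mem (g : G) {n : ℕ} {p : SimplexCategoryᵒᵖ} (x : (power X.V S).el n p)
    (hx : x ∈ (fatDiagonal X.V S).carrier n p) :
    SymSpectrum.Hom.ev (powerAct X S g) x ∈ (fatDiagonal X.V S).carrier n p := by
  rcases hx with h | ⟨s, s', hs, h⟩ | ⟨s, h⟩
  · subst h
    exact Or.inl (ap_pt _)
  · refine Or.inr (Or.inl ⟨g • s, g • s', fun h => hs (MulAction.injective g h), ?_⟩)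
    change SymSpectrum.Hom.ev (X.ρ g : X.V ⟶ X.V) (x (g⁻¹ • g • s)) =
      SymSpectrum.Hom.ev (X.ρ g : X.V ⟶ X.V) (x (g⁻¹ • g • s'))
    rw [inv_smul_smul, inv_smul_smul, h]
  · refine Or.inr (Or.inr ⟨g • s, ?_⟩)
    change SymSpectrum.Hom.ev (X.ρ g : X.V ⟶ X.V) (x (g⁻¹ • g • s)) = _
    rw [inv_smul_smul, h]
    exact ap_pt _

/-- The action of `g` on the subspectrum `X^S_{≤ n-1}` of `X^S`. -/
def fatDiagonalAct (g : G) : (fatDiagonal X.V S).toSpectrum ⟶ (fatDiagonal X.V S).toSpectrum where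
  f n :=
    { hom := mkHom (fun _ x => ⟨SymSpectrum.Hom.ev (powerAct X S g) x.1, powerAct_mem X S g x.1 x.2⟩)
        (fun _ => Subtype.ext (ap_pt (SymSpectrum.Hom.f (powerAct X S g) n).hom))
        (fun φ x => Subtype.ext (ap_rst (SymSpectrum.Hom.f (powerAct X S g) n).hom φ x.1))
      comm := fun h => hom_ext fun _ x => Subtype.ext (SymSpectrum.ev_act (powerAct X S g) h x.1) }
  comm n := hom_ext fun _ x => by
    induction x using smash_ind with
    | h a c =>
      apply Subtype.ext
      exact congrArg (fun m => ap m (smk a.1 c)) (SymSpectrum.Hom.comm (powerAct X S g) n)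

/-- The `G`-symmetric spectrum `X^S_{≤ n-1}`, where `n` is the cardinality of `S`. -/
def fatDiagonalG : GSymSpectrum.{u} G where
  V := (fatDiagonal X.V S).toSpectrum
  ρ :=
    { toFun := fatDiagonalAct X S
      map_one' := SymSpectrum.Hom.ext (funext fun n => Action.hom_ext _ _ (hom_ext fun _ x =>
        Subtype.ext (show (_ : (power X.V S).el n _) = x.1 from
          ρ_one_ev (powerG X S) (n := n) x.1)))
      map_mul' g h := SymSpectrum.Hom.ext (funext fun n => Action.hom_ext _ _ (hom_ext fun _ x =>
        Subtype.ext (show (_ : (power X.V S).el n _) = SymSpectrum.Hom.ev (powerAct X S g)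
            (SymSpectrum.Hom.ev (powerAct X S h) x.1) from
          ρ_mul_ev (powerG X S) g h (n := n) x.1))) }

/-- The inclusion `X^S_{≤ n-1} → X^S`. -/
def fatDiagonalGι : fatDiagonalG X S ⟶ powerG X S where
  hom := (fatDiagonal X.V S).ι
  comm _ := rfl

end G

/-! ### The maps and squares in the characterization of flat cofibrations -/

section gluing

variable {X Y : SymSpectrum.{u}} (f : X ⟶ Y) {k l n : ℕ} {M M₁ M₂ : Type}

/-- For a bijection `k ⊔ M ≅ n`, the space `X(n) ∪_{X(k) ∧ S^M} Y(k) ∧ S^M`. -/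
noncomputable def glue [Finite M] (τ : Fin k ⊕ M ≃ Fin n) : BSSet.{u} :=
  pushout (X.gen τ) (smashMap (SymSpectrum.Hom.f f k).hom (𝟙 (sphere M)))

/-- The map `X(n) ∪_{X(k) ∧ S^M} Y(k) ∧ S^M → Y(n)`. -/
noncomputable def glueTo [Finite M] (τ : Fin k ⊕ M ≃ Fin n) : glue f τ ⟶ (Y.lvl n).V :=
  pushout.desc (SymSpectrum.Hom.f f n).hom (Y.gen τ) (SymSpectrum.gen_nat f τ)

/-- The map `E(k) ∧ S^{M₁ ⊔ M₂} → E(l) ∧ S^{M₂}` given by a bijection `k ⊔ M₁ ≅ l` (the coordinates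
of the sphere being indexed by `M ≅ M₁ ⊔ M₂`). -/
noncomputable def partialStr [Finite M₁] (E : SymSpectrum.{u}) (τ : Fin k ⊕ M₁ ≃ Fin l) (e : M ≃ M₁ ⊕ M₂) :
    smash (E.lvl k).V (sphere M) ⟶ smash (E.lvl l).V (sphere M₂) :=
  smashDesc (fun _ x => sphLift
      (fun t => smk (E.genEl τ x (fun i => t (e.symm (Sum.inl i))))
        (sph (fun i => t (e.symm (Sum.inr i))))) (pt _ _)
      (fun t i hi => by
        obtain ⟨j, rfl⟩ := e.symm.surjective i
        cases j with
        | inl j => rw [SymSpectrum.genEl_eq_pt τ x _ j hi, smk_pt_left]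
        | inr j =>
          rw [sph_eq_pt (t := fun i => t (e.symm (Sum.inr i))) (i := j) hi, smk_pt_right]))
    (fun p s => by
      induction s using sph_ind with
      | hb => rfl
      | hm t =>
        rw [sphLift_sph, SymSpectrum.genEl_pt, smk_pt_left])
    (fun _ _ => rfl)
    (fun φ x s => by
      induction s using sph_ind with
      | hb => exact (rst_pt φ).symm
      | hm t =>
        exact congrArg (fun y => smk y _) (SymSpectrum.rst_genEl τ φ x _))

theorem partialStr_nat [Finite M₁] (τ : Fin k ⊕ M₁ ≃ Fin l) (e : M ≃ M₁ ⊕ M₂) :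
    partialStr X τ e ≫ smashMap (SymSpectrum.Hom.f f l).hom (𝟙 (sphere M₂)) =
      smashMap (SymSpectrum.Hom.f f k).hom (𝟙 (sphere M)) ≫ partialStr Y τ e :=
  smash_sph_ext fun _ x t => congrArg (fun y => smk y _)
    (SymSpectrum.ev_genEl f τ x (fun i => t (e.symm (Sum.inl i))))

/-- The bijection `k ⊔ M ≅ n` obtained from `k ⊔ M₁ ≅ l` and `l ⊔ M₂ ≅ n`. -/
def compBij (τ : Fin k ⊕ M₁ ≃ Fin l) (θ : Fin l ⊕ M₂ ≃ Fin n) (e : M ≃ M₁ ⊕ M₂) :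
    Fin k ⊕ M ≃ Fin n :=
  (Equiv.sumCongr (Equiv.refl _) e).trans ((Equiv.sumAssoc _ _ _).symm.trans
    ((Equiv.sumCongr τ (Equiv.refl _)).trans θ))

theorem partialStr_gen [Finite M] [Finite M₁] [Finite M₂] (E : SymSpectrum.{u})
    (τ : Fin k ⊕ M₁ ≃ Fin l) (θ : Fin l ⊕ M₂ ≃ Fin n) (e : M ≃ M₁ ⊕ M₂) : partialStr E τ e ≫ E.gen θ = E.gen (compBij τ θ e) :=
  smash_sph_ext fun _ x t => by
    refine (SymSpectrum.genEl_genEl τ θ x (fun i => t (e.symm (Sum.inl i)))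
      (fun i => t (e.symm (Sum.inr i)))).trans ?_
    refine SymSpectrum.genEl_congr _ _ _ _ _ (fun _ => rfl) ?_
    intro j j' h
    have h2 : (Sum.inr j : Fin k ⊕ (M₁ ⊕ M₂)) = Sum.inr (e j') := by
      apply ((Equiv.sumAssoc (Fin k) M₁ M₂).symm.trans
        ((Equiv.sumCongr τ (Equiv.refl _)).trans θ)).injective
      exact h
    obtain rfl := Sum.inr.inj h2
    rcases hj : e j' with i | i
    · exact congrArg t (by rw [← hj, e.symm_apply_apply])
    · exact congrArg t (by rw [← hj, e.symm_apply_apply])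

/-- The map `X(n) ∪_{X(k) ∧ S^M} Y(k) ∧ S^M → X(n) ∪_{X(l) ∧ S^{M₂}} Y(l) ∧ S^{M₂}` given by
bijections `k ⊔ M₁ ≅ l`, `l ⊔ M₂ ≅ n` and `M ≅ M₁ ⊔ M₂`. -/
noncomputable def glueStep [Finite M] [Finite M₁] [Finite M₂] (τ : Fin k ⊕ M₁ ≃ Fin l)
    (θ : Fin l ⊕ M₂ ≃ Fin n) (e : M ≃ M₁ ⊕ M₂) (ω : Fin k ⊕ M ≃ Fin n) (hω : ω = compBij τ θ e) : glue f ω ⟶ glue f θ :=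
  pushout.map _ _ _ _ (𝟙 _) (partialStr Y τ e) (partialStr X τ e)
    (by rw [Category.comp_id, partialStr_gen, hω]) (partialStr_nat f τ e).symm

end gluing

/-- The bijection `l ⊔ (k ⊔ m) ≅ k + l + m`, where the blocks are ordered as `k, l, m`. -/
def midBlock (k l m : ℕ) : Fin l ⊕ (Fin k ⊕ Fin m) ≃ Fin (k + l + m) :=
  compBij ((Equiv.sumComm _ _).trans finSumFinEquiv) finSumFinEquiv (Equiv.refl _)

/-- The bijection `(l + m) ⊔ k ≅ k + l + m`, where the blocks are ordered as `k, l, m`. -/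
def lastBlocks (k l m : ℕ) : Fin (l + m) ⊕ Fin k ≃ Fin (k + l + m) :=
  (Equiv.sumComm _ _).trans (finSumFinEquiv.trans (finCongr (Nat.add_assoc k l m).symm))

theorem midBlock_eq (k l m : ℕ) : midBlock k l m =
    compBij finSumFinEquiv (lastBlocks k l m) (Equiv.sumComm (Fin k) (Fin m)) := by
  ext (i | i | i)
  · simp [midBlock, lastBlocks, compBij]
  · simp [midBlock, lastBlocks, compBij]
  · simp [midBlock, lastBlocks, compBij, Nat.add_assoc]

end SymSp

open SymSp

/-!
Everything is reduced to statements about simplices. For a finite group `K`, the `K`-cofibrations of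
based `K`-spaces are exactly the injections (`isEquivariantCofibration_iff`): for the lifting
property of an injection, Zorn's lemma is used to extend a lift over the orbit of one simplex at a
time, where a simplex with stabilizer `H` gives a lifting problem for `∂Δⁿ → Δⁿ` against a trivial
fibration of `H`-fixed points; and conversely a `K`-cofibration `X → Y` lifts against the map to the
point from a cofree object containing `X`. Hence `f` is a `G`-flat cofibration if and only if it is
a flat cofibration after forgetting the action of `G` (`isGFlatCofibration_iff`), and this means
that all maps `X(n) ∪_{L_n X} L_n Y → Y(n)` are injective.

For an injection `a : k → n` and a tuple `c` of simplices of the circle indexed by `n - a`, there is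
an operation `put a · c` from the simplices of `Y(k)` to those of `Y(n)`; these operations compose
like the coloured injections `(a, c)`, and the simplices of `L_n Y` are the formal images
`put a y c` for the injections `a` that are not bijective, modulo the evident relations. The injectivity of
the above maps for all `n` is equivalent to the complement of `X` in `Y` being *freely generated*
(`IsFree`, `isFlatCofibration_iff_isFree`): `f` is injective, the operations whose colours are not
the base point send simplices outside of `X` to simplices outside of `X`, and two presentations
`put a y c = put b z d` of a simplex outside of `X` come from one presentation over the pullback of `a`
and `b`. If this holds, then formal images with the same value have a common source and thus agree
in `L_n Y`. The converse is an induction on `n`: the relations defining `L_n Y` involve lower levels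
only, and free generation there shows that they preserve the property of having a common source with
a given simplex, so that this property is well defined on `X(n) ∪_{L_n X} L_n Y`.

Free generation is easily compared with the conditions of the theorem. For a bijection `k ⊔ M ≅ n`
and injective `f`, the map `X(n) ∪_{X(k) ∧ S^M} Y(k) ∧ S^M → Y(n)` is injective if and only if the
simplices outside of `X` stay outside and are determined by their images, and the pullback squares
say that common sources exist for two injections in standard position; every pair of injections is
in standard position up to permutations (`exists_three_blocks`, `isFree_iff_glueTo`). For a
subspectrum of a flat spectrum common sources are inherited, so only the closure of the complement
under the operations remains (`isFree_ι_iff_inter`). In a power of a flat spectrum, the common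
sources of the entries of two tuples are all taken over the same pullback and therefore form a tuple
(`isFree_power`); and the structure maps, being injective on simplices other than the base point, do
not create coincidences between the entries of a tuple (`isFree_fatDiagonal_ι`). The sphere spectrum
is freely generated by one point of level `0` (`isFree_fromPoint_sphereSpectrum`).
-/

namespace SymSp

/-! ### Equivariant cofibrations are the injections -/

/-- A Kan fibration which is a weak equivalence is a trivial fibration: it is a retract of the
trivial fibration in a factorization with an anodyne extension. -/
theorem rlp_boundary_of_kanFibrations_of_weakEquivalences {A B : SSet.{u}} (q : A ⟶ B)
    (h₁ : kanFibrations q) (h₂ : weakEquivalences q) : SSet.modelCategoryQuillen.I.rlp q := by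
  obtain ⟨E, i, r, hq, hi, hr⟩ := h₂
  have : HasLiftingProperty i q := hi _ h₁
  exact MorphismProperty.of_retract (RetractArrow.ofRightLiftingProperty hq) hr

section equivariantCofibrations

variable {K : Type v} [Group K] {X Y Z W : Action BSSet.{u} K} {p r : SimplexCategoryᵒᵖ}

theorem ρ_one_ap (x : X.V.obj p) : ap (X.ρ 1) x = x := by
  rw [show X.ρ 1 = 𝟙 X.V from Action.ρ_one _]
  rfl

theorem ρ_mul_ap (k k' : K) (x : X.V.obj p) : ap (X.ρ (k * k')) x = ap (X.ρ k) (ap (X.ρ k') x) := by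
  rw [show X.ρ (k * k') = (X.ρ k' : X.V ⟶ X.V) ≫ (X.ρ k : X.V ⟶ X.V) from map_mul X.ρ k k']
  rfl

theorem ρ_inv_ap_ap (k : K) (x : X.V.obj p) : ap (X.ρ k⁻¹) (ap (X.ρ k) x) = x := by
  rw [← ρ_mul_ap, inv_mul_cancel, ρ_one_ap]

theorem hom_ap_ρ_ap (f : X ⟶ Y) (k : K) (x : X.V.obj p) :
    ap f.hom (ap (X.ρ k) x) = ap (Y.ρ k) (ap f.hom x) :=
  congrArg (fun m : X.V ⟶ Y.V => ap m x) (f.comm k)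

/-- A set of pairs of simplices of `Y` and `Z` which is the graph of an equivariant map over `W`
from a subcomplex of `Y` to `Z`. -/
structure IsPartialLift (q : Z ⟶ W) (w : Y ⟶ W)
    (R : Set (Σ p : SimplexCategoryᵒᵖ, Y.V.obj p × Z.V.obj p)) : Prop where
  rst_mem : ∀ {p r : SimplexCategoryᵒᵖ} (φ : p ⟶ r) {y : Y.V.obj p} {z : Z.V.obj p},
    ⟨p, y, z⟩ ∈ R → ⟨r, rst _ φ y, rst _ φ z⟩ ∈ R
  act_mem : ∀ {p : SimplexCategoryᵒᵖ} (k : K) {y : Y.V.obj p} {z : Z.V.obj p},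
    ⟨p, y, z⟩ ∈ R → ⟨p, ap (Y.ρ k) y, ap (Z.ρ k) z⟩ ∈ R
  functional : ∀ {p : SimplexCategoryᵒᵖ} {y : Y.V.obj p} {z z' : Z.V.obj p},
    ⟨p, y, z⟩ ∈ R → ⟨p, y, z'⟩ ∈ R → z = z'
  comm : ∀ {p : SimplexCategoryᵒᵖ} {y : Y.V.obj p} {z : Z.V.obj p},
    ⟨p, y, z⟩ ∈ R → ap q.hom z = ap w.hom y

namespace IsPartialLift

variable {q : Z ⟶ W} {w : Y ⟶ W} {R : Set (Σ p : SimplexCategoryᵒᵖ, Y.V.obj p × Z.V.obj p)}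

/-- A partial lift restricts to the boundary of a simplex fixed by a subgroup, and this restriction
extends over the simplex, through simplices fixed by the same subgroup. -/
theorem exists_extension (hR : IsPartialLift q w R) (hq : ∀ H : Subgroup K,
      SSet.modelCategoryQuillen.I.rlp (fixedPointsMap q H)) {n : ℕ}
    (y : Y.V.obj (op (SimplexCategory.mk n)))
    (hy : ∀ (m : SimplexCategoryᵒᵖ) (φ : m.unop ⟶ SimplexCategory.mk n),
      ¬ Function.Surjective φ.toOrderHom → ∃ z, ⟨m, rst _ φ.op y, z⟩ ∈ R) :
    ∃ z : Z.V.obj (op (SimplexCategory.mk n)), ap q.hom z = ap w.hom y ∧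
      (∀ k : K, ap (Y.ρ k) y = y → ap (Z.ρ k) z = z) ∧
      ∀ (m : SimplexCategoryᵒᵖ) (φ : m.unop ⟶ SimplexCategory.mk n),
        ¬ Function.Surjective φ.toOrderHom → ⟨m, rst _ φ.op y, rst _ φ.op z⟩ ∈ R := by
  -- the stabilizer of `y`
  let H : Subgroup K :=
    { carrier := {k | ap (Y.ρ k) y = y}
      one_mem' := ρ_one_ap y
      mul_mem' := fun {a b} ha hb => by
        change ap (Y.ρ (a * b)) y = y
        rw [ρ_mul_ap, show ap (Y.ρ b) y = y from hb, show ap (Y.ρ a) y = y from ha]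
      inv_mem' := fun {a} ha => by
        change ap (Y.ρ a⁻¹) y = y
        conv_lhs => rw [← show ap (Y.ρ a) y = y from ha]
        exact ρ_inv_ap_ap a y }
  have (m : SimplexCategoryᵒᵖ) : Nonempty (Z.V.obj m) := ⟨pt Z.V m⟩
  choose! c hc using hy
  have hfix : ∀ (m : SimplexCategoryᵒᵖ) (φ : m.unop ⟶ SimplexCategory.mk n)
      (hφ : ¬ Function.Surjective φ.toOrderHom), c m φ ∈ (fixedPoints Z H).obj m := by
    intro m φ hφ k hk
    refine hR.functional (hR.act_mem k (hc m φ hφ)) ?_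
    rw [ap_rst, show ap (Y.ρ k) y = y from hk]
    exact hc m φ hφ
  let top : ((SSet.boundary n : SSet.{u}) ⟶ (fixedPoints Z H : SSet.{u})) :=
    { app m := ↾ fun s => ⟨c m (SSet.stdSimplex.objEquiv s.1), hfix m _ s.2⟩
      naturality m m' φ := by
        apply ConcreteCategory.hom_ext
        intro s
        apply Subtype.ext
        have h1 := hc m (SSet.stdSimplex.objEquiv s.1) s.2
        refine hR.functional (hc m' _ ?_) ?_
        · exact ((SSet.boundary n).map φ s.2)
        · have := hR.rst_mem φ h1
          rwa [← rst_comp] at this }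
  let bot : (SSet.stdSimplex.obj (SimplexCategory.mk n) ⟶ (fixedPoints W H : SSet.{u})) :=
    { app m := ↾ fun s => ⟨ap w.hom (rst _ (SSet.stdSimplex.objEquiv s).op y), fun k hk => by
        rw [← hom_ap_ρ_ap, ap_rst, show ap (Y.ρ k) y = y from hk]⟩
      naturality m m' φ := by
        apply ConcreteCategory.hom_ext
        intro s
        apply Subtype.ext
        change ap w.hom (rst _ ((SSet.stdSimplex.objEquiv s).op ≫ φ) y) = _
        rw [rst_comp, ap_rst]
        rfl }
  have sq : CommSq top (SSet.boundary n).ι (fixedPointsMap q H) bot := ⟨by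
    apply NatTrans.ext
    funext m
    apply ConcreteCategory.hom_ext
    intro s
    apply Subtype.ext
    exact hR.comm (hc m _ s.2)⟩
  have := hq H _ (SSet.modelCategoryQuillen.boundary_ι_mem_I n)
  let l := sq.lift
  let e : (SSet.stdSimplex.{u}.obj (SimplexCategory.mk n)).obj (op (SimplexCategory.mk n)) :=
    SSet.stdSimplex.objEquiv.symm (𝟙 _)
  refine ⟨(l.app _ e).1, ?_, fun k hk => (l.app _ e).2 k hk, fun m φ hφ => ?_⟩
  · have h1 := congrArg Subtype.val (ConcreteCategory.congr_hom
      (NatTrans.congr_app sq.fac_right (op (SimplexCategory.mk n))) e)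
    refine h1.trans ?_
    change ap w.hom (rst _ (𝟙 _) y) = _
    rw [rst_id]
  · let s : (SSet.stdSimplex.{u}.obj (SimplexCategory.mk n)).obj m :=
      SSet.stdSimplex.objEquiv.symm φ
    have h1 := congrArg Subtype.val (ConcreteCategory.congr_hom
      (NatTrans.congr_app sq.fac_left m) ⟨s, hφ⟩)
    have h2 := congrArg Subtype.val (ConcreteCategory.congr_hom (l.naturality φ.op) e)
    have h3 : (l.app m s).1 = c m φ := h1
    have h4 : (l.app m s).1 = rst Z.V φ.op (l.app _ e).1 := by
      refine Eq.trans ?_ h2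
      refine congrArg (fun s => (l.app m s).1) ?_
      exact congrArg SSet.stdSimplex.objEquiv.symm (Category.comp_id φ).symm
    rw [← h4, h3]
    exact hc m φ hφ

/-- A maximal partial lift is defined everywhere: otherwise it extends to a simplex of minimal
dimension at which it is undefined, and hence to the orbits of all its degeneracies. -/
theorem exists_mem_of_maximal (hR : IsPartialLift q w R) (hq : ∀ H : Subgroup K,
      SSet.modelCategoryQuillen.I.rlp (fixedPointsMap q H))
    (hmax : ∀ R', IsPartialLift q w R' → R ⊆ R' → R' ⊆ R) (n : ℕ) :
    ∀ y : Y.V.obj (op (SimplexCategory.mk n)), ∃ z, ⟨_, y, z⟩ ∈ R := by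
  induction n using Nat.strong_induction_on with
  | _ n ih =>
  intro y
  by_contra hy
  -- `y` is undefined, while all simplices of smaller dimension are in the domain of `R`
  have hlow : ∀ (m : SimplexCategoryᵒᵖ) (φ : m.unop ⟶ SimplexCategory.mk n),
      ¬ Function.Surjective φ.toOrderHom → ∃ z, ⟨m, rst _ φ.op y, z⟩ ∈ R := by
    intro m φ hφ
    obtain _ | n := n
    · exact absurd (fun b => ⟨0, Subsingleton.elim (α := Fin 1) _ _⟩) hφ
    · obtain ⟨i, θ, rfl⟩ := SimplexCategory.eq_comp_δ_of_not_surjective φ hφ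
      obtain ⟨z, hz⟩ := ih n (Nat.lt_succ_self n) (rst _ (SimplexCategory.δ i).op y)
      refine ⟨rst _ θ.op z, ?_⟩
      rw [op_comp, rst_comp]
      exact hR.rst_mem θ.op hz
  obtain ⟨z, hqz, hzfix, hzR⟩ := hR.exists_extension hq y hlow
  have hnd : ∀ k : K, (ap (Y.ρ k) y : (forgetBase.obj Y.V).obj (op (SimplexCategory.mk n))) ∈
      (forgetBase.obj Y.V).nonDegenerate n := by
    rintro k ⟨m, hm, θ, y', hy'⟩
    obtain ⟨z', hz'⟩ := ih m hm y'
    have h1 := hR.act_mem k⁻¹ (hR.rst_mem θ.op hz')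
    refine hy ⟨ap (Z.ρ k⁻¹) (rst _ θ.op z'), ?_⟩
    · have h2 : rst _ θ.op y' = ap (Y.ρ k) y := hy'
      rwa [h2, ρ_inv_ap_ap] at h1
  -- values of the extension at simplices of the form `k φ^* y` with `φ` not surjective
  have hns : ∀ (k : K) (m : SimplexCategoryᵒᵖ) (φ : m.unop ⟶ SimplexCategory.mk n) (z' : Z.V.obj m),
      ⟨m, ap (Y.ρ k) (rst _ φ.op y), z'⟩ ∈ R → z' = ap (Z.ρ k) (rst _ φ.op z) := by
    intro k m φ z' hz'
    by_cases hφ : Function.Surjective φ.toOrderHom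
    · exfalso
      have : Epi φ := SimplexCategory.epi_iff_surjective.2 hφ
      have : IsSplitEpi φ := isSplitEpi_of_epi φ
      have hs := hR.rst_mem (section_ φ).op (hR.act_mem k⁻¹ hz')
      rw [ρ_inv_ap_ap, ← rst_comp, ← op_comp, IsSplitEpi.id, op_id, rst_id] at hs
      exact hy ⟨_, hs⟩
    · exact hR.functional hz' (hR.act_mem k (hzR m φ hφ))
  have hfun : ∀ (k k' : K) (m : SimplexCategoryᵒᵖ) (φ φ' : m.unop ⟶ SimplexCategory.mk n),
      ap (Y.ρ k) (rst _ φ.op y) = ap (Y.ρ k') (rst _ φ'.op y) →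
        ap (Z.ρ k) (rst _ φ.op z) = ap (Z.ρ k') (rst _ φ'.op z) := by
    intro k k' m φ φ' h
    by_cases hφ : Function.Surjective φ.toOrderHom
    · have : Epi φ := SimplexCategory.epi_iff_surjective.2 hφ
      have h1 := (forgetBase.obj Y.V).unique_nonDegenerate_map (n := m.unop.len)
        (ap (Y.ρ k) (rst _ φ.op y)) φ ⟨_, hnd k⟩ (ap_rst _ _ _) φ' ⟨_, hnd k'⟩
          (h.trans (ap_rst _ _ _))
      have h2 := congrArg Subtype.val ((forgetBase.obj Y.V).unique_nonDegenerate_simplex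
        (n := m.unop.len) (ap (Y.ρ k) (rst _ φ.op y)) φ ⟨_, hnd k⟩ (ap_rst _ _ _) φ' ⟨_, hnd k'⟩
          (h.trans (ap_rst _ _ _)))
      subst h1
      have h3 : ap (Y.ρ k) y = ap (Y.ρ k') y := h2
      have h4 : ap (Z.ρ (k'⁻¹ * k)) z = z := hzfix _ (by rw [ρ_mul_ap, h3, ρ_inv_ap_ap])
      rw [ρ_mul_ap] at h4
      have h5 : ap (Z.ρ k) z = ap (Z.ρ k') z := by
        conv_rhs => rw [← h4, ← ρ_mul_ap, mul_inv_cancel, ρ_one_ap]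
      rw [ap_rst, ap_rst, h5]
    · have h1 := hR.act_mem k (hzR m φ hφ)
      have h2 : (⟨m, ap (Y.ρ k') (rst _ φ'.op y), ap (Z.ρ k) (rst _ φ.op z)⟩ :
          Σ p : SimplexCategoryᵒᵖ, Y.V.obj p × Z.V.obj p) ∈ R := h ▸ h1
      exact hns k' m φ' _ h2
  let R' : Set (Σ p : SimplexCategoryᵒᵖ, Y.V.obj p × Z.V.obj p) := R ∪
    {t | ∃ (k : K) (φ : t.1.unop ⟶ SimplexCategory.mk n),
      t.2.1 = ap (Y.ρ k) (rst _ φ.op y) ∧ t.2.2 = ap (Z.ρ k) (rst _ φ.op z)}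
  have hR' : IsPartialLift q w R' := by
    constructor
    · rintro p r φ a b (h | ⟨k, θ, h1, h2⟩)
      · exact Or.inl (hR.rst_mem φ h)
      · refine Or.inr ⟨k, φ.unop ≫ θ, ?_, ?_⟩
        · change rst _ φ a = _
          rw [show a = _ from h1, ← ap_rst, ← rst_comp]
          rfl
        · change rst _ φ b = _
          rw [show b = _ from h2, ← ap_rst, ← rst_comp]
          rfl
    · rintro p k' a b (h | ⟨k, θ, h1, h2⟩)
      · exact Or.inl (hR.act_mem k' h)
      · refine Or.inr ⟨k' * k, θ, ?_, ?_⟩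
        · change ap _ a = _
          rw [show a = _ from h1, ρ_mul_ap]
        · change ap _ b = _
          rw [show b = _ from h2, ρ_mul_ap]
    · rintro p a b b' (h | ⟨k, θ, h1, h2⟩) (h' | ⟨k', θ', h1', h2'⟩)
      · exact hR.functional h h'
      · dsimp only at h1' h2'
        rw [h2']
        rw [h1'] at h
        exact hns _ _ _ _ h
      · dsimp only at h1 h2
        rw [h2]
        rw [h1] at h'
        exact (hns _ _ _ _ h').symm
      · dsimp only at h1 h2 h1' h2'
        rw [h2, h2']
        exact hfun _ _ _ _ _ (h1.symm.trans h1')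
    · rintro p a b (h | ⟨k, θ, h1, h2⟩)
      · exact hR.comm h
      · dsimp only at h1 h2
        rw [h1, h2, hom_ap_ρ_ap, hom_ap_ρ_ap, ap_rst q.hom, ap_rst w.hom, hqz]
  refine hy ⟨z, hmax R' hR' Set.subset_union_left (Or.inr ⟨1, 𝟙 _, ?_, ?_⟩)⟩
  · change y = _
    rw [ρ_one_ap, op_id, rst_id]
  · change z = _
    rw [ρ_one_ap, op_id, rst_id]

end IsPartialLift

/-- Any injection of based `K`-spaces is built from orbits of cells `K/H × Δⁿ`, for subgroups `H`,
and thus lifts against the maps which are trivial fibrations on all fixed points. -/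
theorem hasLiftingProperty_of_injective {f : X ⟶ Y} {q : Z ⟶ W}
    (hf : ∀ p, Function.Injective (fun x : X.V.obj p => ap f.hom x))
    (hq : ∀ H : Subgroup K, SSet.modelCategoryQuillen.I.rlp (fixedPointsMap q H)) :
    HasLiftingProperty f q := by
  refine ⟨fun {g w} sq => ?_⟩
  have hsq : ∀ {p} (x : X.V.obj p), ap q.hom (ap g.hom x) = ap w.hom (ap f.hom x) := fun {p} x =>
    congrArg (fun m : X ⟶ W => ap m.hom x) sq.w
  let R₀ : Set (Σ p : SimplexCategoryᵒᵖ, Y.V.obj p × Z.V.obj p) :=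
    {t | ∃ x, t.2.1 = ap f.hom x ∧ t.2.2 = ap g.hom x}
  have hR₀ : IsPartialLift q w R₀ := by
    constructor
    · rintro p r φ a b ⟨x, h1, h2⟩
      dsimp only at h1 h2
      exact ⟨rst _ φ x, by dsimp only; rw [h1, ap_rst], by dsimp only; rw [h2, ap_rst]⟩
    · rintro p k a b ⟨x, h1, h2⟩
      dsimp only at h1 h2
      exact ⟨ap (X.ρ k) x, by dsimp only; rw [h1, hom_ap_ρ_ap], by dsimp only; rw [h2, hom_ap_ρ_ap]⟩
    · rintro p a b b' ⟨x, h1, h2⟩ ⟨x', h1', h2'⟩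
      dsimp only at h1 h2 h1' h2'
      obtain rfl := hf p (h1.symm.trans h1')
      rw [h2, h2']
    · rintro p a b ⟨x, h1, h2⟩
      dsimp only at h1 h2
      rw [h1, h2, hsq]
  obtain ⟨R, hR₀R, hRmax⟩ := zorn_subset_nonempty {R | IsPartialLift q w R} (by
    intro c hc hchain hne
    refine ⟨⋃₀ c, ?_, fun s hs => Set.subset_sUnion_of_mem hs⟩
    constructor
    · rintro p r φ a b ⟨s, hs, h⟩
      exact ⟨s, hs, (hc hs).rst_mem φ h⟩
    · rintro p k a b ⟨s, hs, h⟩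
      exact ⟨s, hs, (hc hs).act_mem k h⟩
    · rintro p a b b' ⟨s, hs, h⟩ ⟨s', hs', h'⟩
      rcases hchain.total hs hs' with hss | hss
      · exact (hc hs').functional (hss h) h'
      · exact (hc hs).functional h (hss h')
    · rintro p a b ⟨s, hs, h⟩
      exact (hc hs).comm h) R₀ hR₀
  have hR : IsPartialLift q w R := hRmax.prop
  have htot : ∀ (p : SimplexCategoryᵒᵖ) (y : Y.V.obj p), ∃ z, ⟨p, y, z⟩ ∈ R := fun p =>
    hR.exists_mem_of_maximal hq (fun R' hR' hle => hRmax.le_of_ge hR' hle) p.unop.len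
  choose l hl using htot
  refine ⟨⟨⟨⟨mkHom l ?_ ?_, ?_⟩, ?_, ?_⟩⟩⟩
  · intro p
    refine hR.functional (hl p _) (hR₀R ⟨pt X.V p, ?_, ?_⟩)
    · exact (ap_pt f.hom).symm
    · exact (ap_pt g.hom).symm
  · intro p r φ x
    exact hR.functional (hl r _) (hR.rst_mem φ (hl p x))
  · intro k
    exact hom_ext fun p x => hR.functional (hl p _) (hR.act_mem k (hl p x))
  · exact Action.hom_ext _ _ (hom_ext fun p x => hR.functional (hl p _) (hR₀R ⟨x, rfl, rfl⟩))
  · exact Action.hom_ext _ _ (hom_ext fun p y => hR.comm (hl p y))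

/-- The cofree simplicial set on the underlying graded set of a based `K`-space `X`: its
`p`-simplices are the families of simplices of `X` indexed by the simplices of `Δ^p`. -/
def cofree (X : Action BSSet.{u} K) : Action BSSet.{u} K where
  V := mkBSSet (fun p => ∀ m : SimplexCategoryᵒᵖ, (p ⟶ m) → X.V.obj m)
    (fun _ m _ => pt X.V m) (fun φ x m ψ => x m (φ ≫ ψ)) (fun _ => rfl)
    (fun x => by simp) (fun φ ψ x => by simp)
  ρ :=
    { toFun k := mkHom (fun _ x m ψ => ap (X.ρ k) (x m ψ))
        (fun _ => funext fun _ => funext fun _ => ap_pt _) (fun _ _ => rfl)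
      map_one' := hom_ext fun _ x => funext fun m => funext fun ψ => ρ_one_ap (x m ψ)
      map_mul' k k' := hom_ext fun _ x => funext fun m => funext fun ψ => ρ_mul_ap k k' (x m ψ) }

/-- The unit `X → cofree X`. -/
def toCofree (X : Action BSSet.{u} K) : X ⟶ cofree X where
  hom := mkHom (fun _ x _ ψ => rst X.V ψ x) (fun _ => funext fun _ => funext fun ψ => rst_pt ψ)
    (fun φ x => funext fun _ => funext fun ψ => (rst_comp φ ψ x).symm)
  comm k := hom_ext fun _ x => funext fun _ => funext fun ψ => (ap_rst (X.ρ k) ψ x).symm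

/-- The one-point `K`-space. -/
def onePoint (K : Type v) [Group K] : Action BSSet.{u} K :=
  Action.trivial K (mkBSSet (fun _ => PUnit) (fun _ => ⟨⟩) (fun _ _ => ⟨⟩)
    (fun _ => rfl) (fun _ => rfl) (fun _ _ _ => rfl))

/-- The unique map to the one-point `K`-space. -/
def toOnePoint (X : Action BSSet.{u} K) : X ⟶ onePoint K where
  hom := mkHom (fun _ _ => ⟨⟩) (fun _ => rfl) (fun _ _ => rfl)
  comm _ := rfl

/-- The fixed points of a cofree `K`-space are injective: a map from `A` amounts to a family of
functions on the sets of simplices of `A`, which is extended by the base point. -/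
theorem fixedPointsMap_toOnePoint_cofree_rlp (X : Action BSSet.{u} K) (H : Subgroup K)
    {A B : SSet.{u}} (i : A ⟶ B) [Mono i] :
    HasLiftingProperty i (fixedPointsMap (toOnePoint (cofree X)) H) := by
  classical
  refine ⟨fun {a b} sq => ?_⟩
  have hi : ∀ m, Function.Injective (fun s : A.obj m => i.app m s) := fun m =>
    (CategoryTheory.mono_iff_injective _).1 inferInstance
  let v : ∀ m, A.obj m → X.V.obj m := fun m s => (a.app m s).1 m (𝟙 m)
  have hv : ∀ {p m} (ψ : p ⟶ m) (s : A.obj p), (a.app p s).1 m ψ = v m (A.map ψ s) := by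
    intro p m ψ s
    have := congrArg Subtype.val (ConcreteCategory.congr_hom (a.naturality ψ) s)
    refine Eq.symm ((congrFun (congrFun this m) (𝟙 m)).trans ?_)
    change (a.app p s).1 m (ψ ≫ 𝟙 m) = _
    rw [Category.comp_id]
  let V : ∀ m, B.obj m → X.V.obj m := fun m s =>
    if h : ∃ s', i.app m s' = s then v m h.choose else pt X.V m
  have hVv : ∀ m s, V m (i.app m s) = v m s := by
    intro m s
    have h : ∃ s', i.app m s' = i.app m s := ⟨s, rfl⟩
    change (if h : ∃ s', i.app m s' = i.app m s then v m h.choose else pt X.V m) = _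
    rw [dif_pos h, hi m h.choose_spec]
  have hV : ∀ m s, ∀ h ∈ H, ap (X.ρ h) (V m s) = V m s := by
    intro m s h hh
    change ap (X.ρ h) (dite _ _ _) = dite _ _ _
    split_ifs with hs
    · exact congrFun (congrFun ((a.app m hs.choose).2 h hh) m) (𝟙 m)
    · exact ap_pt _
  refine ⟨⟨⟨{
    app p := ↾ fun s => ⟨fun m ψ => V m (B.map ψ s), fun h hh =>
      funext fun m => funext fun ψ => hV _ _ h hh⟩
    naturality p r φ := ?_ }, ?_, ?_⟩⟩⟩
  · apply ConcreteCategory.hom_ext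
    intro s
    apply Subtype.ext
    refine funext fun m => funext fun ψ => ?_
    change V m (B.map ψ (B.map φ s)) = V m (B.map (φ ≫ ψ) s)
    simp
  · apply NatTrans.ext
    funext p
    apply ConcreteCategory.hom_ext
    intro s
    apply Subtype.ext
    refine funext fun m => funext fun ψ => ?_
    refine Eq.trans ?_ (hv ψ s).symm
    refine Eq.trans (congrArg (V m) ?_) (hVv m (A.map ψ s))
    exact (ConcreteCategory.congr_hom (i.naturality ψ) s).symm
  · rfl

/-- `K`-cofibrations are the injective maps. -/
theorem isEquivariantCofibration_iff (f : X ⟶ Y) : IsEquivariantCofibration f ↔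
    ∀ p, Function.Injective (fun x : X.V.obj p => ap f.hom x) := by
  constructor
  · intro hf p x x' hx
    have hI : ∀ H, SSet.modelCategoryQuillen.I.rlp (fixedPointsMap (toOnePoint (cofree X)) H) := by
      intro H A B i hi
      have : Mono i := SSet.modelCategoryQuillen.I_le_monomorphisms _ hi
      exact fixedPointsMap_toOnePoint_cofree_rlp X H i
    have := hf (toOnePoint (cofree X))
      (fun H A B i hi => by
        have : Mono i := SSet.modelCategoryQuillen.J_le_monomorphisms _ hi
        exact fixedPointsMap_toOnePoint_cofree_rlp X H i)
      (fun H => ⟨{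
        Z := _
        i := 𝟙 _
        p := fixedPointsMap (toOnePoint (cofree X)) H
        fac := Category.id_comp _
        hi := SSet.anodyneExtensions.of_isIso _
        hp := hI H }⟩)
    have sq : CommSq (toCofree X) f (toOnePoint (cofree X)) (toOnePoint Y) := ⟨rfl⟩
    have key : ∀ y : X.V.obj p, (show ∀ m, (p ⟶ m) → X.V.obj m from
        ap (Action.Hom.hom sq.lift) (ap f.hom y)) p (𝟙 p) = y := by
      intro y
      have h1 : ap (Action.Hom.hom sq.lift) (ap f.hom y) = ap (toCofree X).hom y :=
        congrArg (fun m : X ⟶ cofree X => ap m.hom y) sq.fac_left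
      refine (congrFun (congrFun h1 p) (𝟙 p)).trans ?_
      exact rst_id y
    dsimp only at hx
    rw [← key x, ← key x', hx]
  · intro hf Z W q h1 h2
    exact hasLiftingProperty_of_injective hf fun H =>
      rlp_boundary_of_kanFibrations_of_weakEquivalences _ (h1 H) (h2 H)

end equivariantCofibrations

end SymSp

namespace SymSp

/-! ### Simplices of pushouts -/

/-- The map `B ∪_A C → D` given by functions `b : B → D` and `c : C → D` is injective. -/
def PushoutInjective {A B C D : Type*} (f : A → B) (g : A → C) (b : B → D) (c : C → D) : Prop :=
  ∀ x y : B ⊕ C, Sum.elim b c x = Sum.elim b c y →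
    Quot.mk (fun x y : B ⊕ C => ∃ a, x = Sum.inl (f a) ∧ y = Sum.inr (g a)) x = Quot.mk _ y

section pushout

variable {A B C P D : BSSet.{u}} {f : A ⟶ B} {g : A ⟶ C} {i : B ⟶ P} {j : C ⟶ P}

/-- Pushouts of based spaces are computed on simplices. -/
theorem exists_equiv_of_isPushout (h : IsPushout f g i j) (p : SimplexCategoryᵒᵖ) :
    ∃ e : (P.obj p).X ≃ Quot (pointedPushoutRel (f.app p) (g.app p)),
      (∀ b : B.obj p, e (ap i b) = Quot.mk _ (Sum.inl b)) ∧
      ∀ c : C.obj p, e (ap j c) = Quot.mk _ (Sum.inr c) := by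
  have h1 : IsPushout (f.app p) (g.app p) (i.app p) (j.app p) :=
    IsPushout.map (show BSSet.{u} ⥤ Pointed.{u} from
      (evaluation SimplexCategoryᵒᵖ Pointed.{u}).obj p) h
  let e := h1.isoIsPushout _ _ (pointed_isPushout (f.app p) (g.app p))
  refine ⟨⟨e.hom.toFun, e.inv.toFun, fun x => ?_, fun x => ?_⟩, fun b => ?_, fun c => ?_⟩
  · exact congrFun (congrArg Pointed.Hom.toFun e.hom_inv_id) x
  · exact congrFun (congrArg Pointed.Hom.toFun e.inv_hom_id) x
  · exact congrFun (congrArg Pointed.Hom.toFun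
      (h1.inl_isoIsPushout_hom _ _ (pointed_isPushout (f.app p) (g.app p)))) b
  · exact congrFun (congrArg Pointed.Hom.toFun
      (h1.inr_isoIsPushout_hom _ _ (pointed_isPushout (f.app p) (g.app p)))) c

theorem exists_of_isPushout (h : IsPushout f g i j) {p : SimplexCategoryᵒᵖ} (x : P.obj p) :
    (∃ b : B.obj p, ap i b = x) ∨ ∃ c : C.obj p, ap j c = x := by
  obtain ⟨e, he₁, he₂⟩ := exists_equiv_of_isPushout h p
  obtain ⟨y, hy⟩ := Quot.exists_rep (e x)
  cases y with
  | inl b => exact Or.inl ⟨b, e.injective ((he₁ b).trans hy)⟩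
  | inr c => exact Or.inr ⟨c, e.injective ((he₂ c).trans hy)⟩

theorem injective_iff_of_isPushout (h : IsPushout f g i j) (d : P ⟶ D) {b : B ⟶ D} {c : C ⟶ D}
    (hb : i ≫ d = b) (hc : j ≫ d = c) (p : SimplexCategoryᵒᵖ) :
    Function.Injective (fun x : P.obj p => ap d x) ↔
      PushoutInjective (fun x : A.obj p => ap f x) (fun x : A.obj p => ap g x)
        (fun x : B.obj p => ap b x) (fun x : C.obj p => ap c x) := by
  obtain ⟨e, he₁, he₂⟩ := exists_equiv_of_isPushout h p
  subst hb hc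
  have hd : ∀ x : B.obj p ⊕ C.obj p, ap d (e.symm (Quot.mk _ x)) =
      Sum.elim (fun x : B.obj p => ap (i ≫ d) x) (fun x : C.obj p => ap (j ≫ d) x) x := by
    rintro (x | x)
    · rw [← he₁, e.symm_apply_apply]
      rfl
    · rw [← he₂, e.symm_apply_apply]
      rfl
  constructor
  · intro hinj x y hxy
    rw [← hd, ← hd] at hxy
    exact e.symm.injective (hinj hxy)
  · intro hinj x y hxy
    obtain ⟨x, rfl⟩ := e.symm.surjective x
    obtain ⟨y, rfl⟩ := e.symm.surjective y
    obtain ⟨x, rfl⟩ := Quot.exists_rep x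
    obtain ⟨y, rfl⟩ := Quot.exists_rep y
    dsimp only at hxy
    rw [hd, hd] at hxy
    exact congrArg e.symm (hinj x y hxy)

end pushout

theorem isCofibration_iff {X Y : BSSet.{u}} (f : X ⟶ Y) :
    IsCofibration f ↔ ∀ p, Function.Injective (fun x : X.obj p => ap f x) := by
  unfold IsCofibration
  rw [NatTrans.mono_iff_mono_app]
  exact forall_congr' fun p => CategoryTheory.mono_iff_injective _

theorem isEquivariantCofibration_pushoutDesc_iff {K : Type v} [Group K]
    {A B C D : Action BSSet.{u} K} {f : A ⟶ B} {g : A ⟶ C} (b : B ⟶ D) (c : C ⟶ D)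
    (w : f ≫ b = g ≫ c) :
    IsEquivariantCofibration (pushout.desc b c w) ↔ ∀ p,
      PushoutInjective (fun x : A.V.obj p => ap f.hom x) (fun x : A.V.obj p => ap g.hom x)
        (fun x : B.V.obj p => ap b.hom x) (fun x : C.V.obj p => ap c.hom x) := by
  rw [isEquivariantCofibration_iff]
  have h : IsPushout f.hom g.hom (Action.Hom.hom (pushout.inl f g))
      (Action.Hom.hom (pushout.inr f g)) :=
    (IsPushout.of_hasPushout f g).map (Action.forget BSSet.{u} K)
  refine forall_congr' fun p => injective_iff_of_isPushout h _ ?_ ?_ p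
  · rw [← Action.comp_hom, pushout.inl_desc]
  · rw [← Action.comp_hom, pushout.inr_desc]

section flat

/-- The injectivity, in simplicial degree `p`, of `ν_n(f) : X_n ∪_{L_n X} L_n Y → Y_n`. -/
def LatchingInjective {X Y : SymSpectrum.{u}} (f : X ⟶ Y) (n : ℕ) (p : SimplexCategoryᵒᵖ) : Prop :=
  PushoutInjective (fun x : ((latching n).obj X).V.obj p => ap ((latchingMap n).app X).hom x)
    (fun x : ((latching n).obj X).V.obj p => ap ((latching n).map f).hom x)
    (fun x : X.el n p => SymSpectrum.Hom.ev f x)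
    (fun x : ((latching n).obj Y).V.obj p => ap ((latchingMap n).app Y).hom x)

theorem isFlatCofibration_iff_latchingInjective {X Y : SymSpectrum.{u}} (f : X ⟶ Y) :
    IsFlatCofibration f ↔ ∀ n p, LatchingInjective f n p :=
  forall_congr' fun _ => isEquivariantCofibration_pushoutDesc_iff _ _ _

/-- Cofibrations of `G × Σ_n`-spaces and of `Σ_n`-spaces are both the injections. -/
theorem isGFlatCofibration_iff {G : Type v} [Group G] {X Y : GSymSpectrum.{u} G} (f : X ⟶ Y) :
    IsGFlatCofibration f ↔ IsFlatCofibration f.hom := by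
  rw [isFlatCofibration_iff_latchingInjective]
  exact forall_congr' fun _ => isEquivariantCofibration_pushoutDesc_iff _ _ _

end flat

end SymSp

namespace SymSp

/-! ### Coloured injections acting on simplices -/

namespace SymSpectrum

variable {E F : SymSpectrum.{u}} {p q : SimplexCategoryᵒᵖ} {k l m n : ℕ}

/-- The map `E(k) ∧ S^{n - a} → E(n)` given by an injection `a : k → n`, on simplices. The simplex
of the sphere is given by a tuple indexed by all of `n`, whose entries at the image of `a` are
irrelevant. -/
noncomputable def put (E : SymSpectrum.{u}) (a : Fin k ↪ Fin n) (x : E.el k p)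
    (c : Fin n → circle.{u}.obj p) : E.el n p :=
  E.genEl (split a) x (fun j => c j.1)

theorem genEl_eq_put {M : Type} [Finite M] (τ : Fin k ⊕ M ≃ Fin n) (x : E.el k p)
    (t : M → circle.{u}.obj p) (c : Fin n → circle.{u}.obj p)
    (hc : ∀ i, c (τ (Sum.inr i)) = t i) :
    E.genEl τ x t = E.put (Function.Embedding.inl.trans τ.toEmbedding) x c := by
  refine genEl_congr _ _ _ _ _ (fun i => rfl) (fun i j h => ?_)
  rw [← hc i, h]
  rfl

theorem put_congr (a : Fin k ↪ Fin n) (x : E.el k p) {c d : Fin n → circle.{u}.obj p}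
    (h : ∀ j, j ∉ Set.range a → c j = d j) : E.put a x c = E.put a x d :=
  congrArg (E.genEl (split a) x) (funext fun j => h j.1 j.2)

theorem put_pt (a : Fin k ↪ Fin n) (c : Fin n → circle.{u}.obj p) :
    E.put a (pt _ p) c = pt _ p := genEl_pt _ _

theorem put_eq_pt (a : Fin k ↪ Fin n) (x : E.el k p) (c : Fin n → circle.{u}.obj p) {j : Fin n}
    (hj : j ∉ Set.range a) (h : c j = pt circle p) : E.put a x c = pt _ p :=
  genEl_eq_pt _ _ _ ⟨j, hj⟩ h

theorem ev_put (f : E ⟶ F) (a : Fin k ↪ Fin n) (x : E.el k p) (c : Fin n → circle.{u}.obj p) :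
    SymSpectrum.Hom.ev f (E.put a x c) = F.put a (SymSpectrum.Hom.ev f x) c :=
  ev_genEl f _ x _

theorem put_put (a : Fin k ↪ Fin l) (b : Fin l ↪ Fin n) (x : E.el k p)
    (c : Fin n → circle.{u}.obj p) :
    E.put b (E.put a x (fun i => c (b i))) c = E.put (a.trans b) x c := by
  refine (genEl_genEl _ _ _ _ _).trans (genEl_congr _ _ _ _ _ (fun i => rfl) ?_)
  rintro (i | i) j h
  · have h' : b i.1 = j.1 := h
    exact congrArg c h'
  · have h' : i.1 = j.1 := h
    exact congrArg c h'

theorem put_of_forall_eq (a : Fin n ↪ Fin n) (ha : ∀ i, a i = i) (x : E.el n p)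
    (c : Fin n → circle.{u}.obj p) : E.put a x c = x := by
  have : IsEmpty {j : Fin n // j ∉ Set.range a} := ⟨fun j => j.2 ⟨j.1, ha _⟩⟩
  unfold put
  rw [genEl_eq_push (Equiv.equivOfIsEmpty (Fin 0) _)]
  refine Eq.trans ?_ (relabel_refl x)
  unfold push
  refine congrArg (fun e => E.relabel e x) ?_
  ext i
  obtain ⟨i, rfl⟩ := finSumFinEquiv.surjective i
  cases i with
  | inl i =>
    simp only [Equiv.trans_apply, Equiv.symm_apply_apply]
    exact congrArg Fin.val (ha i)
  | inr i => exact i.elim0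

theorem put_symm_put (e : Fin k ≃ Fin n) (x : E.el k p) (c d) :
    E.put e.symm.toEmbedding (E.put e.toEmbedding x c) d = x := by
  have h : E.put e.toEmbedding x c = E.put e.toEmbedding x (fun i => d (e.symm i)) :=
    put_congr _ _ fun j hj => absurd ⟨e.symm j, e.apply_symm_apply j⟩ hj
  rw [h]
  refine (put_put e.toEmbedding e.symm.toEmbedding x d).trans ?_
  exact put_of_forall_eq _ (fun i => e.symm_apply_apply i) _ _

end SymSpectrum

/-! ### Maps whose complement is freely generated -/

open SymSpectrum

variable {X Y : SymSpectrum.{u}} {p : SimplexCategoryᵒᵖ} {k l m n : ℕ}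

/-- A simplex of `Y` is new if it is not in the image of `X`. -/
def IsNew (f : X ⟶ Y) (y : Y.el n p) : Prop := ∀ x, SymSpectrum.Hom.ev f x ≠ y

/-- The simplices `y ∧ c` and `z ∧ d` of `Y(k) ∧ S^{n - a}` and `Y(l) ∧ S^{n - b}` are both images
of one simplex `w ∧ r` of `Y(m) ∧ S^{n - e}`, for an injection `e : m → n` which factors through
`a` and `b`. -/
def HaveCommonSource (a : Fin k ↪ Fin n) (y : Y.el k p) (c : Fin n → circle.{u}.obj p)
    (b : Fin l ↪ Fin n) (z : Y.el l p) (d : Fin n → circle.{u}.obj p) : Prop :=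
  ∃ (m : ℕ) (s : Fin m ↪ Fin k) (t : Fin m ↪ Fin l) (w : Y.el m p) (r : Fin n → circle.{u}.obj p),
    (∀ i, a (s i) = b (t i)) ∧ Y.put s w (fun i => r (a i)) = y ∧
    Y.put t w (fun i => r (b i)) = z ∧
    (∀ j, j ∉ Set.range a → r j = c j) ∧ ∀ j, j ∉ Set.range b → r j = d j

/-- In simplicial degree `p`, the complement of the image of `f` in level `n` is freely generated:
`f` is injective, new simplices are sent to new simplices by the structure maps, and two ways of
writing a new simplex as an image of new simplices of lower levels have a common source. -/
structure IsFreeAt (f : X ⟶ Y) (n : ℕ) (p : SimplexCategoryᵒᵖ) : Prop where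
  injective : Function.Injective (fun x : X.el n p => SymSpectrum.Hom.ev f x)
  isNew_put : ∀ {k : ℕ} (a : Fin k ↪ Fin n) {y : Y.el k p} {c : Fin n → circle.{u}.obj p},
    IsNew f y → (∀ j, j ∉ Set.range a → c j ≠ pt circle p) → IsNew f (Y.put a y c)
  haveCommonSource : ∀ {k l : ℕ} (a : Fin k ↪ Fin n) {y : Y.el k p} {c : Fin n → circle.{u}.obj p}
    (b : Fin l ↪ Fin n) {z : Y.el l p} {d : Fin n → circle.{u}.obj p},
    IsNew f y → IsNew f z → Y.put a y c = Y.put b z d → IsNew f (Y.put a y c) →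
      HaveCommonSource a y c b z d

/-- The complement of the image of `f` is freely generated in all degrees. -/
def IsFree (f : X ⟶ Y) : Prop := ∀ n p, IsFreeAt f n p

section

variable {f : X ⟶ Y}

theorem IsNew.ne_pt {y : Y.el n p} (h : IsNew f y) : y ≠ pt _ p := fun h' =>
  h (pt _ p) ((ap_pt _).trans h'.symm)

theorem IsNew.of_put {a : Fin k ↪ Fin n} {y : Y.el k p} {c : Fin n → circle.{u}.obj p}
    (h : IsNew f (Y.put a y c)) : IsNew f y := by
  rintro x rfl
  exact h _ (ev_put f a x c)

theorem IsNew.ne_pt_of_put {a : Fin k ↪ Fin n} {y : Y.el k p} {c : Fin n → circle.{u}.obj p}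
    (h : IsNew f (Y.put a y c)) (j : Fin n) (hj : j ∉ Set.range a) : c j ≠ pt circle p :=
  fun h' => h.ne_pt (put_eq_pt a y c hj h')

theorem HaveCommonSource.symm {a : Fin k ↪ Fin n} {y : Y.el k p} {c : Fin n → circle.{u}.obj p}
    {b : Fin l ↪ Fin n} {z : Y.el l p} {d : Fin n → circle.{u}.obj p}
    (h : HaveCommonSource a y c b z d) : HaveCommonSource b z d a y c := by
  obtain ⟨m, s, t, w, r, h1, h2, h3, h4, h5⟩ := h
  exact ⟨m, t, s, w, r, fun i => (h1 i).symm, h3, h2, h5, h4⟩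

/-- The injection underlying the common source can be taken to be the pullback of `a` and `b`, and
the colouring can be prescribed. -/
theorem HaveCommonSource.exists_of_pullback {a : Fin k ↪ Fin n} {y : Y.el k p}
    {c : Fin n → circle.{u}.obj p} {b : Fin l ↪ Fin n} {z : Y.el l p}
    {d : Fin n → circle.{u}.obj p} (h : HaveCommonSource a y c b z d) (s : Fin m ↪ Fin k)
    (t : Fin m ↪ Fin l) (hst : ∀ i, a (s i) = b (t i))
    (hpb : ∀ i j, a i = b j → ∃ q, s q = i) (r : Fin n → circle.{u}.obj p)
    (hc : ∀ j, j ∉ Set.range a → r j = c j) (hd : ∀ j, j ∉ Set.range b → r j = d j) :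
    ∃ w : Y.el m p, Y.put s w (fun i => r (a i)) = y ∧ Y.put t w (fun i => r (b i)) = z := by
  obtain ⟨m', s', t', w, r', h1, rfl, rfl, h4, h5⟩ := h
  choose g hg using fun i => hpb (s' i) (t' i) (h1 i)
  have hg' : ∀ i, t (g i) = t' i := fun i => b.injective (by rw [← hst, hg, h1])
  let e : Fin m' ↪ Fin m := ⟨g, fun i j hij => s'.injective (by rw [← hg, ← hg, hij])⟩
  have hr : ∀ j, (j ∉ Set.range a ∨ j ∉ Set.range b) → r' j = r j := by
    rintro j (hj | hj)
    · rw [h4 j hj, hc j hj]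
    · rw [h5 j hj, hd j hj]
  have hes : e.trans s = s' := Function.Embedding.ext hg
  have het : e.trans t = t' := Function.Embedding.ext hg'
  refine ⟨Y.put e w (fun i => r' (a (s i))), ?_, ?_⟩
  · have h6 : Y.put s (Y.put e w (fun i => r' (a (s i)))) (fun i => r (a i)) =
        Y.put s (Y.put e w (fun i => r' (a (s i)))) (fun i => r' (a i)) := by
      refine put_congr _ _ fun j hj => (hr _ (Or.inr ?_)).symm
      rintro ⟨i, hi⟩
      exact hj (hpb j i hi.symm)
    rw [h6, ← hes]
    exact put_put e s w (fun i => r' (a i))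
  · have h6 : Y.put t (Y.put e w (fun i => r' (a (s i)))) (fun i => r (b i)) =
        Y.put t (Y.put e w (fun i => r' (b (t i)))) (fun i => r' (b i)) := by
      simp only [hst]
      refine put_congr _ _ fun j hj => (hr _ (Or.inl ?_)).symm
      rintro ⟨i, hi⟩
      obtain ⟨q, rfl⟩ := hpb i j hi
      exact hj ⟨q, b.injective ((hst q).symm.trans hi)⟩
    rw [h6, ← het]
    exact put_put e t w (fun i => r' (b i))

/-- The case `a = b`: the structure maps are injective on new simplices. -/
theorem HaveCommonSource.eq {a : Fin k ↪ Fin n} {y z : Y.el k p}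
    {c d : Fin n → circle.{u}.obj p} (h : HaveCommonSource a y c a z d) : y = z := by
  obtain ⟨m, s, t, w, r, h1, rfl, rfl, -, -⟩ := h
  have : s = t := Function.Embedding.ext fun i => a.injective (h1 i)
  rw [this]

theorem HaveCommonSource.color_eq {a : Fin k ↪ Fin n} {y : Y.el k p}
    {c : Fin n → circle.{u}.obj p} {b : Fin l ↪ Fin n} {z : Y.el l p}
    {d : Fin n → circle.{u}.obj p} (h : HaveCommonSource a y c b z d) (j : Fin n)
    (ha : j ∉ Set.range a) (hb : j ∉ Set.range b) : c j = d j := by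
  obtain ⟨m, s, t, w, r, -, -, -, h4, h5⟩ := h
  rw [← h4 j ha, h5 j hb]

end

end SymSp

namespace SymSp

/-! ### Simplices of latching objects -/

open SymSpectrum

section latching

variable {E F : SymSpectrum.{u}} {p : SimplexCategoryᵒᵖ} {k k' l l' n : ℕ}

/-- The restriction of an injection `k ⊔ k' → n` to `k`. -/
abbrev inlEmb (α : Fin k ⊕ Fin k' ↪ Fin n) : Fin k ↪ Fin n := Function.Embedding.inl.trans α

theorem inr_notMem_range_inlEmb (α : Fin k ⊕ Fin k' ↪ Fin n) (i : Fin k') :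
    α (Sum.inr i) ∉ Set.range (inlEmb α) := by
  rintro ⟨j, hj⟩
  cases α.injective hj

/-- The simplex `x ∧ c` of `E(k) ∧ S^{n - k}`, with `S^{n - k}` split into the factor `𝕊̄(k')` and
the factor `S^{n - α}`. -/
def latchRep (hk : k' ≠ 0) (α : Fin k ⊕ Fin k' ↪ Fin n) (x : E.el k p)
    (c : Fin n → circle.{u}.obj p) : SmashRep E truncSphere.toSpectrum n p :=
  ⟨k, k', α, x, ⟨(sph (fun i => c (α (Sum.inr i))) : (sphere (Fin k')).obj p),
    fun h => absurd h hk⟩, fun i => c i.1⟩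

theorem latchRep_congr (hk : k' ≠ 0) (α : Fin k ⊕ Fin k' ↪ Fin n) (x : E.el k p)
    {c d : Fin n → circle.{u}.obj p} (h : ∀ j, j ∉ Set.range (inlEmb α) → c j = d j) :
    latchRep hk α x c = latchRep hk α x d := by
  have h1 : (fun i => c (α (Sum.inr i))) = fun i => d (α (Sum.inr i)) :=
    funext fun i => h _ (inr_notMem_range_inlEmb α i)
  have h2 : (fun i : {i : Fin n // i ∉ Set.range α} => c i.1) = fun i => d i.1 :=
    funext fun i => h _ (by
      rintro ⟨j, hj⟩
      exact i.2 ⟨_, hj⟩)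
  unfold latchRep
  simp only [h1, h2]

/-- The colouring of `n` given by colourings of `k'` and of the complement of `k ⊔ k'`. -/
noncomputable def mergeColors (α : Fin k ⊕ Fin k' ↪ Fin n) (t : Fin k' → circle.{u}.obj p)
    (z : {i : Fin n // i ∉ Set.range α} → circle.{u}.obj p) (i : Fin n) : circle.{u}.obj p :=
  Sum.elim (fun _ => pt circle p) (Sum.elim t z) ((SmashRep.split₃ α).symm i)

theorem mergeColors_inr (α : Fin k ⊕ Fin k' ↪ Fin n) (t : Fin k' → circle.{u}.obj p)
    (z : {i : Fin n // i ∉ Set.range α} → circle.{u}.obj p) (i : Fin k') :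
    mergeColors α t z (α (Sum.inr i)) = t i := by
  have : (SmashRep.split₃ α).symm (α (Sum.inr i)) = Sum.inr (Sum.inl i) :=
    (SmashRep.split₃ α).symm_apply_apply (Sum.inr (Sum.inl i))
  simp [mergeColors, this]

theorem mergeColors_val (α : Fin k ⊕ Fin k' ↪ Fin n) (t : Fin k' → circle.{u}.obj p)
    (z : {i : Fin n // i ∉ Set.range α} → circle.{u}.obj p) (i : {i : Fin n // i ∉ Set.range α}) :
    mergeColors α t z i.1 = z i := by
  have : (SmashRep.split₃ α).symm i.1 = Sum.inr (Sum.inr i) :=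
    (SmashRep.split₃ α).symm_apply_apply (Sum.inr (Sum.inr i))
  simp [mergeColors, this]

theorem isBase_or_exists_latchRep (r : SmashRep E truncSphere.toSpectrum n p) :
    r.IsBase ∨ ∃ (k k' : ℕ) (hk : k' ≠ 0) (α : Fin k ⊕ Fin k' ↪ Fin n) (x : E.el k p)
      (c : Fin n → circle.{u}.obj p), r = latchRep hk α x c := by
  obtain ⟨k, k', α, x, ⟨y, hy⟩, z⟩ := r
  by_cases hk : k' = 0
  · exact Or.inl (Or.inr (Or.inl (Subtype.ext (hy hk))))
  · change (sphere.{u} (Fin k')).obj p at y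
    induction y using sph_ind with
    | hb => exact Or.inl (Or.inr (Or.inl rfl))
    | hm t =>
      refine Or.inr ⟨k, k', hk, α, x, mergeColors α t z, ?_⟩
      unfold latchRep
      simp only [mergeColors_inr, mergeColors_val]

/-- The simplices of `L_n(E)`. -/
theorem latching_ind {C : ((latching n).obj E).V.obj p → Prop} (hb : C (pt _ p))
    (hr : ∀ {k k' : ℕ} (hk : k' ≠ 0) (α : Fin k ⊕ Fin k' ↪ Fin n) (x : E.el k p)
      (c : Fin n → circle.{u}.obj p), C (Quot.mk _ (latchRep hk α x c))) (x) : C x := by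
  obtain ⟨r, rfl⟩ := Quot.exists_rep x
  rcases isBase_or_exists_latchRep r with h | ⟨k, k', hk, α, x, c, rfl⟩
  · rw [show Quot.mk _ r = pt ((latching n).obj E).V p from
      Quot.sound (.base _ _ h SmashRep.basePt_isBase)]
    exact hb
  · exact hr hk α x c

theorem latchingMap_latchRep (hk : k' ≠ 0) (α : Fin k ⊕ Fin k' ↪ Fin n) (x : E.el k p)
    (c : Fin n → circle.{u}.obj p) :
    ap ((latchingMap n).app E).hom (Quot.mk _ (latchRep hk α x c)) = E.put (inlEmb α) x c :=
  genEl_eq_put (SmashRep.split₃ α) x _ c (by rintro (i | i) <;> rfl)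

theorem latching_map_latchRep (f : E ⟶ F) (hk : k' ≠ 0) (α : Fin k ⊕ Fin k' ↪ Fin n)
    (x : E.el k p) (c : Fin n → circle.{u}.obj p) :
    ap ((latching n).map f).hom (Quot.mk _ (latchRep hk α x c)) =
      Quot.mk _ (latchRep hk α (SymSpectrum.Hom.ev f x) c) := rfl

theorem latching_map_pt (f : E ⟶ F) :
    ap ((latching n).map f).hom (pt ((latching n).obj E).V p) = pt ((latching n).obj F).V p :=
  ap_pt _

theorem ne_zero_of_embedding (hk : k' ≠ 0) (γ' : Fin k' ↪ Fin l') : l' ≠ 0 := by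
  rintro rfl
  exact (γ' ⟨0, Nat.pos_of_ne_zero hk⟩).elim0

theorem move_latchRep (hk : k' ≠ 0) (γ : Fin k ↪ Fin l) (γ' : Fin k' ↪ Fin l')
    (β : Fin l ⊕ Fin l' ↪ Fin n) (x : E.el k p) (c : Fin n → circle.{u}.obj p) :
    SmashRep.move γ γ' β x (latchRep hk ((γ.sumMap γ').trans β) x c).y
        (latchRep hk ((γ.sumMap γ').trans β) x c).z =
      latchRep (ne_zero_of_embedding hk γ') β (E.put γ x (fun i => c (inlEmb β i))) c := by
  have hy : truncSphere.toSpectrum.genEl (split γ')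
      (latchRep hk ((γ.sumMap γ').trans β) x c).y (fun j => c (β (Sum.inr j.1))) =
      (latchRep (ne_zero_of_embedding hk γ') β (E.put γ x (fun i => c (inlEmb β i))) c).y := by
    apply Subtype.ext
    refine (ev_genEl truncSphere.ι (split γ')
      (latchRep hk ((γ.sumMap γ').trans β) x c).y (fun j => c (β (Sum.inr j.1)))).trans ?_
    refine (sphereSpectrum_genEl (split γ') _ _).trans (congrArg sph (funext fun i => ?_))
    obtain ⟨j, rfl⟩ := (split γ').surjective i
    rw [Equiv.symm_apply_apply]
    cases j <;> rfl
  unfold SmashRep.move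
  rw [SmashRep.mk.injEq]
  exact ⟨rfl, rfl, HEq.rfl, HEq.rfl, heq_of_eq hy, HEq.rfl⟩

/-- A representative of the base point is moved to a representative of the base point. -/
theorem move_isBase (γ : Fin k ↪ Fin l) (γ' : Fin k' ↪ Fin l') (β : Fin l ⊕ Fin l' ↪ Fin n)
    (x : E.el k p) (y : F.el k' p)
    (z : {i : Fin n // i ∉ Set.range ((γ.sumMap γ').trans β)} → circle.{u}.obj p)
    (h : SmashRep.IsBase ⟨k, k', (γ.sumMap γ').trans β, x, y, z⟩) :
    (SmashRep.move γ γ' β x y z).IsBase := by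
  dsimp only [SmashRep.IsBase] at h
  dsimp only [SmashRep.IsBase, SmashRep.move]
  rcases h with h | h | ⟨⟨i, hi⟩, h⟩
  · have h1 : ∀ t, E.genEl (split γ) x t = pt _ p := by
      rw [show x = pt _ p from h]
      exact genEl_pt _
    exact Or.inl (h1 _)
  · have h1 : ∀ t, F.genEl (split γ') y t = pt _ p := by
      rw [show y = pt _ p from h]
      exact genEl_pt _
    exact Or.inr (Or.inl (h1 _))
  · by_cases hβ : i ∈ Set.range β
    · obtain ⟨j | j, rfl⟩ := hβ
      · have hj : j ∉ Set.range γ := fun ⟨a, ha⟩ =>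
          hi ⟨Sum.inl a, congrArg (fun j => β (Sum.inl j)) ha⟩
        refine Or.inl ?_
        refine genEl_eq_pt (split γ) x _ ⟨j, hj⟩ ?_
        exact h
      · have hj : j ∉ Set.range γ' := fun ⟨a, ha⟩ =>
          hi ⟨Sum.inr a, congrArg (fun j => β (Sum.inr j)) ha⟩
        refine Or.inr (Or.inl ?_)
        refine genEl_eq_pt (split γ') y _ ⟨j, hj⟩ ?_
        exact h
    · exact Or.inr (Or.inr ⟨⟨i, hβ⟩, h⟩)

theorem latchRep_move (hk : k' ≠ 0) (γ : Fin k ↪ Fin l) (γ' : Fin k' ↪ Fin l')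
    (β : Fin l ⊕ Fin l' ↪ Fin n) (x : E.el k p) (c : Fin n → circle.{u}.obj p) :
    Quot.mk SmashRep.Rel (latchRep hk ((γ.sumMap γ').trans β) x c) =
      Quot.mk SmashRep.Rel (latchRep (ne_zero_of_embedding hk γ') β
        (E.put γ x (fun i => c (inlEmb β i))) c) := by
  rw [← move_latchRep hk]
  exact Quot.sound (SmashRep.Rel.move γ γ' β x _ _)

/-- The class of `x ∧ c` does not depend on the splitting of the sphere. -/
theorem latchRep_eq_of_inlEmb_eq (hk : k' ≠ 0) (hl : l' ≠ 0) (α : Fin k ⊕ Fin k' ↪ Fin n)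
    (β : Fin k ⊕ Fin l' ↪ Fin n) (h : inlEmb α = inlEmb β) (x : E.el k p)
    (c : Fin n → circle.{u}.obj p) :
    Quot.mk SmashRep.Rel (latchRep hk α x c) = Quot.mk SmashRep.Rel (latchRep hl β x c) := by
  -- both splittings are compared with the one given by the whole complement of `k`
  let M := {j : Fin n // j ∉ Set.range (inlEmb α)}
  let e := Finite.equivFin M
  have hM : Nat.card M ≠ 0 := by
    have : Nonempty M := ⟨⟨α (Sum.inr ⟨0, Nat.pos_of_ne_zero hk⟩), inr_notMem_range_inlEmb α _⟩⟩
    exact Nat.card_pos.ne'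
  let ω : Fin k ⊕ Fin (Nat.card M) ↪ Fin n :=
    ((Equiv.sumCongr (Equiv.refl _) e.symm).trans (split (inlEmb α))).toEmbedding
  have key : ∀ {r : ℕ} (hr : r ≠ 0) (θ : Fin k ⊕ Fin r ↪ Fin n), inlEmb α = inlEmb θ →
      Quot.mk SmashRep.Rel (latchRep hr θ x c) = Quot.mk SmashRep.Rel (latchRep hM ω x c) := by
    intro r hr θ hθ
    let γ' : Fin r ↪ Fin (Nat.card M) :=
      ⟨fun i => e ⟨θ (Sum.inr i), by rw [hθ]; exact inr_notMem_range_inlEmb θ i⟩, by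
        intro i j hij
        have := congrArg Subtype.val (e.injective hij)
        exact Sum.inr.inj (θ.injective this)⟩
    have hθ' : θ = ((Function.Embedding.refl _).sumMap γ').trans ω := by
      ext (i | i)
      · exact congrArg Fin.val (DFunLike.congr_fun hθ i).symm
      · refine congrArg Fin.val ?_
        change _ = (split (inlEmb α)) (Sum.inr (e.symm (e ⟨θ (Sum.inr i), _⟩)))
        rw [e.symm_apply_apply]
        rfl
    have h1 := latchRep_move hr (Function.Embedding.refl _) γ' ω x c
    rw [put_of_forall_eq _ (fun _ => rfl)] at h1
    rw [← h1]
    exact congrArg (fun θ => Quot.mk SmashRep.Rel (latchRep hr θ x c)) hθ'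
  rw [key hk α rfl, key hl β h]

/-- Simplices of `E(k) ∧ S^{n-a}` and `E(l) ∧ S^{n-b}` with a common source agree in `L_n(E)`. -/
theorem latchRep_eq_of_haveCommonSource (hk : k' ≠ 0) (hl : l' ≠ 0)
    (α : Fin k ⊕ Fin k' ↪ Fin n) (β : Fin l ⊕ Fin l' ↪ Fin n) {x : E.el k p} {y : E.el l p}
    {c d : Fin n → circle.{u}.obj p} (h : HaveCommonSource (inlEmb α) x c (inlEmb β) y d) :
    Quot.mk SmashRep.Rel (latchRep hk α x c) = Quot.mk SmashRep.Rel (latchRep hl β y d) := by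
  obtain ⟨m, s, t, w, r, h1, rfl, rfl, h4, h5⟩ := h
  rw [← latchRep_congr hk α _ h4, ← latchRep_congr hl β _ h5]
  have h2 := latchRep_move hk s (Function.Embedding.refl _) α w r
  have h3 := latchRep_move hl t (Function.Embedding.refl _) β w r
  rw [← h2, ← h3]
  exact latchRep_eq_of_inlEmb_eq _ _ _ _ (Function.Embedding.ext h1) _ _

/-- Functions out of `L_n(E)`. As the second summand of an injection `k ⊔ k' → n` indexing a simplex
is nonempty, compatibility with the structure maps is needed in levels below `n` only. -/
theorem exists_latching_lift {Q : Type u} (Φ : ∀ {k : ℕ}, (Fin k ↪ Fin n) → E.el k p →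
      (Fin n → circle.{u}.obj p) → Q) (b : Q)
    (hcongr : ∀ {k : ℕ} (a : Fin k ↪ Fin n) (x : E.el k p) (c d : Fin n → circle.{u}.obj p),
      (∀ j, j ∉ Set.range a → c j = d j) → Φ a x c = Φ a x d)
    (hpt : ∀ {k : ℕ} (a : Fin k ↪ Fin n) (c), Φ a (pt _ p) c = b)
    (hcol : ∀ {k : ℕ} (a : Fin k ↪ Fin n) (x : E.el k p) (c j), j ∉ Set.range a →
      c j = pt circle p → Φ a x c = b)
    (hput : ∀ {k l : ℕ} (e : Fin k ↪ Fin l) (a : Fin l ↪ Fin n) (x : E.el k p)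
      (c : Fin n → circle.{u}.obj p), l < n →
      Φ (e.trans a) x c = Φ a (E.put e x (fun i => c (a i))) c) :
    ∃ Ψ : ((latching n).obj E).V.obj p → Q, Ψ (pt _ p) = b ∧
      ∀ {k k' : ℕ} (hk : k' ≠ 0) (α : Fin k ⊕ Fin k' ↪ Fin n) (x : E.el k p)
        (c : Fin n → circle.{u}.obj p), Ψ (Quot.mk _ (latchRep hk α x c)) = Φ (inlEmb α) x c := by
  let Ψ : SmashRep E truncSphere.toSpectrum n p → Q := fun r =>
    sphLift (fun t => Φ (inlEmb r.α) r.x (mergeColors r.α t r.z)) b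
      (fun t i hi => hcol _ _ _ (r.α (Sum.inr i)) (inr_notMem_range_inlEmb _ _) (by
        rw [mergeColors_inr, hi]))
      (SymSpectrum.Hom.ev truncSphere.ι r.y)
  have hbase : ∀ r, r.IsBase → Ψ r = b := by
    intro r h
    have hs : ∀ (F : (Fin r.k' → circle.{u}.obj p) → Q) (hF) (_ : ∀ t, F t = b)
        (s : (sphere (Fin r.k')).obj p), sphLift F b hF s = b := by
      intro F hF hF' s
      induction s using sph_ind with
      | hb => rfl
      | hm t => exact hF' t
    rcases h with h | h | ⟨i, h⟩
    · exact hs _ _ (fun t => by rw [h]; exact hpt _ _) _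
    · change sphLift _ _ _ (SymSpectrum.Hom.ev truncSphere.ι r.y) = b
      rw [h]
      rfl
    · refine hs _ _ (fun t => hcol _ _ _ i.1 ?_ ?_) _
      · rintro ⟨j, hj⟩
        exact i.2 ⟨_, hj⟩
      · rw [mergeColors_val, h]
  have hrep : ∀ {k k' : ℕ} (hk : k' ≠ 0) (α : Fin k ⊕ Fin k' ↪ Fin n) (x : E.el k p)
      (c : Fin n → circle.{u}.obj p), Ψ (latchRep hk α x c) = Φ (inlEmb α) x c := by
    intro k k' hk α x c
    refine hcongr _ _ _ _ fun j hj => ?_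
    obtain ⟨i, rfl⟩ := (SmashRep.split₃ α).surjective j
    rcases i with i | i | i
    · exact absurd ⟨i, rfl⟩ hj
    · exact mergeColors_inr α _ _ i
    · exact mergeColors_val α _ _ i
  refine ⟨Quot.lift Ψ ?_, hbase _ SmashRep.basePt_isBase, hrep⟩
  intro r r' h
  cases h with
  | base _ _ h h' => rw [hbase _ h, hbase _ h']
  | @move k k' l l' γ γ' β x y z =>
    rcases isBase_or_exists_latchRep (⟨k, k', (γ.sumMap γ').trans β, x, y, z⟩ :
      SmashRep E truncSphere.toSpectrum n p) with h | ⟨k₁, k₁', hk, α, x₁, c, h⟩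
    · rw [hbase _ h]
      exact (hbase _ (move_isBase γ γ' β x y z h)).symm
    · obtain ⟨rfl, rfl, h1, h2, h3, h4⟩ := SmashRep.mk.inj h
      obtain rfl := eq_of_heq h1
      obtain rfl := eq_of_heq h2
      obtain rfl := eq_of_heq h3
      obtain rfl := eq_of_heq h4
      have h5 := move_latchRep hk γ γ' β x c
      refine (hrep hk _ x c).trans (Eq.trans ?_ ((congrArg Ψ h5).trans (hrep _ _ _ c)).symm)
      refine hput γ (inlEmb β) x c ?_
      have := Fintype.card_le_of_embedding β
      have h6 := ne_zero_of_embedding hk γ'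
      simp only [Fintype.card_sum, Fintype.card_fin] at this
      lia

/-- Functions out of `L_n(E)`, where only the levels below `n` matter. -/
theorem exists_latching_lift_of_lt {Q : Type u} (Φ : ∀ {k : ℕ}, (Fin k ↪ Fin n) → E.el k p →
      (Fin n → circle.{u}.obj p) → Q) (b : Q)
    (hcongr : ∀ {k : ℕ} (a : Fin k ↪ Fin n) (x : E.el k p) (c d : Fin n → circle.{u}.obj p),
      k < n → (∀ j, j ∉ Set.range a → c j = d j) → Φ a x c = Φ a x d)
    (hpt : ∀ {k : ℕ} (a : Fin k ↪ Fin n) (c), k < n → Φ a (pt _ p) c = b)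
    (hcol : ∀ {k : ℕ} (a : Fin k ↪ Fin n) (x : E.el k p) (c j), k < n → j ∉ Set.range a →
      c j = pt circle p → Φ a x c = b)
    (hput : ∀ {k l : ℕ} (e : Fin k ↪ Fin l) (a : Fin l ↪ Fin n) (x : E.el k p)
      (c : Fin n → circle.{u}.obj p), l < n →
      Φ (e.trans a) x c = Φ a (E.put e x (fun i => c (a i))) c) :
    ∃ Ψ : ((latching n).obj E).V.obj p → Q, Ψ (pt _ p) = b ∧
      ∀ {k k' : ℕ} (hk : k' ≠ 0) (α : Fin k ⊕ Fin k' ↪ Fin n) (x : E.el k p)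
        (c : Fin n → circle.{u}.obj p), Ψ (Quot.mk _ (latchRep hk α x c)) = Φ (inlEmb α) x c := by
  obtain ⟨Ψ, h1, h2⟩ := exists_latching_lift (E := E) (n := n) (p := p)
    (fun {k} a x c => if k < n then Φ a x c else b) b
    (fun a x c d h => by
      split_ifs with hk
      · exact hcongr a x c d hk h
      · rfl)
    (fun a c => by
      split_ifs with hk
      · exact hpt a c hk
      · rfl)
    (fun a x c j hj h => by
      split_ifs with hk
      · exact hcol a x c j hk hj h
      · rfl)
    (fun {k l} e a x c hl => by
      have hk : k < n := lt_of_le_of_lt (by simpa using Fintype.card_le_of_embedding e) hl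
      rw [if_pos hl, if_pos hk]
      exact hput e a x c hl)
  refine ⟨Ψ, h1, fun {k k'} hk α x c => (h2 hk α x c).trans (if_pos ?_)⟩
  have := Fintype.card_le_of_embedding α
  simp only [Fintype.card_sum, Fintype.card_fin] at this
  lia

theorem exists_inlEmb_eq (a : Fin k ↪ Fin n) (hk : k < n) :
    ∃ (k' : ℕ) (_ : k' ≠ 0) (α : Fin k ⊕ Fin k' ↪ Fin n), inlEmb α = a := by
  refine ⟨_, ?_, ((Equiv.sumCongr (Equiv.refl _)
    (Finite.equivFin {j : Fin n // j ∉ Set.range a}).symm).trans (split a)).toEmbedding, rfl⟩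
  intro h
  have h1 := Nat.card_congr (split a)
  rw [Nat.card_sum, h, Nat.card_fin, Nat.card_fin] at h1
  lia

end latching

end SymSp

namespace SymSp

/-! ### Flat cofibrations are the maps with freely generated complement -/

open SymSpectrum

variable {X Y : SymSpectrum.{u}} {f : X ⟶ Y} {p : SimplexCategoryᵒᵖ} {k l m n : ℕ}

theorem HaveCommonSource.refl (a : Fin k ↪ Fin n) (y : Y.el k p) (c : Fin n → circle.{u}.obj p) :
    HaveCommonSource a y c a y c :=
  ⟨k, Function.Embedding.refl _, Function.Embedding.refl _, y, c, fun _ => rfl,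
    put_of_forall_eq _ (fun _ => rfl) _ _, put_of_forall_eq _ (fun _ => rfl) _ _,
    fun _ _ => rfl, fun _ _ => rfl⟩

theorem HaveCommonSource.congr_right {a : Fin k ↪ Fin n} {y : Y.el k p}
    {c : Fin n → circle.{u}.obj p} {b : Fin l ↪ Fin n} {z : Y.el l p}
    {d d' : Fin n → circle.{u}.obj p} (h : HaveCommonSource a y c b z d)
    (hd : ∀ j, j ∉ Set.range b → d j = d' j) : HaveCommonSource a y c b z d' := by
  obtain ⟨m, s, t, w, r, h1, h2, h3, h4, h5⟩ := h
  exact ⟨m, s, t, w, r, h1, h2, h3, h4, fun j hj => (h5 j hj).trans (hd j hj)⟩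

theorem HaveCommonSource.of_surjective (a : Fin n ≃ Fin n) {y : Y.el n p}
    {c : Fin n → circle.{u}.obj p} {b : Fin l ↪ Fin n} {z : Y.el l p}
    {d : Fin n → circle.{u}.obj p} (h : Y.put a.toEmbedding y c = Y.put b z d) :
    HaveCommonSource a.toEmbedding y c b z d := by
  refine ⟨l, b.trans a.symm.toEmbedding, Function.Embedding.refl _, z, d, fun i => ?_, ?_,
    put_of_forall_eq _ (fun _ => rfl) _ _, fun j hj => absurd ⟨a.symm j, a.apply_symm_apply j⟩ hj,
    fun _ _ => rfl⟩
  · exact a.apply_symm_apply _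
  · have h1 := put_put b a.symm.toEmbedding z (fun i => d (a i))
    have h2 : (fun i => d (a (a.symm.toEmbedding i))) = d :=
      funext fun i => congrArg d (a.apply_symm_apply i)
    rw [h2, ← h] at h1
    exact h1.symm.trans (put_symm_put a y c _)

theorem exists_equiv_of_embedding (a : Fin n ↪ Fin n) : ∃ e : Fin n ≃ Fin n, e.toEmbedding = a :=
  ⟨Equiv.ofBijective a (Finite.injective_iff_bijective.1 a.injective), rfl⟩

/-- A common source of a simplex of level `k`, and another simplex, is also one of its image in a
level `l < n`. -/
theorem HaveCommonSource.put_right {a : Fin m ↪ Fin n} {y : Y.el m p}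
    {c : Fin n → circle.{u}.obj p} {e : Fin k ↪ Fin l} {b : Fin l ↪ Fin n} {z : Y.el k p}
    {d : Fin n → circle.{u}.obj p} (h : HaveCommonSource a y c (e.trans b) z d) :
    HaveCommonSource a y c b (Y.put e z (fun i => d (b i))) d := by
  obtain ⟨q, s, t, w, r, h1, h2, h3, h4, h5⟩ := h
  refine ⟨q, s, t.trans e, w, r, h1, h2, ?_, h4, fun j hj => h5 j ?_⟩
  · refine (put_put t e w (fun i => r (b i))).symm.trans ?_
    have h3' : Y.put t w (fun i => r (b (e i))) = z := h3
    rw [h3']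
    refine put_congr _ _ fun j hj => h5 _ ?_
    rintro ⟨i, hi⟩
    exact hj ⟨i, b.injective hi⟩
  · rintro ⟨i, rfl⟩
    exact hj ⟨e i, rfl⟩

/-- Conversely, a common source with the image of a simplex in level `l` refines to a common source
with the simplex itself, if the complement of the image of `f` is freely generated in level `l`. -/
theorem HaveCommonSource.of_put_right {a : Fin m ↪ Fin n} {y : Y.el m p}
    {c : Fin n → circle.{u}.obj p} {e : Fin k ↪ Fin l} {b : Fin l ↪ Fin n} {z : Y.el k p}
    {d : Fin n → circle.{u}.obj p} (hf : IsFreeAt f l p)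
    (hz : IsNew f (Y.put e z (fun i => d (b i))))
    (h : HaveCommonSource a y c b (Y.put e z (fun i => d (b i))) d) :
    HaveCommonSource a y c (e.trans b) z d := by
  classical
  obtain ⟨q, s, t, w, r, h1, h2, h3, h4, h5⟩ := h
  have hw : IsNew f (Y.put t w (fun i => r (b i))) := h3 ▸ hz
  obtain ⟨q', s', t', w', r', h1', rfl, rfl, h4', h5'⟩ :=
    hf.haveCommonSource t e hw.of_put hz.of_put h3 hw
  -- the colouring of `n` which is `r'` on the image of `b`, and `r` elsewhere
  let r'' : Fin n → circle.{u}.obj p := fun j => if h : ∃ i, b i = j then r' h.choose else r j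
  have hr₁ : ∀ i, r'' (b i) = r' i := by
    intro i
    have h : ∃ i', b i' = b i := ⟨i, rfl⟩
    change (if h : ∃ i', b i' = b i then r' h.choose else r (b i)) = _
    rw [dif_pos h, b.injective h.choose_spec]
  have hr₂ : ∀ j, j ∉ Set.range b → r'' j = r j := fun j hj => dif_neg hj
  have hr₃ : ∀ j, (∀ i, b (t i) ≠ j) → r'' j = r j := by
    intro j hj
    by_cases hb : j ∈ Set.range b
    · obtain ⟨i, rfl⟩ := hb
      rw [hr₁]
      refine h4' i ?_
      rintro ⟨i', rfl⟩
      exact hj i' rfl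
    · exact hr₂ j hb
  refine ⟨q', s'.trans s, t', w', r'', fun i => ?_, ?_, ?_, fun j hj => ?_, fun j hj => ?_⟩
  · exact (h1 (s' i)).trans (congrArg b (h1' i))
  · refine (put_put s' s w' (fun i => r'' (a i))).symm.trans ?_
    have h6 : (fun i => r'' (a (s i))) = fun i => r' (t i) := funext fun i => by rw [h1, hr₁]
    rw [h6, ← h2]
    refine put_congr _ _ fun i hi => hr₃ _ fun i' hi' => ?_
    rw [← h1] at hi'
    exact hi ⟨i', a.injective hi'⟩
  · exact congrArg (Y.put t' w') (funext fun i => hr₁ (e i))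
  · rw [← h4 j hj]
    refine hr₃ j fun i hi => ?_
    rw [← h1] at hi
    exact hj ⟨_, hi⟩
  · by_cases hb : j ∈ Set.range b
    · obtain ⟨i, rfl⟩ := hb
      rw [hr₁]
      refine h5' i ?_
      rintro ⟨i', rfl⟩
      exact hj ⟨i', rfl⟩
    · rw [hr₂ j hb, h5 j hb]

/-- If the complement of the image of `f` is freely generated in level `n`, then `ν_n(f)` is
injective: its source consists of the simplices of `X_n` and of classes `y ∧ c` with `y` new. -/
theorem IsFreeAt.latchingInjective (hf : IsFreeAt f n p) : LatchingInjective f n p := by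
  let R : X.el n p ⊕ ((latching n).obj Y).V.obj p →
      X.el n p ⊕ ((latching n).obj Y).V.obj p → Prop := fun x y =>
    ∃ a : ((latching n).obj X).V.obj p,
      x = Sum.inl (ap ((latchingMap n).app X).hom a) ∧
        y = Sum.inr (ap ((latching n).map f).hom a)
  let V : X.el n p ⊕ ((latching n).obj Y).V.obj p → Y.el n p :=
    Sum.elim (fun x : X.el n p => SymSpectrum.Hom.ev f x)
      (fun x : ((latching n).obj Y).V.obj p => ap ((latchingMap n).app Y).hom x)
  have hbase : Quot.mk R (Sum.inr (pt _ p)) = Quot.mk R (Sum.inl (pt _ p)) :=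
    (Quot.sound ⟨pt _ p, congrArg Sum.inl (ap_pt _).symm, congrArg Sum.inr (ap_pt _).symm⟩).symm
  -- every element comes from `X_n`, or is the class of `y ∧ c` with `y` new and no colour at the
  -- base point
  have hnormal : ∀ q, (∃ x, Quot.mk R q = Quot.mk R (Sum.inl x) ∧ V q = SymSpectrum.Hom.ev f x) ∨
      ∃ (k k' : ℕ) (hk : k' ≠ 0) (α : Fin k ⊕ Fin k' ↪ Fin n) (y : Y.el k p)
        (c : Fin n → circle.{u}.obj p), q = Sum.inr (Quot.mk _ (latchRep hk α y c)) ∧ IsNew f y ∧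
          ∀ j, j ∉ Set.range (inlEmb α) → c j ≠ pt circle p := by
    rintro (x | z)
    · exact Or.inl ⟨x, rfl, rfl⟩
    · induction z using latching_ind with
      | hb => exact Or.inl ⟨pt _ p, hbase, (ap_pt _).trans (ap_pt _).symm⟩
      | hr hk α y c =>
        by_cases hy : IsNew f y
        · by_cases hc : ∀ j, j ∉ Set.range (inlEmb α) → c j ≠ pt circle p
          · exact Or.inr ⟨_, _, hk, α, y, c, rfl, hy, hc⟩
          · left
            push Not at hc
            obtain ⟨j, hj, hc⟩ := hc
            refine ⟨pt _ p, ?_, ?_⟩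
            · rw [← hbase]
              refine congrArg (fun z => Quot.mk R (Sum.inr z)) (Quot.sound (.base _ _ ?_
                SmashRep.basePt_isBase))
              obtain ⟨i, rfl⟩ := (SmashRep.split₃ α).surjective j
              rcases i with i | i | i
              · exact absurd ⟨i, rfl⟩ hj
              · exact Or.inr (Or.inl (Subtype.ext (sph_eq_pt (i := i) hc)))
              · exact Or.inr (Or.inr ⟨i, hc⟩)
            · refine (latchingMap_latchRep hk α y c).trans ?_
              exact (put_eq_pt _ _ _ hj hc).trans (ap_pt _).symm
        · left
          unfold IsNew at hy
          push Not at hy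
          obtain ⟨x, rfl⟩ := hy
          refine ⟨X.put (inlEmb α) x c, ?_, ?_⟩
          · exact (Quot.sound ⟨Quot.mk _ (latchRep hk α x c),
              congrArg Sum.inl (latchingMap_latchRep hk α x c).symm, rfl⟩).symm
          · exact (latchingMap_latchRep hk α _ c).trans (ev_put f _ x c).symm
  intro q q' h
  rcases hnormal q with ⟨x, hx, hvx⟩ | ⟨k, k', hk, α, y, c, rfl, hy, hc⟩ <;>
  rcases hnormal q' with ⟨x', hx', hvx'⟩ | ⟨l, l', hl, β, z, d, rfl, hz, hd⟩
  · obtain rfl := hf.injective (hvx.symm.trans (h.trans hvx'))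
    exact hx.trans hx'.symm
  · exact absurd (hvx.symm.trans (h.trans (latchingMap_latchRep hl β z d)))
      (hf.isNew_put _ hz hd x)
  · exact absurd (hvx'.symm.trans (h.symm.trans (latchingMap_latchRep hk α y c)))
      (hf.isNew_put _ hy hc x')
  · have h1 : Y.put (inlEmb α) y c = Y.put (inlEmb β) z d :=
      (latchingMap_latchRep hk α y c).symm.trans (h.trans (latchingMap_latchRep hl β z d))
    have h2 := hf.haveCommonSource _ _ hy hz h1 (hf.isNew_put _ hy hc)
    exact congrArg (fun z => Quot.mk R (Sum.inr z)) (latchRep_eq_of_haveCommonSource hk hl α β h2)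

/-- A function out of the source of `ν_n(f)` to propositions, given by compatible functions `Φ` and
`Ψ`, only depends on the image under `ν_n(f)` if `ν_n(f)` is injective. -/
theorem LatchingInjective.iff_of_eq (h : LatchingInjective f n p) (Φ : X.el n p → Prop)
    (Ψ : ((latching n).obj Y).V.obj p → ULift.{u} Prop)
    (hΦΨ : ∀ a : ((latching n).obj X).V.obj p, Φ (ap ((latchingMap n).app X).hom a) ↔
      (Ψ (ap ((latching n).map f).hom a)).down)
    {q q' : X.el n p ⊕ ((latching n).obj Y).V.obj p}
    (hq : Sum.elim (fun x : X.el n p => SymSpectrum.Hom.ev f x)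
      (fun x : ((latching n).obj Y).V.obj p => ap ((latchingMap n).app Y).hom x) q =
      Sum.elim (fun x : X.el n p => SymSpectrum.Hom.ev f x)
      (fun x : ((latching n).obj Y).V.obj p => ap ((latchingMap n).app Y).hom x) q') :
    Sum.elim Φ (fun z => (Ψ z).down) q ↔ Sum.elim Φ (fun z => (Ψ z).down) q' := by
  have h1 := congrArg (Quot.lift (Sum.elim Φ (fun z => (Ψ z).down)) (by
    rintro _ _ ⟨a, rfl, rfl⟩
    exact propext (hΦΨ a))) (h q q' hq)
  exact Iff.of_eq h1

/-- A simplex of level below `n` represents the simplex `x` of `X_n` if it comes from a simplex of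
`X` sent to `x` (or if a colour is the base point, and so is `x`). This is well defined on the
source of `ν_n(f)`, which therefore contains `X_n`, disjointly from the new simplices. -/
theorem exists_represents (hf : ∀ m < n, IsFreeAt f m p) (x : X.el n p) :
    ∃ Ψ : ((latching n).obj Y).V.obj p → ULift.{u} Prop,
      (∀ a : ((latching n).obj X).V.obj p, ap ((latchingMap n).app X).hom a = x ↔
        (Ψ (ap ((latching n).map f).hom a)).down) ∧
      ∀ {k k' : ℕ} (hk : k' ≠ 0) (α : Fin k ⊕ Fin k' ↪ Fin n) (y : Y.el k p)
        (c : Fin n → circle.{u}.obj p), (Ψ (Quot.mk _ (latchRep hk α y c))).down →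
          IsNew f y → ∃ j, j ∉ Set.range (inlEmb α) ∧ c j = pt circle p := by
  have hpt : ∀ {k : ℕ} (_ : k < n) (x' : X.el k p), SymSpectrum.Hom.ev f x' = pt _ p →
      x' = pt _ p := fun hk x' h => (hf _ hk).injective (h.trans (ap_pt _).symm)
  have hcol : ∀ {k : ℕ} (a : Fin k ↪ Fin n) (y : Y.el k p) (c : Fin n → circle.{u}.obj p) (j),
      j ∉ Set.range a → c j = pt circle p →
      (((∃ x', SymSpectrum.Hom.ev f x' = y ∧ X.put a x' c = x) ∨
        ((∃ j, j ∉ Set.range a ∧ c j = pt circle p) ∧ x = pt _ p)) ↔ x = pt _ p) := by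
    intro k a y c j hj hc
    constructor
    · rintro (⟨x', -, rfl⟩ | ⟨-, h⟩)
      · exact put_eq_pt _ _ _ hj hc
      · exact h
    · exact fun h => Or.inr ⟨⟨j, hj, hc⟩, h⟩
  obtain ⟨Ψ, h1, h2⟩ := exists_latching_lift_of_lt (E := Y) (n := n) (p := p)
    (fun a y c => ULift.up ((∃ x', SymSpectrum.Hom.ev f x' = y ∧ X.put a x' c = x) ∨
      ((∃ j, j ∉ Set.range a ∧ c j = pt circle p) ∧ x = pt _ p))) (ULift.up (x = pt _ p))
    (fun a y c d _ h => by
      have h1 : ∀ x', X.put a x' c = X.put a x' d := fun x' => put_congr a x' h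
      refine congrArg ULift.up (propext (or_congr (by simp only [h1])
        (and_congr_left fun _ => exists_congr fun j => and_congr_right fun hj => ?_)))
      rw [h j hj])
    (fun a c hk => by
      refine congrArg ULift.up (propext ⟨?_, fun h => Or.inl ⟨pt _ p, ap_pt _, ?_⟩⟩)
      · rintro (⟨x', h, rfl⟩ | ⟨-, h⟩)
        · rw [hpt hk x' h, put_pt]
        · exact h
      · rw [put_pt, h])
    (fun a y c j _ hj hc => congrArg ULift.up (propext (hcol a y c j hj hc)))
    (fun {k l} e a y c hl => by
      refine congrArg ULift.up (propext ⟨?_, ?_⟩)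
      · rintro (⟨x', rfl, rfl⟩ | ⟨⟨j, hj, hc⟩, rfl⟩)
        · exact Or.inl ⟨_, ev_put f _ x' _, put_put e a x' c⟩
        · by_cases hja : j ∈ Set.range a
          · obtain ⟨i, rfl⟩ := hja
            refine Or.inl ⟨pt _ p, ?_, put_pt _ _⟩
            rw [put_eq_pt e y _ (j := i) (fun ⟨i', hi'⟩ => hj ⟨i', congrArg a hi'⟩) hc]
            exact ap_pt _
          · exact Or.inr ⟨⟨j, hja, hc⟩, rfl⟩
      · rintro (⟨x', hx', rfl⟩ | ⟨⟨j, hj, hc⟩, h⟩)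
        · by_cases hc : ∀ i, i ∉ Set.range e → c (a i) ≠ pt circle p
          · by_cases hy : IsNew f y
            · exact absurd hx' ((hf l hl).isNew_put e hy hc x')
            · unfold IsNew at hy
              push Not at hy
              obtain ⟨x, rfl⟩ := hy
              rw [← ev_put] at hx'
              obtain rfl := (hf l hl).injective hx'
              exact Or.inl ⟨x, rfl, (put_put e a x c).symm⟩
          · push Not at hc
            obtain ⟨i, hi, hc⟩ := hc
            refine Or.inr ⟨⟨a i, fun ⟨i', hi'⟩ => hi ⟨i', a.injective hi'⟩, hc⟩, ?_⟩
            rw [put_eq_pt e y _ hi hc] at hx'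
            rw [hpt hl x' hx', put_pt]
        · exact Or.inr ⟨⟨j, fun ⟨i, hi⟩ => hj ⟨e i, hi⟩, hc⟩, h⟩)
  refine ⟨Ψ, fun a => ?_, fun {k k'} hk α y c h hy => ?_⟩
  · induction a using latching_ind with
    | hb =>
      rw [latching_map_pt, h1, ap_pt]
      exact eq_comm
    | hr hk α x' c =>
      rw [latching_map_latchRep, h2, latchingMap_latchRep]
      refine ⟨fun h => Or.inl ⟨x', rfl, h⟩, ?_⟩
      rintro (⟨x'', h, rfl⟩ | ⟨⟨j, hj, hc⟩, rfl⟩)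
      · have := Fintype.card_le_of_embedding α
        simp only [Fintype.card_sum, Fintype.card_fin] at this
        rw [(hf _ (by lia)).injective h]
      · exact put_eq_pt _ _ _ hj hc
  · rw [h2] at h
    rcases h with ⟨x', h, -⟩ | ⟨h, -⟩
    · exact absurd h (hy x')
    · exact h

/-- Having a common source with a given simplex is well defined on the source of `ν_n(f)`. -/
theorem exists_commonSource_lift (hf : ∀ m < n, IsFreeAt f m p) (a : Fin m ↪ Fin n) (y : Y.el m p)
    (c : Fin n → circle.{u}.obj p) :
    ∃ Ψ : ((latching n).obj Y).V.obj p → ULift.{u} Prop,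
      (∀ x : ((latching n).obj X).V.obj p, ¬ (Ψ (ap ((latching n).map f).hom x)).down) ∧
      ∀ {k k' : ℕ} (hk : k' ≠ 0) (α : Fin k ⊕ Fin k' ↪ Fin n) (z : Y.el k p)
        (d : Fin n → circle.{u}.obj p), (Ψ (Quot.mk _ (latchRep hk α z d))).down ↔
          IsNew f z ∧ (∀ j, j ∉ Set.range (inlEmb α) → d j ≠ pt circle p) ∧
            HaveCommonSource a y c (inlEmb α) z d := by
  obtain ⟨Ψ, h1, h2⟩ := exists_latching_lift_of_lt (E := Y) (n := n) (p := p)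
    (fun b z d => ULift.up (IsNew f z ∧ (∀ j, j ∉ Set.range b → d j ≠ pt circle p) ∧
      HaveCommonSource a y c b z d)) (ULift.up False)
    (fun b z d d' _ h => by
      refine congrArg ULift.up (propext ⟨?_, ?_⟩)
      · exact fun ⟨h1, h2, h3⟩ => ⟨h1, fun j hj => h j hj ▸ h2 j hj, h3.congr_right h⟩
      · exact fun ⟨h1, h2, h3⟩ => ⟨h1, fun j hj => (h j hj).symm ▸ h2 j hj,
          h3.congr_right fun j hj => (h j hj).symm⟩)
    (fun b d _ => congrArg ULift.up (eq_false fun h => h.1.ne_pt rfl))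
    (fun b z d j _ hj hd => congrArg ULift.up (eq_false fun h => h.2.1 j hj hd))
    (fun {k l} e b z d hl => by
      refine congrArg ULift.up (propext ⟨?_, ?_⟩)
      · rintro ⟨h1, h2, h3⟩
        refine ⟨(hf l hl).isNew_put e h1 fun i hi => h2 _ ?_, fun j hj => h2 j ?_, h3.put_right⟩
        · exact fun ⟨i', hi'⟩ => hi ⟨i', b.injective hi'⟩
        · exact fun ⟨i, hi⟩ => hj ⟨e i, hi⟩
      · rintro ⟨h1, h2, h3⟩
        refine ⟨h1.of_put, fun j hj => ?_, h3.of_put_right (hf l hl) h1⟩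
        by_cases hjb : j ∈ Set.range b
        · obtain ⟨i, rfl⟩ := hjb
          exact h1.ne_pt_of_put i fun ⟨i', hi'⟩ => hj ⟨i', congrArg b hi'⟩
        · exact h2 j hjb)
  refine ⟨Ψ, fun x => ?_, fun hk α z d => by rw [h2]⟩
  induction x using latching_ind with
  | hb =>
    rw [latching_map_pt, h1]
    exact id
  | hr hk α x' d =>
    rw [latching_map_latchRep, h2]
    exact fun h => h.1 x' rfl

/-- The induction step: if `ν_n(f)` is injective and the complement of the image of `f` is freely
generated below level `n`, then it is freely generated in level `n`. -/
theorem LatchingInjective.isFreeAt (h : LatchingInjective f n p)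
    (hf : ∀ m < n, IsFreeAt f m p) : IsFreeAt f n p := by
  have hle : ∀ {k : ℕ}, (Fin k ↪ Fin n) → k = n ∨ k < n := fun a =>
    (by simpa using Fintype.card_le_of_embedding a : _ ≤ n).eq_or_lt
  refine ⟨fun x x' hx => ?_, fun {k} a y c hy hc x hx => ?_,
    fun {k l} a y c b z d hy hz hyz hnew => ?_⟩
  · obtain ⟨Ψ, hΨ, -⟩ := exists_represents hf x'
    exact (h.iff_of_eq (· = x') Ψ hΨ (q := Sum.inl x) (q' := Sum.inl x') hx).2 rfl
  · rcases hle a with rfl | hk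
    · obtain ⟨e, rfl⟩ := exists_equiv_of_embedding a
      refine hy (X.put e.symm.toEmbedding x c) ?_
      rw [ev_put, hx, put_symm_put]
    · obtain ⟨k', hk', α, rfl⟩ := exists_inlEmb_eq a hk
      obtain ⟨Ψ, hΨ, hΨ'⟩ := exists_represents hf x
      have h1 := (h.iff_of_eq (· = x) Ψ hΨ (q := Sum.inl x)
        (q' := Sum.inr (Quot.mk _ (latchRep hk' α y c)))
        (hx.trans (latchingMap_latchRep hk' α y c).symm)).1 rfl
      obtain ⟨j, hj, hj'⟩ := hΨ' hk' α y c h1 hy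
      exact hc j hj hj'
  · rcases hle a with rfl | hk
    · obtain ⟨e, rfl⟩ := exists_equiv_of_embedding a
      exact HaveCommonSource.of_surjective e hyz
    · rcases hle b with rfl | hl
      · obtain ⟨e, rfl⟩ := exists_equiv_of_embedding b
        exact (HaveCommonSource.of_surjective e hyz.symm).symm
      · obtain ⟨k', hk', α, rfl⟩ := exists_inlEmb_eq a hk
        obtain ⟨l', hl', β, rfl⟩ := exists_inlEmb_eq b hl
        obtain ⟨Ψ, hΨ, hΨ'⟩ := exists_commonSource_lift hf (inlEmb α) y c
        have h1 := h.iff_of_eq (fun _ => False) Ψ (fun x => (iff_false_intro (hΨ x)).symm)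
          (q := Sum.inr (Quot.mk _ (latchRep hk' α y c)))
          (q' := Sum.inr (Quot.mk _ (latchRep hl' β z d)))
          ((latchingMap_latchRep hk' α y c).trans
            (hyz.trans (latchingMap_latchRep hl' β z d).symm))
        have h2 := h1.1 ((hΨ' hk' α y c).2 ⟨hy, hnew.ne_pt_of_put, HaveCommonSource.refl _ _ _⟩)
        exact ((hΨ' hl' β z d).1 h2).2.2

/-- The main criterion: flat cofibrations are the maps whose complement is freely generated. -/
theorem isFlatCofibration_iff_isFree (f : X ⟶ Y) : IsFlatCofibration f ↔ IsFree f := by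
  rw [isFlatCofibration_iff_latchingInjective]
  refine ⟨fun h n p => ?_, fun h n p => (h n p).latchingInjective⟩
  induction n using Nat.strong_induction_on with
  | _ n ih => exact (h n p).isFreeAt ih

end SymSp

namespace SymSp

open SymSpectrum

variable {X Y E : SymSpectrum.{u}} {f : X ⟶ Y} {p : SimplexCategoryᵒᵖ} {k l m n : ℕ}

/-! ### Generalized structure maps and coloured injections -/

/-- The injection `k → n` underlying a bijection `k ⊔ M ≅ n`. -/
abbrev blockEmb {M : Type} (τ : Fin k ⊕ M ≃ Fin n) : Fin k ↪ Fin n :=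
  Function.Embedding.inl.trans τ.toEmbedding

/-- The extension of a tuple indexed by `M` along a bijection `k ⊔ M ≅ n`, by the base point. -/
def spread {M : Type} (τ : Fin k ⊕ M ≃ Fin n) (t : M → circle.{u}.obj p) (j : Fin n) :
    circle.{u}.obj p :=
  Sum.elim (fun _ => pt circle p) t (τ.symm j)

theorem spread_inr {M : Type} (τ : Fin k ⊕ M ≃ Fin n) (t : M → circle.{u}.obj p) (i : M) :
    spread τ t (τ (Sum.inr i)) = t i := by
  simp [spread]

theorem notMem_range_blockEmb_iff {M : Type} (τ : Fin k ⊕ M ≃ Fin n) (j : Fin n) :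
    j ∉ Set.range (blockEmb τ) ↔ ∃ i, τ (Sum.inr i) = j := by
  obtain ⟨i | i, rfl⟩ := τ.surjective j
  · refine ⟨fun h => absurd ⟨i, rfl⟩ h, ?_⟩
    rintro ⟨i', h⟩
    cases τ.injective h
  · refine ⟨fun _ => ⟨i, rfl⟩, ?_⟩
    rintro - ⟨i', h⟩
    cases τ.injective h

theorem gen_smk_sph {M : Type} [Finite M] (τ : Fin k ⊕ M ≃ Fin n) (x : E.el k p)
    (t : M → circle.{u}.obj p) :
    ap (E.gen τ) (smk x (sph t)) = E.put (blockEmb τ) x (spread τ t) :=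
  (gen_smk τ x t).trans (genEl_eq_put τ x t _ (spread_inr τ t))

theorem put_blockEmb {M : Type} [Finite M] (τ : Fin k ⊕ M ≃ Fin n) (x : E.el k p)
    (c : Fin n → circle.{u}.obj p) :
    E.put (blockEmb τ) x c = ap (E.gen τ) (smk x (sph fun i => c (τ (Sum.inr i)))) :=
  ((gen_smk τ x _).trans (genEl_eq_put τ x _ c fun _ => rfl)).symm

theorem exists_equiv_extending (a : Fin k ↪ Fin n) :
    ∃ (l : ℕ) (e : Fin (k + l) ≃ Fin n), (blockEmb finSumFinEquiv).trans e.toEmbedding = a := by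
  refine ⟨_, finSumFinEquiv.symm.trans ((Equiv.sumCongr (Equiv.refl _)
    (Finite.equivFin {j : Fin n // j ∉ Set.range a}).symm).trans (split a)), ?_⟩
  ext i
  refine congrArg Fin.val ?_
  change (split a) (Sum.map id _ (finSumFinEquiv.symm (finSumFinEquiv (Sum.inl i)))) = _
  rw [Equiv.symm_apply_apply]
  rfl

/-- Up to a permutation, the image of `x ∧ c` for an injection is that for a standard one. -/
theorem put_symm_put_trans (a : Fin k ↪ Fin m) (e : Fin m ≃ Fin n) (x : E.el k p)
    (c : Fin n → circle.{u}.obj p) (d) :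
    E.put e.symm.toEmbedding (E.put (a.trans e.toEmbedding) x c) d =
      E.put a x (fun i => c (e i)) := by
  rw [← put_put]
  exact put_symm_put e _ _ _

theorem IsNew.put_equiv {y : Y.el m p} (h : IsNew f y) (e : Fin m ≃ Fin n)
    (c : Fin n → circle.{u}.obj p) : IsNew f (Y.put e.toEmbedding y c) := by
  refine IsNew.of_put (a := e.symm.toEmbedding) (c := fun i => c (e i)) ?_
  rwa [put_symm_put]

/-! ### Subspectra of flat spectra -/

theorem isNew_fromPoint_iff (y : Y.el n p) : IsNew (fromPoint Y) y ↔ y ≠ pt _ p :=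
  ⟨fun h => h.ne_pt, fun h _ h' => h h'.symm⟩

theorem isNew_ι_iff (A : SubSpectrum Y) (y : Y.el n p) : IsNew A.ι y ↔ y ∉ A.carrier n p :=
  ⟨fun h hy => h ⟨y, hy⟩ rfl, fun h x hx => h (hx ▸ x.2)⟩

/-- The inclusion of a subspectrum of a flat spectrum has freely generated complement as soon as the
complement is closed under the structure maps: common sources exist in the ambient spectrum. -/
theorem isFree_ι_iff (hY : IsFree (fromPoint Y)) (A : SubSpectrum Y) : IsFree A.ι ↔
    ∀ {k n : ℕ} {p : SimplexCategoryᵒᵖ} (a : Fin k ↪ Fin n) (y : Y.el k p)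
      (c : Fin n → circle.{u}.obj p), y ∉ A.carrier k p →
        (∀ j, j ∉ Set.range a → c j ≠ pt circle p) → Y.put a y c ∉ A.carrier n p := by
  constructor
  · intro h k n p a y c hy hc
    rw [← isNew_ι_iff] at hy ⊢
    exact (h n p).isNew_put a hy hc
  · intro h n p
    refine ⟨fun x x' hx => Subtype.ext hx, fun a y c hy hc => ?_, fun a y c b z d hy hz hyz hnew =>
      (hY n p).haveCommonSource a b ?_ ?_ hyz ?_⟩
    · rw [isNew_ι_iff] at hy ⊢
      exact h a y c hy hc
    · exact (isNew_fromPoint_iff _).2 hy.ne_pt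
    · exact (isNew_fromPoint_iff _).2 hz.ne_pt
    · exact (isNew_fromPoint_iff _).2 hnew.ne_pt

/-- The intersection condition says that the complement is closed under the structure maps. -/
theorem isFree_ι_iff_inter (hY : IsFree (fromPoint Y)) (A : SubSpectrum Y) :
    IsFree A.ι ↔ ∀ (k l : ℕ) (p : SimplexCategoryᵒᵖ),
        Set.range (ap (p := p) (SymSpectrum.Hom.f A.ι (k + l)).hom) ∩
            Set.range (ap (p := p) (Y.gen (finSumFinEquiv : Fin k ⊕ Fin l ≃ Fin (k + l)))) =
          Set.range (ap (p := p) (smashMap (SymSpectrum.Hom.f A.ι k).hom (𝟙 (sphere (Fin l))) ≫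
            Y.gen (finSumFinEquiv : Fin k ⊕ Fin l ≃ Fin (k + l)))) := by
  rw [isFree_ι_iff hY]
  constructor
  · intro h k l p
    apply Set.Subset.antisymm
    · rintro z ⟨⟨x, rfl⟩, ⟨w, hw⟩⟩
      induction w using smash_ind with
      | h y s =>
        induction s using sph_ind with
        | hb =>
          refine ⟨pt _ p, ?_⟩
          rw [← hw, ap_pt, smk_pt_right, ap_pt]
        | hm t =>
          by_cases hy : y ∈ A.carrier k p
          · exact ⟨smk (A := (A.toSpectrum.lvl k).V) ⟨y, hy⟩ (sph t), hw⟩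
          · rw [gen_smk_sph] at hw
            by_cases ht : ∃ i, t i = pt circle p
            · obtain ⟨i, hi⟩ := ht
              refine ⟨pt _ p, ?_⟩
              rw [← hw, ap_pt, put_eq_pt _ _ _ ((notMem_range_blockEmb_iff _ _).2 ⟨i, rfl⟩)
                ((spread_inr _ _ _).trans hi)]
            · push Not at ht
              refine absurd ?_ (h (blockEmb finSumFinEquiv) y (spread finSumFinEquiv t) hy
                fun j hj => ?_)
              · rw [hw]
                exact x.2
              · obtain ⟨i, rfl⟩ := (notMem_range_blockEmb_iff _ _).1 hj
                rw [spread_inr]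
                exact ht i
    · rintro z ⟨w, rfl⟩
      refine ⟨?_, ⟨_, rfl⟩⟩
      rw [← gen_nat A.ι]
      exact ⟨_, rfl⟩
  · intro h k n p a y c hy hc hmem
    obtain ⟨l, e, rfl⟩ := exists_equiv_extending a
    have hy₀ : IsNew (fromPoint Y) y := by
      rw [isNew_fromPoint_iff]
      rintro rfl
      exact hy (A.pt_mem _ _)
    have hnew := (hY n p).isNew_put _ hy₀ hc
    -- the image of `y ∧ c` for the standard block injection
    let z := Y.put (blockEmb (finSumFinEquiv : Fin k ⊕ Fin l ≃ Fin (k + l))) y (fun i => c (e i))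
    have hz : Y.put e.symm.toEmbedding (Y.put _ y c) (fun i => c (e i)) = z :=
      put_symm_put_trans _ e y c _
    have hznew : IsNew (fromPoint Y) z := hz ▸ hnew.put_equiv e.symm _
    have h1 : z ∈ Set.range (ap (p := p) (SymSpectrum.Hom.f A.ι (k + l)).hom) := by
      refine ⟨A.toSpectrum.put e.symm.toEmbedding ⟨_, hmem⟩ (fun i => c (e i)), ?_⟩
      exact (ev_put A.ι _ _ _).trans hz
    have h2 : z ∈ Set.range (ap (p := p) (Y.gen (finSumFinEquiv : Fin k ⊕ Fin l ≃ Fin (k + l)))) :=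
      ⟨_, (put_blockEmb _ _ _).symm⟩
    obtain ⟨w, hw⟩ := (h k l p).subset ⟨h1, h2⟩
    induction w using smash_ind with
    | h x s =>
      induction s using sph_ind with
      | hb =>
        refine hznew.ne_pt (hw.symm.trans ?_)
        rw [smk_pt_right, ap_pt]
      | hm t =>
        have h3 : z = Y.put (blockEmb finSumFinEquiv) x.1 (spread finSumFinEquiv t) :=
          hw.symm.trans (gen_smk_sph (E := Y) finSumFinEquiv x.1 t)
        have h4 := (hY _ p).haveCommonSource _ _ hznew.of_put (IsNew.of_put (h3 ▸ hznew)) h3 hznew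
        exact hy (h4.eq ▸ x.2)

/-! ### Powers -/

/-- The projection of a power to a factor. -/
def powerProj (E : SymSpectrum.{u}) (S : Type) (s : S) : power E S ⟶ E where
  f n :=
    { hom := mkHom (fun _ x => x s) (fun _ => rfl) (fun _ _ => rfl)
      comm := fun _ => rfl }
  comm n := hom_ext fun _ x => by
    induction x using smash_ind with
    | h a c => rfl

theorem power_put (S : Type) (a : Fin k ↪ Fin n) (x : (power E S).el k p)
    (c : Fin n → circle.{u}.obj p) (s : S) : (power E S).put a x c s = E.put a (x s) c :=
  ev_put (powerProj E S s) a x c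

/-- The pullback of two injections, as a standard finite set. -/
theorem exists_pullback (a : Fin k ↪ Fin n) (b : Fin l ↪ Fin n) :
    ∃ (m : ℕ) (s : Fin m ↪ Fin k) (t : Fin m ↪ Fin l), (∀ i, a (s i) = b (t i)) ∧
      ∀ i j, a i = b j → ∃ q, s q = i := by
  let M := {i : Fin k // a i ∈ Set.range b}
  let e := Finite.equivFin M
  refine ⟨_, e.symm.toEmbedding.trans (Function.Embedding.subtype _),
    ⟨fun i => (e.symm i).2.choose, fun i j hij => ?_⟩, fun i => (e.symm i).2.choose_spec.symm,
    fun i j hij => ⟨e ⟨i, j, hij.symm⟩, ?_⟩⟩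
  · have h := congrArg b hij
    dsimp only at h
    rw [(e.symm i).2.choose_spec, (e.symm j).2.choose_spec] at h
    exact e.symm.injective (Subtype.ext (a.injective h))
  · exact congrArg Subtype.val (e.symm_apply_apply _)

/-- Powers of flat spectra are flat: the common sources of the entries of two tuples are taken over
one pullback, where they form a tuple. -/
theorem isFree_power (hE : IsFree (fromPoint E)) (S : Type) : IsFree (fromPoint (power E S)) := by
  classical
  intro n p
  have hput : ∀ {k : ℕ} (a : Fin k ↪ Fin n) {y : E.el k p} {c : Fin n → circle.{u}.obj p},
      (∀ j, j ∉ Set.range a → c j ≠ pt circle p) → E.put a y c = pt _ p → y = pt _ p := by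
    intro k a y c hc h
    by_contra hy
    exact ((hE n p).isNew_put a ((isNew_fromPoint_iff y).2 hy) hc).ne_pt h
  refine ⟨fun _ _ _ => rfl, fun a y c hy hc => ?_, fun {k l} a y c b z d hy hz hyz hnew => ?_⟩
  · rw [isNew_fromPoint_iff] at hy ⊢
    refine fun h => hy (funext fun s => hput a hc ?_)
    rw [← power_put]
    exact congrFun h s
  · have hc := hnew.ne_pt_of_put
    have hd := (hyz ▸ hnew : IsNew _ ((power E S).put b z d)).ne_pt_of_put
    have hyz' : ∀ s, E.put a (y s) c = E.put b (z s) d := fun s =>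
      (power_put S a y c s).symm.trans ((congrFun hyz s).trans (power_put S b z d s))
    have hsrc : ∀ s, y s ≠ pt _ p → HaveCommonSource a (y s) c b (z s) d := by
      intro s hs
      have h1 : E.put a (y s) c ≠ pt _ p := fun h => hs (hput a hc h)
      refine (hE n p).haveCommonSource a b ((isNew_fromPoint_iff _).2 hs)
        ((isNew_fromPoint_iff _).2 fun h => h1 ?_) (hyz' s) ((isNew_fromPoint_iff _).2 h1)
      rw [hyz' s, h, put_pt]
    obtain ⟨s₀, hs₀⟩ : ∃ s, y s ≠ pt _ p := by
      by_contra! h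
      exact hy.ne_pt (funext h)
    obtain ⟨m, s, t, hst, hpb⟩ := exists_pullback a b
    -- a colouring which agrees with `c` off the image of `a` and with `d` off the image of `b`
    let r : Fin n → circle.{u}.obj p := fun j => if j ∈ Set.range a then d j else c j
    have hr₁ : ∀ j, j ∉ Set.range a → r j = c j := fun j hj => if_neg hj
    have hr₂ : ∀ j, j ∉ Set.range b → r j = d j := by
      intro j hj
      by_cases hja : j ∈ Set.range a
      · exact if_pos hja
      · rw [hr₁ j hja]
        exact (hsrc s₀ hs₀).color_eq j hja hj
    have hw : ∀ i, ∃ w : E.el m p, E.put s w (fun j => r (a j)) = y i ∧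
        E.put t w (fun j => r (b j)) = z i := by
      intro i
      by_cases hi : y i = pt _ p
      · refine ⟨pt _ p, ?_, ?_⟩
        · rw [put_pt, hi]
        · rw [put_pt]
          refine (hput b hd ?_).symm
          rw [← hyz' i, hi, put_pt]
      · exact (hsrc i hi).exists_of_pullback s t hst hpb r hr₁ hr₂
    choose w hw₁ hw₂ using hw
    exact ⟨m, s, t, w, r, hst, funext fun i => (power_put S s w _ i).trans (hw₁ i),
      funext fun i => (power_put S t w _ i).trans (hw₂ i), hr₁, hr₂⟩

/-- The structure maps are injective on new simplices, so they do not identify distinct entries of a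
tuple, nor send an entry to the base point. -/
theorem isFree_fatDiagonal_ι (hE : IsFree (fromPoint E)) (S : Type) :
    IsFree (fatDiagonal E S).ι := by
  rw [isFree_ι_iff (isFree_power hE S)]
  intro k n p a y c hy hc hmem
  have hpow := (isFree_power hE S n p).isNew_put a (c := c)
    ((isNew_fromPoint_iff y).2 fun h => hy (Or.inl h)) hc
  have hput : ∀ s, IsNew (fromPoint E) (E.put a (y s) c) := fun s =>
    (hE n p).isNew_put a ((isNew_fromPoint_iff _).2 fun h => hy (Or.inr (Or.inr ⟨s, h⟩))) hc
  rcases hmem with h | ⟨s, s', hs, h⟩ | ⟨s, h⟩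
  · exact hpow.ne_pt h
  · rw [power_put, power_put] at h
    exact hy (Or.inr (Or.inl ⟨s, s', hs,
      ((hE n p).haveCommonSource a a (hput s).of_put (hput s').of_put h (hput s)).eq⟩))
  · rw [power_put] at h
    exact (hput s).ne_pt h

/-! ### The sphere spectrum -/

theorem sph_eq_pt_iff {M : Type} {t : M → circle.{u}.obj p} :
    sph t = pt (sphere M) p ↔ ∃ i, t i = pt circle p :=
  Collapse.mk_eq_base_iff

theorem eq_of_sph_eq_sph {M : Type} {t t' : M → circle.{u}.obj p} (h : sph t = sph t')
    (ht : sph t ≠ pt (sphere M) p) : t = t' := by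
  rcases Quotient.exact h with h1 | h1
  · exact Option.some.inj h1
  · exact absurd (Collapse.mk_eq_base (h1.1 t rfl)) ht

theorem exists_eq_sph {M : Type} {x : (sphere.{u} M).obj p} (h : x ≠ pt (sphere M) p) :
    ∃ t, x = sph t := by
  induction x using sph_ind with
  | hb => exact absurd rfl h
  | hm t => exact ⟨t, rfl⟩

/-- In the sphere spectrum, the structure maps merge colourings. -/
theorem sphereSpectrum_put (a : Fin k ↪ Fin n) (t : Fin k → circle.{u}.obj p)
    (c : Fin n → circle.{u}.obj p) :
    ∃ r : Fin n → circle.{u}.obj p,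
      sphereSpectrum.{u}.put a (sph t : (sphere (Fin k)).obj p) c =
          (sph r : (sphere (Fin n)).obj p) ∧
        (∀ i, r (a i) = t i) ∧ ∀ j, j ∉ Set.range a → r j = c j := by
  refine ⟨_, sphereSpectrum_genEl (split a) t _, fun i => ?_, fun j hj => ?_⟩
  · rw [show (split a).symm (a i) = Sum.inl i from (split a).symm_apply_apply (Sum.inl i)]
    rfl
  · rw [show (split a).symm j = Sum.inr ⟨j, hj⟩ from
      (split a).symm_apply_apply (Sum.inr ⟨j, hj⟩)]
    rfl

/-- The sphere spectrum is flat: it is freely generated by a point of level `0`. -/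
theorem isFree_fromPoint_sphereSpectrum : IsFree (fromPoint sphereSpectrum.{u}) := by
  intro n p
  refine ⟨fun _ _ _ => rfl, fun {k} a y c hy hc => ?_, fun {k l} a y c b z d hy hz hyz hnew => ?_⟩
  · rw [isNew_fromPoint_iff] at hy ⊢
    obtain ⟨t, rfl⟩ := exists_eq_sph hy
    obtain ⟨r, h1, h2, h3⟩ := sphereSpectrum_put a t c
    rw [h1]
    intro h
    obtain ⟨j, hj⟩ := sph_eq_pt_iff.1 h
    by_cases hja : j ∈ Set.range a
    · obtain ⟨i, rfl⟩ := hja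
      exact hy (sph_eq_pt (i := i) ((h2 i).symm.trans hj))
    · exact hc j hja ((h3 j hja).symm.trans hj)
  · obtain ⟨t, rfl⟩ := exists_eq_sph hy.ne_pt
    obtain ⟨t', rfl⟩ := exists_eq_sph hz.ne_pt
    obtain ⟨r, h1, h2, h3⟩ := sphereSpectrum_put a t c
    obtain ⟨r', h1', h2', h3'⟩ := sphereSpectrum_put b t' d
    obtain rfl : r = r' := eq_of_sph_eq_sph (h1.symm.trans (hyz.trans h1'))
      (h1 ▸ hnew.ne_pt)
    -- the common source is the nonbasepoint simplex of level `0`, coloured by `r`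
    have key : ∀ {k : ℕ} (a : Fin k ↪ Fin n) (t : Fin k → circle.{u}.obj p),
        (∀ i, r (a i) = t i) → sphereSpectrum.{u}.put (Function.Embedding.ofIsEmpty : Fin 0 ↪ Fin k)
          (sph Fin.elim0 : (sphere (Fin 0)).obj p) (fun i => r (a i)) =
            (sph t : (sphere (Fin k)).obj p) := by
      intro k a t hr
      obtain ⟨q, hq1, -, hq3⟩ := sphereSpectrum_put
        (Function.Embedding.ofIsEmpty : Fin 0 ↪ Fin k) Fin.elim0 (fun i => r (a i))
      rw [hq1]
      refine congrArg sph (funext fun i => ?_)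
      rw [hq3 i (by simp), hr]
    exact ⟨0, Function.Embedding.ofIsEmpty, Function.Embedding.ofIsEmpty,
      (sph Fin.elim0 : (sphere (Fin 0)).obj p), r, fun i => i.elim0, key a t h2, key b t' h2',
      h3, h3'⟩

end SymSp

namespace SymSp

open SymSpectrum

variable {X Y : SymSpectrum.{u}} {f : X ⟶ Y} {p : SimplexCategoryᵒᵖ} {k l m n : ℕ}

/-! ### Pullbacks of based spaces -/

section pullback

variable {A B C P : BSSet.{u}} {i : P ⟶ A} {j : P ⟶ B} {g : A ⟶ C} {h : B ⟶ C}

/-- The explicit pullback of based spaces. -/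
def pullbackObj (g : A ⟶ C) (h : B ⟶ C) : BSSet.{u} :=
  mkBSSet (fun p => {x : A.obj p × B.obj p // ap g x.1 = ap h x.2})
    (fun p => ⟨(pt A p, pt B p), (ap_pt g).trans (ap_pt h).symm⟩)
    (fun φ x => ⟨(rst A φ x.1.1, rst B φ x.1.2), by rw [ap_rst, ap_rst, x.2]⟩)
    (fun φ => Subtype.ext (Prod.ext (rst_pt φ) (rst_pt φ)))
    (fun x => Subtype.ext (Prod.ext (rst_id _) (rst_id _)))
    (fun φ ψ x => Subtype.ext (Prod.ext (rst_comp φ ψ _) (rst_comp φ ψ _)))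

/-- Pullbacks of based spaces are computed on simplices. -/
theorem exists_of_isPullback (hP : IsPullback i j g h) {p : SimplexCategoryᵒᵖ} {a : A.obj p}
    {b : B.obj p} (hab : ap g a = ap h b) : ∃ x : P.obj p, ap i x = a ∧ ap j x = b := by
  let π₁ : pullbackObj g h ⟶ A := mkHom (fun _ x => x.1.1) (fun _ => rfl) (fun _ _ => rfl)
  let π₂ : pullbackObj g h ⟶ B := mkHom (fun _ x => x.1.2) (fun _ => rfl) (fun _ _ => rfl)
  have hπ : π₁ ≫ g = π₂ ≫ h := hom_ext fun _ x => x.2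
  refine ⟨ap (hP.lift π₁ π₂ hπ) ⟨(a, b), hab⟩, ?_, ?_⟩
  · exact congrArg (fun m : pullbackObj g h ⟶ A => ap m ⟨(a, b), hab⟩) (hP.lift_fst π₁ π₂ hπ)
  · exact congrArg (fun m : pullbackObj g h ⟶ B => ap m ⟨(a, b), hab⟩) (hP.lift_snd π₁ π₂ hπ)

theorem isPullback_of_exists (w : i ≫ g = j ≫ h)
    (hinj : ∀ p, Function.Injective (fun x : P.obj p => ap i x))
    (hex : ∀ {p : SimplexCategoryᵒᵖ} (a : A.obj p) (b : B.obj p), ap g a = ap h b →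
      ∃ x : P.obj p, ap i x = a ∧ ap j x = b) : IsPullback i j g h := by
  have hs : ∀ (s : PullbackCone g h) {p} (x : s.pt.obj p), ∃ z : P.obj p,
      ap i z = ap s.fst x ∧ ap j z = ap s.snd x := fun s p x =>
    hex _ _ (congrArg (fun m : s.pt ⟶ C => ap m x) s.condition)
  choose F hF₁ hF₂ using hs
  refine ⟨⟨w⟩, ⟨PullbackCone.IsLimit.mk _ (fun s => mkHom (fun _ x => F s x) (fun p => ?_)
    (fun {p q} φ x => ?_)) ?_ ?_ ?_⟩⟩
  · exact hinj p ((hF₁ s _).trans ((ap_pt _).trans (ap_pt _).symm))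
  · refine hinj q ((hF₁ s _).trans ?_)
    dsimp only
    rw [ap_rst, ap_rst, hF₁]
  · exact fun s => hom_ext fun _ x => hF₁ s x
  · exact fun s => hom_ext fun _ x => hF₂ s x
  · intro s m h1 h2
    refine hom_ext fun p x => hinj p (Eq.trans ?_ (hF₁ s x).symm)
    exact congrArg (fun m : s.pt ⟶ A => ap m x) h1

end pullback

/-! ### Simplices of the glued spaces -/

theorem eq_of_smk_sph_eq {A : BSSet.{u}} {M : Type} {y y' : A.obj p} {t t' : M → circle.{u}.obj p}
    (h : smk y (sph t) = smk y' (sph t')) (hy : y ≠ pt A p) (ht : ∀ i, t i ≠ pt circle p) :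
    y = y' ∧ t = t' := by
  have hs : sph t ≠ pt (sphere M) p := fun h => by
    obtain ⟨i, hi⟩ := sph_eq_pt_iff.1 h
    exact ht i hi
  rcases Quotient.exact h with h1 | h1
  · have h2 := Option.some.inj h1
    exact ⟨congrArg Prod.fst h2, eq_of_sph_eq_sph (congrArg Prod.snd h2) hs⟩
  · rcases h1.1 _ rfl with h2 | h2
    · exact absurd h2 hy
    · exact absurd h2 hs

theorem smashMap_injective {A A' B : BSSet.{u}} {g : A ⟶ A'}
    (hg : Function.Injective (fun x : A.obj p => ap g x)) :
    Function.Injective (fun x : (smash A B).obj p => ap (smashMap g (𝟙 B)) x) := by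
  intro v v' h
  induction v using smash_ind with
  | h x s =>
    induction v' using smash_ind with
    | h x' s' =>
      have hpt : ∀ (x : A.obj p) (s : B.obj p), ap g x = pt A' p ∨ s = pt B p →
          smk x s = pt (smash A B) p := by
        rintro x s (h | rfl)
        · obtain rfl : x = pt A p := hg (h.trans (ap_pt g).symm)
          exact smk_pt_left s
        · exact smk_pt_right x
      rcases Quotient.exact h with h1 | h1
      · have h2 := Option.some.inj h1
        obtain rfl : x = x' := hg (congrArg Prod.fst h2)
        obtain rfl : s = s' := congrArg Prod.snd h2
        rfl
      · rw [hpt x s (h1.1 _ rfl), hpt x' s' (h1.2 _ rfl)]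

/-- A new simplex smashed with a simplex of the sphere other than the base point is new. -/
theorem smashMap_ne_smk_sph {M : Type} {y : Y.el k p} {t : M → circle.{u}.obj p} (hy : IsNew f y)
    (ht : ∀ i, t i ≠ pt circle p) (v : (smash (X.lvl k).V (sphere M)).obj p) :
    ap (smashMap (SymSpectrum.Hom.f f k).hom (𝟙 (sphere M))) v ≠ smk y (sph t) := by
  have hpt : smk y (sph t) ≠ pt (smash (Y.lvl k).V (sphere M)) p := fun h => by
    rcases Collapse.mk_eq_base_iff.1 h with h | h
    · exact hy.ne_pt h
    · obtain ⟨i, hi⟩ := sph_eq_pt_iff.1 h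
      exact ht i hi
  intro h
  induction v using smash_ind with
  | h x s =>
    rw [smashMap_smk] at h
    rcases Quotient.exact h with h1 | h1
    · exact hy x (congrArg Prod.fst (Option.some.inj h1))
    · exact hpt (Collapse.mk_eq_base (h1.2 _ rfl))

section glue

variable {M : Type} [Finite M] (τ : Fin k ⊕ M ≃ Fin n)

/-- The simplices of `X(n) ∪_{X(k) ∧ S^M} Y(k) ∧ S^M` coming from `X(n)`. -/
noncomputable def glueInl (f : X ⟶ Y) (x : X.el n p) : (glue f τ).obj p :=
  ap (pushout.inl (X.gen τ) (smashMap (SymSpectrum.Hom.f f k).hom (𝟙 (sphere M)))) x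

/-- The simplices of `X(n) ∪_{X(k) ∧ S^M} Y(k) ∧ S^M` coming from `Y(k) ∧ S^M`. -/
noncomputable def glueInr (f : X ⟶ Y) (w : (smash (Y.lvl k).V (sphere M)).obj p) :
    (glue f τ).obj p :=
  ap (pushout.inr (X.gen τ) (smashMap (SymSpectrum.Hom.f f k).hom (𝟙 (sphere M)))) w

theorem glueTo_glueInl (x : X.el n p) : ap (glueTo f τ) (glueInl τ f x) = SymSpectrum.Hom.ev f x :=
  congrArg (fun m : (X.lvl n).V ⟶ (Y.lvl n).V => ap m x) (pushout.inl_desc _ _ _)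

theorem glueTo_glueInr (w : (smash (Y.lvl k).V (sphere M)).obj p) :
    ap (glueTo f τ) (glueInr τ f w) = ap (Y.gen τ) w :=
  congrArg (fun m : smash (Y.lvl k).V (sphere M) ⟶ (Y.lvl n).V => ap m w) (pushout.inr_desc _ _ _)

theorem glueInl_gen (v : (smash (X.lvl k).V (sphere M)).obj p) :
    glueInl τ f (ap (X.gen τ) v) =
      glueInr τ f (ap (smashMap (SymSpectrum.Hom.f f k).hom (𝟙 (sphere M))) v) :=
  congrArg (fun m : smash (X.lvl k).V (sphere M) ⟶ glue f τ => ap m v) pushout.condition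

/-- A simplex of the glued space comes from `X(n)`, or is the class of `y ∧ t` with `y` new and no
colour at the base point. -/
theorem glue_cases (q : (glue f τ).obj p) : (∃ x, q = glueInl τ f x) ∨
    ∃ (y : Y.el k p) (t : M → circle.{u}.obj p), q = glueInr τ f (smk y (sph t)) ∧ IsNew f y ∧
      ∀ j, j ∉ Set.range (blockEmb τ) → spread τ t j ≠ pt circle p := by
  have hpt : glueInr τ f (pt _ p) = glueInl τ f (pt _ p) := (ap_pt _).trans (ap_pt _).symm
  rcases exists_of_isPushout (IsPushout.of_hasPushout (X.gen τ)
    (smashMap (SymSpectrum.Hom.f f k).hom (𝟙 (sphere M)))) q with ⟨x, rfl⟩ | ⟨w, rfl⟩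
  · exact Or.inl ⟨x, rfl⟩
  · induction w using smash_ind with
    | h y s =>
      induction s using sph_ind with
      | hb => exact Or.inl ⟨pt _ p, (congrArg (glueInr τ f) (smk_pt_right y)).trans hpt⟩
      | hm t =>
        by_cases ht : ∀ j, j ∉ Set.range (blockEmb τ) → spread τ t j ≠ pt circle p
        · by_cases hy : IsNew f y
          · exact Or.inr ⟨y, t, rfl, hy, ht⟩
          · unfold IsNew at hy
            push Not at hy
            obtain ⟨x, rfl⟩ := hy
            exact Or.inl ⟨_, (glueInl_gen τ (smk x (sph t))).symm⟩
        · push Not at ht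
          obtain ⟨j, hj, hjt⟩ := ht
          obtain ⟨i, rfl⟩ := (notMem_range_blockEmb_iff τ j).1 hj
          rw [spread_inr] at hjt
          refine Or.inl ⟨pt _ p, Eq.trans (congrArg (glueInr τ f) ?_) hpt⟩
          rw [sph_eq_pt hjt, smk_pt_right]

theorem glueTo_injective (hf : IsFree f) :
    Function.Injective (fun x : (glue f τ).obj p => ap (glueTo f τ) x) := by
  intro q q' h
  dsimp only at h
  rcases glue_cases τ q with ⟨x, rfl⟩ | ⟨y, t, rfl, hy, ht⟩ <;>
  rcases glue_cases τ q' with ⟨x', rfl⟩ | ⟨y', t', rfl, hy', ht'⟩ <;>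
  simp only [glueTo_glueInl, glueTo_glueInr, gen_smk_sph] at h
  · rw [(hf n p).injective h]
  · exact absurd h ((hf n p).isNew_put _ hy' ht' x)
  · exact absurd h.symm ((hf n p).isNew_put _ hy ht x')
  · have h1 := (hf n p).haveCommonSource _ _ hy hy' h ((hf n p).isNew_put _ hy ht)
    obtain rfl := h1.eq
    have h2 : t = t' := funext fun i => by
      have hi := (notMem_range_blockEmb_iff τ _).2 ⟨i, rfl⟩
      rw [← spread_inr τ t, h1.color_eq _ hi hi, spread_inr]
    rw [h2]

theorem glueStep_glueTo {M₁ M₂ : Type} [Finite M₁] [Finite M₂] (f : X ⟶ Y)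
    (τ : Fin k ⊕ M₁ ≃ Fin l) (θ : Fin l ⊕ M₂ ≃ Fin n) (e : M ≃ M₁ ⊕ M₂) (ω : Fin k ⊕ M ≃ Fin n)
    (hω : ω = compBij τ θ e) : glueStep f τ θ e ω hω ≫ glueTo f θ = glueTo f ω := by
  subst hω
  unfold glueStep glueTo
  refine pushout.hom_ext ?_ ?_
  · rw [pushout.inl_desc]
    exact (pushout.inl_desc_assoc _ _ _ _).trans
      ((Category.assoc _ _ _).trans ((Category.id_comp _).trans (pushout.inl_desc _ _ _)))
  · rw [pushout.inr_desc]
    exact (pushout.inr_desc_assoc _ _ _ _).trans ((Category.assoc _ _ _).trans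
      ((congrArg _ (pushout.inr_desc _ _ _)).trans (partialStr_gen Y τ θ e)))

end glue

/-! ### The converse: free generation from the gluing conditions -/

section converse

/-- A function out of `X(n) ∪_{X(k) ∧ S^M} Y(k) ∧ S^M` to propositions, given by compatible
functions `Φ` and `Ψ`, only depends on the image in `Y(n)` if the glued space injects there. -/
theorem glue_iff_of_eq {M : Type} [Finite M] (τ : Fin k ⊕ M ≃ Fin n)
    (hinj : Function.Injective (fun x : (glue f τ).obj p => ap (glueTo f τ) x))
    (Φ : X.el n p → Prop) (Ψ : (smash (Y.lvl k).V (sphere M)).obj p → Prop)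
    (hΦΨ : ∀ v, Φ (ap (X.gen τ) v) ↔
      Ψ (ap (smashMap (SymSpectrum.Hom.f f k).hom (𝟙 (sphere M))) v))
    {q q' : X.el n p ⊕ (smash (Y.lvl k).V (sphere M)).obj p}
    (hq : Sum.elim (fun x => SymSpectrum.Hom.ev f x) (fun w => ap (Y.gen τ) w) q =
      Sum.elim (fun x => SymSpectrum.Hom.ev f x) (fun w => ap (Y.gen τ) w) q') :
    Sum.elim Φ Ψ q ↔ Sum.elim Φ Ψ q' := by
  have h := (injective_iff_of_isPushout (IsPushout.of_hasPushout (X.gen τ)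
    (smashMap (SymSpectrum.Hom.f f k).hom (𝟙 (sphere M)))) (glueTo f τ)
    (pushout.inl_desc _ _ _) (pushout.inr_desc _ _ _) p).1 hinj q q' hq
  have h1 := congrArg (Quot.lift (Sum.elim Φ Ψ) (by
    rintro _ _ ⟨a, rfl, rfl⟩
    exact propext (hΦΨ a))) h
  exact Iff.of_eq h1

variable (hinj : ∀ (k l : ℕ) (p : SimplexCategoryᵒᵖ), Function.Injective
    (fun x : (glue f (finSumFinEquiv : Fin k ⊕ Fin l ≃ Fin (k + l))).obj p =>
      ap (glueTo f finSumFinEquiv) x))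

include hinj

/-- Injectivity in level `0` propagates along `X(0) ∧ S^n → X(n)`, since the map from `X(n)` to the
glued space for `0 ⊔ n` is then injective. -/
theorem injective_of_glueTo_injective
    (h₀ : Function.Injective (fun x : X.el 0 p => SymSpectrum.Hom.ev f x)) (n : ℕ) :
    Function.Injective (fun x : X.el n p => SymSpectrum.Hom.ev f x) := by
  suffices h : Function.Injective (fun x : X.el (0 + n) p => SymSpectrum.Hom.ev f x) by
    rwa [Nat.zero_add] at h
  intro x x' hx
  -- the simplices of `Y(0) ∧ S^n` which represent `x'`
  refine (glue_iff_of_eq finSumFinEquiv (hinj 0 n p) (· = x') (fun w => ∃ v,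
    ap (smashMap (SymSpectrum.Hom.f f 0).hom (𝟙 (sphere (Fin n)))) v = w ∧
      ap (X.gen finSumFinEquiv) v = x') (fun v => ⟨fun h => ⟨v, rfl, h⟩, ?_⟩)
    (q := Sum.inl x) (q' := Sum.inl x') hx).2 rfl
  rintro ⟨v', h1, rfl⟩
  rw [smashMap_injective h₀ h1]

end converse

end SymSp

namespace SymSp

open SymSpectrum

variable {X Y : SymSpectrum.{u}} {f : X ⟶ Y} {p : SimplexCategoryᵒᵖ} {k l m n : ℕ}

/-! ### Free generation and the gluing conditions -/

/-- A common source of two simplices over `N` is a common source over `n`, for an injection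
`ω : N → n`. -/
theorem HaveCommonSource.trans {N : ℕ} {a : Fin k ↪ Fin N} {b : Fin l ↪ Fin N} (ω : Fin N ↪ Fin n)
    {y : Y.el k p} {z : Y.el l p} {c d : Fin n → circle.{u}.obj p}
    (h : HaveCommonSource a y (fun i => c (ω i)) b z (fun i => d (ω i)))
    (hcd : ∀ j, j ∉ Set.range ω → c j = d j) :
    HaveCommonSource (a.trans ω) y c (b.trans ω) z d := by
  obtain ⟨m, s, t, w, r, h1, h2, h3, h4, h5⟩ := h
  have hr : ∀ i, Function.extend ω r c (ω i) = r i := fun i => ω.injective.extend_apply r c i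
  refine ⟨m, s, t, w, Function.extend ω r c, fun i => congrArg ω (h1 i), ?_, ?_, fun j hj => ?_,
    fun j hj => ?_⟩
  · exact (congrArg (Y.put s w) (funext fun i => hr (a i))).trans h2
  · exact (congrArg (Y.put t w) (funext fun i => hr (b i))).trans h3
  · by_cases hj' : ∃ i, ω i = j
    · obtain ⟨i, rfl⟩ := hj'
      rw [hr]
      refine h4 i ?_
      rintro ⟨q, rfl⟩
      exact hj ⟨q, rfl⟩
    · exact Function.extend_apply' _ _ _ hj'
  · by_cases hj' : ∃ i, ω i = j
    · obtain ⟨i, rfl⟩ := hj'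
      rw [hr]
      refine h5 i ?_
      rintro ⟨q, rfl⟩
      exact hj ⟨q, rfl⟩
    · exact (Function.extend_apply' _ _ _ hj').trans (hcd j hj')

theorem lastBlocks_inl_inl (i : Fin l) : lastBlocks k l m (Sum.inl (finSumFinEquiv (Sum.inl i))) =
    finSumFinEquiv (Sum.inl (finSumFinEquiv (Sum.inr i))) :=
  (congrArg (fun e => e (Sum.inl i)) (midBlock_eq k l m)).symm

theorem lastBlocks_inl_inr (i : Fin m) : lastBlocks k l m (Sum.inl (finSumFinEquiv (Sum.inr i))) =
    finSumFinEquiv (Sum.inr i) :=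
  (congrArg (fun e => e (Sum.inr (Sum.inr i))) (midBlock_eq k l m)).symm

theorem blockEmb_trans_lastBlocks : (blockEmb finSumFinEquiv).trans (blockEmb (lastBlocks k l m)) =
    blockEmb (midBlock k l m) :=
  Function.Embedding.ext lastBlocks_inl_inl

theorem blockEmb_trans_finSumFinEquiv :
    (blockEmb ((Equiv.sumComm (Fin l) (Fin k)).trans finSumFinEquiv)).trans
      (blockEmb finSumFinEquiv) = blockEmb (midBlock k l m) :=
  rfl

section converse

variable (hinj : ∀ (k l : ℕ) (p : SimplexCategoryᵒᵖ), Function.Injective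
    (fun x : (glue f (finSumFinEquiv : Fin k ⊕ Fin l ≃ Fin (k + l))).obj p =>
      ap (glueTo f finSumFinEquiv) x))

include hinj

/-- The test function is membership in the image of `X(k) ∧ S^l`, extended by `True` on
`X(k + l)`. -/
theorem isNew_put_of_glueTo_injective (a : Fin k ↪ Fin n) {y : Y.el k p}
    {c : Fin n → circle.{u}.obj p} (hy : IsNew f y)
    (hc : ∀ j, j ∉ Set.range a → c j ≠ pt circle p) : IsNew f (Y.put a y c) := by
  obtain ⟨l, e, rfl⟩ := exists_equiv_extending a
  suffices h : IsNew f (Y.put (blockEmb finSumFinEquiv) y (fun i => c (e i))) by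
    refine IsNew.of_put (a := e.symm.toEmbedding) (c := fun i => c (e i)) ?_
    rwa [put_symm_put_trans]
  intro x hx
  obtain ⟨v, hv⟩ := (glue_iff_of_eq finSumFinEquiv (hinj k l p) (fun _ => True)
    (fun w => ∃ v, ap (smashMap (SymSpectrum.Hom.f f k).hom (𝟙 (sphere (Fin l)))) v = w)
    (fun v => ⟨fun _ => ⟨v, rfl⟩, fun _ => trivial⟩) (q := Sum.inl x) (q' := Sum.inr _)
    (hx.trans (put_blockEmb _ _ _))).1 trivial
  refine smashMap_ne_smk_sph hy (fun i => hc _ ?_) v hv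
  rintro ⟨i', hi'⟩
  have h : e (finSumFinEquiv (Sum.inl i')) = e (finSumFinEquiv (Sum.inr i)) := hi'
  cases finSumFinEquiv.injective (e.injective h)

/-- The test function is equality with one of the two simplices of `Y(k) ∧ S^l`, extended by `False`
on `X(k + l)`. -/
theorem eq_of_put_eq_of_glueTo_injective (a : Fin k ↪ Fin n) {y z : Y.el k p}
    {c d : Fin n → circle.{u}.obj p} (h : Y.put a y c = Y.put a z d)
    (hnew : IsNew f (Y.put a y c)) :
    y = z ∧ ∀ j, j ∉ Set.range a → c j = d j := by
  have hc := hnew.ne_pt_of_put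
  have hd := (h ▸ hnew : IsNew f (Y.put a z d)).ne_pt_of_put
  have hy := hnew.of_put
  have hz := (h ▸ hnew : IsNew f (Y.put a z d)).of_put
  obtain ⟨l, e, rfl⟩ := exists_equiv_extending a
  have h1 := congrArg (fun x => Y.put e.symm.toEmbedding x (fun i => c (e i))) h
  simp only [put_symm_put_trans] at h1
  rw [put_blockEmb, put_blockEmb] at h1
  have hi : ∀ i : Fin l, e (finSumFinEquiv (Sum.inr i)) ∉
      Set.range ((blockEmb (finSumFinEquiv : Fin k ⊕ Fin l ≃ _)).trans e.toEmbedding) := by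
    rintro i ⟨i', hi'⟩
    have h : e (finSumFinEquiv (Sum.inl i')) = e (finSumFinEquiv (Sum.inr i)) := hi'
    cases finSumFinEquiv.injective (e.injective h)
  have h2 : smk y (sph fun i => c (e (finSumFinEquiv (Sum.inr i)))) =
      smk z (sph fun i => d (e (finSumFinEquiv (Sum.inr i)))) := by
    refine ((glue_iff_of_eq finSumFinEquiv (hinj k l p) (fun _ => False)
      (fun w => smk y (sph fun i => c (e (finSumFinEquiv (Sum.inr i)))) = w)
      (fun v => ⟨False.elim, fun h => ?_⟩) (q := Sum.inr _) (q' := Sum.inr _) h1).1 rfl)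
    exact smashMap_ne_smk_sph hy (fun i => hc _ (hi i)) v h.symm
  obtain ⟨rfl, h3⟩ := eq_of_smk_sph_eq h2 hy.ne_pt (fun i => hc _ (hi i))
  refine ⟨rfl, fun j hj => ?_⟩
  obtain ⟨j, rfl⟩ := e.surjective j
  obtain ⟨i, rfl⟩ := (notMem_range_blockEmb_iff finSumFinEquiv j).1 (by
    rintro ⟨i, rfl⟩
    exact hj ⟨i, rfl⟩)
  exact congrFun h3 i

/-- The pullback condition yields common sources for the two standard injections of blocks. -/
theorem haveCommonSource_of_isPullback (hpb : IsPullback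
    (glueStep f finSumFinEquiv (lastBlocks k l m) (Equiv.sumComm (Fin k) (Fin m))
      (midBlock k l m) (midBlock_eq k l m))
    (glueStep f ((Equiv.sumComm (Fin l) (Fin k)).trans finSumFinEquiv) finSumFinEquiv
      (Equiv.refl (Fin k ⊕ Fin m)) (midBlock k l m) rfl)
    (glueTo f (lastBlocks k l m))
    (glueTo f (finSumFinEquiv : Fin (k + l) ⊕ Fin m ≃ Fin (k + l + m))))
    {y : Y.el (l + m) p} {z : Y.el (k + l) p} {c d : Fin (k + l + m) → circle.{u}.obj p}
    (h : Y.put (blockEmb (lastBlocks k l m)) y c = Y.put (blockEmb finSumFinEquiv) z d)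
    (hnew : IsNew f (Y.put (blockEmb (lastBlocks k l m)) y c)) :
    HaveCommonSource (blockEmb (lastBlocks k l m)) y c (blockEmb finSumFinEquiv) z d := by
  have h1 := h
  rw [put_blockEmb, put_blockEmb, ← glueTo_glueInr (f := f), ← glueTo_glueInr (f := f)] at h1
  obtain ⟨q, hq, -⟩ := exists_of_isPullback hpb h1
  have hq' : ap (glueTo f (midBlock k l m)) q = Y.put (blockEmb (lastBlocks k l m)) y c := by
    rw [← glueStep_glueTo f finSumFinEquiv (lastBlocks k l m) (Equiv.sumComm (Fin k) (Fin m))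
      (midBlock k l m) (midBlock_eq k l m), ap_comp, hq, glueTo_glueInr, put_blockEmb]
  rcases glue_cases _ q with ⟨x, rfl⟩ | ⟨w, t, rfl, -, -⟩
  · rw [glueTo_glueInl] at hq'
    exact absurd hq' (hnew x)
  · rw [glueTo_glueInr, gen_smk_sph] at hq'
    have h₁ := hq'
    have h₂ := hq'.trans h
    rw [← blockEmb_trans_lastBlocks, ← put_put] at h₁
    rw [← blockEmb_trans_finSumFinEquiv, ← put_put] at h₂
    obtain ⟨e₁, e₂⟩ := eq_of_put_eq_of_glueTo_injective hinj _ h₁ (h₁ ▸ hnew)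
    obtain ⟨e₃, e₄⟩ := eq_of_put_eq_of_glueTo_injective hinj _ h₂ (h₂ ▸ h ▸ hnew)
    exact ⟨l, _, _, w, _, fun i => lastBlocks_inl_inl i, e₁, e₃, e₂, e₄⟩

end converse

/-- Two injections into `n` are, up to bijections of their sources, restrictions of one injection
`ω : k₀ ⊔ l₀ ⊔ m₀ → n` to `l₀ ⊔ m₀` and to `k₀ ⊔ l₀`. -/
theorem exists_three_blocks (a : Fin k ↪ Fin n) (b : Fin l ↪ Fin n) :
    ∃ (k₀ l₀ m₀ : ℕ) (e : Fin (l₀ + m₀) ≃ Fin k) (e' : Fin (k₀ + l₀) ≃ Fin l)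
      (ω : Fin (k₀ + l₀ + m₀) ↪ Fin n),
      (blockEmb (lastBlocks k₀ l₀ m₀)).trans ω = e.toEmbedding.trans a ∧
        (blockEmb finSumFinEquiv).trans ω = e'.toEmbedding.trans b := by
  obtain ⟨l₀, s, t, hst, hpb⟩ := exists_pullback a b
  obtain ⟨m₀, e, rfl⟩ := exists_equiv_extending s
  obtain ⟨k₀, e₁, rfl⟩ := exists_equiv_extending t
  let e' : Fin (k₀ + l₀) ≃ Fin l :=
    finSumFinEquiv.symm.trans ((Equiv.sumComm _ _).trans (finSumFinEquiv.trans e₁))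
  have he' : ∀ i, e' (finSumFinEquiv (Sum.inr i)) = e₁ (finSumFinEquiv (Sum.inl i)) := fun i => by
    simp [e']
  let g : Fin (k₀ + l₀) ⊕ Fin m₀ → Fin n :=
    Sum.elim (fun i => b (e' i)) (fun i => a (e (finSumFinEquiv (Sum.inr i))))
  have hne : ∀ i j, a (e (finSumFinEquiv (Sum.inr i))) ≠ b j := fun i j h => by
    obtain ⟨q, hq⟩ := hpb _ _ h
    have h' : e (finSumFinEquiv (Sum.inl q)) = e (finSumFinEquiv (Sum.inr i)) := hq
    cases finSumFinEquiv.injective (e.injective h')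
  have hg : Function.Injective g := by
    rintro (i | i) (j | j) h
    · exact congrArg Sum.inl (e'.injective (b.injective h))
    · exact absurd h.symm (hne _ _)
    · exact absurd h (hne _ _)
    · exact congrArg Sum.inr
        (Sum.inr.inj (finSumFinEquiv.injective (e.injective (a.injective h))))
  have hω : ∀ i, g (finSumFinEquiv.symm (finSumFinEquiv i)) = g i := fun i => by
    rw [Equiv.symm_apply_apply]
  refine ⟨k₀, l₀, m₀, e, e', finSumFinEquiv.symm.toEmbedding.trans ⟨g, hg⟩, ?_, ?_⟩
  · refine Function.Embedding.ext fun i => ?_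
    obtain ⟨i | i, rfl⟩ := finSumFinEquiv.surjective i
    · refine Eq.trans ?_ (hst i).symm
      refine (congrArg (fun j => g (finSumFinEquiv.symm j)) (lastBlocks_inl_inl i)).trans ?_
      exact (hω _).trans (congrArg b (he' i))
    · refine (congrArg (fun j => g (finSumFinEquiv.symm j)) (lastBlocks_inl_inr i)).trans ?_
      exact hω _
  · exact Function.Embedding.ext fun i => hω (Sum.inl i)

/-- The complement of the image of `f` is freely generated if and only if `f` satisfies the gluing
conditions on injectivity and on pullbacks. -/
theorem isFree_iff_glueTo : IsFree f ↔ IsCofibration (SymSpectrum.Hom.f f 0).hom ∧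
      (∀ k l : ℕ, IsCofibration (glueTo f (finSumFinEquiv : Fin k ⊕ Fin l ≃ Fin (k + l)))) ∧
      (∀ k l m : ℕ, IsPullback
        (glueStep f finSumFinEquiv (lastBlocks k l m) (Equiv.sumComm (Fin k) (Fin m))
          (midBlock k l m) (midBlock_eq k l m))
        (glueStep f ((Equiv.sumComm (Fin l) (Fin k)).trans finSumFinEquiv) finSumFinEquiv
          (Equiv.refl (Fin k ⊕ Fin m)) (midBlock k l m) rfl)
        (glueTo f (lastBlocks k l m))
        (glueTo f (finSumFinEquiv : Fin (k + l) ⊕ Fin m ≃ Fin (k + l + m)))) := by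
  constructor
  · intro hf
    refine ⟨(isCofibration_iff _).2 fun p => (hf 0 p).injective,
      fun k l => (isCofibration_iff _).2 fun p => glueTo_injective _ hf, fun k l m => ?_⟩
    have hw₁ := glueStep_glueTo f finSumFinEquiv (lastBlocks k l m) (Equiv.sumComm (Fin k) (Fin m))
      (midBlock k l m) (midBlock_eq k l m)
    have hw₂ := glueStep_glueTo f ((Equiv.sumComm (Fin l) (Fin k)).trans finSumFinEquiv)
      (finSumFinEquiv : Fin (k + l) ⊕ Fin m ≃ _) (Equiv.refl (Fin k ⊕ Fin m)) (midBlock k l m) rfl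
    -- all glued spaces embed into `Y(N)`, so only a simplex with the right image there is needed
    have hlift : ∀ {p} (x : (glue f (lastBlocks k l m)).obj p)
        (y : (glue f (finSumFinEquiv : Fin (k + l) ⊕ Fin m ≃ _)).obj p)
        (q : (glue f (midBlock k l m)).obj p), ap (glueTo f (midBlock k l m)) q =
          ap (glueTo f (lastBlocks k l m)) x →
        ap (glueTo f (lastBlocks k l m)) x = ap (glueTo f finSumFinEquiv) y →
        ∃ q, ap (glueStep f finSumFinEquiv (lastBlocks k l m) (Equiv.sumComm (Fin k) (Fin m))
          (midBlock k l m) (midBlock_eq k l m)) q = x ∧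
          ap (glueStep f ((Equiv.sumComm (Fin l) (Fin k)).trans finSumFinEquiv) finSumFinEquiv
          (Equiv.refl (Fin k ⊕ Fin m)) (midBlock k l m) rfl) q = y := by
      intro p x y q h1 h2
      refine ⟨q, glueTo_injective _ hf ?_, glueTo_injective _ hf ?_⟩
      · exact (congrArg (fun g => ap g q) hw₁).trans h1
      · exact (congrArg (fun g => ap g q) hw₂).trans (h1.trans h2)
    refine isPullback_of_exists (hw₁.trans hw₂.symm) (fun p q q' h => ?_) fun {p} x y h => ?_
    · refine glueTo_injective _ hf (p := p) ?_
      dsimp only at h ⊢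
      rw [← hw₁, ap_comp, ap_comp, h]
    · rcases glue_cases _ x with ⟨x, rfl⟩ | ⟨y₁, t₁, rfl, h₁, h₁'⟩
      · exact hlift _ _ (glueInl _ f x) ((glueTo_glueInl _ x).trans (glueTo_glueInl _ x).symm) h
      rcases glue_cases _ y with ⟨x, rfl⟩ | ⟨y₂, t₂, rfl, h₂, -⟩
      · exact hlift _ _ (glueInl _ f x)
          ((glueTo_glueInl _ x).trans ((glueTo_glueInl _ x).symm.trans h.symm)) h
      have h3 := h
      rw [glueTo_glueInr, glueTo_glueInr, gen_smk_sph, gen_smk_sph] at h3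
      have hsrc := (hf _ p).haveCommonSource _ _ h₁ h₂ h3 ((hf _ p).isNew_put _ h₁ h₁')
      obtain ⟨_, _, _, _, r, _, _, _, hr₁, hr₂⟩ := id hsrc
      have hpb : ∀ i j, blockEmb (lastBlocks k l m) i =
          blockEmb (finSumFinEquiv : Fin (k + l) ⊕ Fin m ≃ _) j →
          ∃ q : Fin l, blockEmb finSumFinEquiv q = i := by
        intro i j hij
        obtain ⟨i | i, rfl⟩ := finSumFinEquiv.surjective i
        · exact ⟨i, rfl⟩
        · have h4 : (finSumFinEquiv (Sum.inr i) : Fin (k + l + m)) = finSumFinEquiv (Sum.inl j) :=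
            (lastBlocks_inl_inr i).symm.trans hij
          cases finSumFinEquiv.injective h4
      obtain ⟨w, hw, -⟩ := hsrc.exists_of_pullback (blockEmb finSumFinEquiv)
        (blockEmb ((Equiv.sumComm (Fin l) (Fin k)).trans finSumFinEquiv)) lastBlocks_inl_inl
        hpb r hr₁ hr₂
      refine hlift _ _ (glueInr _ f (smk w (sph fun i => r (midBlock k l m (Sum.inr i))))) ?_ h
      rw [glueTo_glueInr, glueTo_glueInr, ← put_blockEmb _ w r, gen_smk_sph,
        ← blockEmb_trans_lastBlocks, ← put_put, hw]
      exact put_congr _ _ hr₁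
  · rintro ⟨h₀, ha, hb⟩ n p
    have hinj : ∀ (k l : ℕ) (p : SimplexCategoryᵒᵖ), Function.Injective
        (fun x : (glue f (finSumFinEquiv : Fin k ⊕ Fin l ≃ Fin (k + l))).obj p =>
          ap (glueTo f finSumFinEquiv) x) := fun k l => (isCofibration_iff _).1 (ha k l)
    refine ⟨injective_of_glueTo_injective hinj ((isCofibration_iff _).1 h₀ p) n,
      fun a _ _ hy hc => isNew_put_of_glueTo_injective hinj a hy hc,
      fun {k l} a y c b z d hy hz hyz hnew => ?_⟩
    obtain ⟨k₀, l₀, m₀, e, e', ω, hω, hω'⟩ := exists_three_blocks a b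
    -- `y` and `z` are replaced by simplices over the standard blocks
    have hy' : ∀ r, Y.put e.toEmbedding (Y.put e.symm.toEmbedding y (fun i => c (a (e i)))) r = y :=
      put_symm_put e.symm y _
    have hz' : ∀ r,
        Y.put e'.toEmbedding (Y.put e'.symm.toEmbedding z (fun i => d (b (e' i)))) r = z :=
      put_symm_put e'.symm z _
    have h1 : Y.put ω (Y.put (blockEmb (lastBlocks k₀ l₀ m₀)) (Y.put e.symm.toEmbedding y
        fun i => c (a (e i)))
        (fun i => c (ω i))) c = Y.put a y c := by
      rw [put_put, hω, ← put_put, hy']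
    have h2 : Y.put ω (Y.put (blockEmb finSumFinEquiv) (Y.put e'.symm.toEmbedding z
        fun i => d (b (e' i)))
        (fun i => d (ω i))) d = Y.put b z d := by
      rw [put_put, hω', ← put_put, hz']
    obtain ⟨h3, h4⟩ := eq_of_put_eq_of_glueTo_injective hinj ω (h1.trans (hyz.trans h2.symm))
      (h1 ▸ hnew)
    have h5 := (haveCommonSource_of_isPullback hinj (hb k₀ l₀ m₀) h3
      (IsNew.of_put (h1 ▸ hnew))).trans ω h4
    rw [hω, hω'] at h5
    have h6 := h5.put_right.symm.put_right.symm
    rwa [hy', hz'] at h6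

end SymSp

theorem mainTheorem4 :
    (∀ (X Y : SymSpectrum.{u}) (f : X ⟶ Y), IsFlatCofibration f ↔
      IsCofibration (SymSpectrum.Hom.f f 0).hom ∧
      (∀ k l : ℕ, IsCofibration (glueTo f (finSumFinEquiv : Fin k ⊕ Fin l ≃ Fin (k + l)))) ∧
      (∀ k l m : ℕ, IsPullback
        (glueStep f finSumFinEquiv (lastBlocks k l m) (Equiv.sumComm (Fin k) (Fin m))
          (midBlock k l m) (midBlock_eq k l m))
        (glueStep f ((Equiv.sumComm (Fin l) (Fin k)).trans finSumFinEquiv) finSumFinEquiv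
          (Equiv.refl (Fin k ⊕ Fin m)) (midBlock k l m) rfl)
        (glueTo f (lastBlocks k l m))
        (glueTo f (finSumFinEquiv : Fin (k + l) ⊕ Fin m ≃ Fin (k + l + m))))) ∧
    (∀ (Y : SymSpectrum.{u}) (A : SubSpectrum Y), IsFlat Y →
      (IsFlatCofibration A.ι ↔ ∀ (k l : ℕ) (p : SimplexCategoryᵒᵖ),
        Set.range (ap (p := p) (SymSpectrum.Hom.f A.ι (k + l)).hom) ∩
            Set.range (ap (p := p) (Y.gen (finSumFinEquiv : Fin k ⊕ Fin l ≃ Fin (k + l)))) =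
          Set.range (ap (p := p) (smashMap (SymSpectrum.Hom.f A.ι k).hom (𝟙 (sphere (Fin l))) ≫
            Y.gen (finSumFinEquiv : Fin k ⊕ Fin l ≃ Fin (k + l)))))) ∧
    (∀ (G : Type v) [Group G] [Finite G] (S : Type) [Finite S] [MulAction G S],
      (∀ X : GSymSpectrum.{u} G, IsGFlat X →
        IsGFlat (powerG X S) ∧ IsGFlatCofibration (fatDiagonalGι X S)) ∧
      IsGFlat (powerG (Action.trivial G sphereSpectrum.{u}) S) ∧
      IsGFlatCofibration (fatDiagonalGι (Action.trivial G sphereSpectrum.{u}) S)) := by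
  refine ⟨fun X Y f => (isFlatCofibration_iff_isFree f).trans isFree_iff_glueTo,
    fun Y A hY => (isFlatCofibration_iff_isFree A.ι).trans
      (isFree_ι_iff_inter ((isFlatCofibration_iff_isFree _).1 hY) A), fun G _ _ S _ _ => ?_⟩
  have key : ∀ X : GSymSpectrum.{u} G, IsGFlat X →
      IsGFlat (powerG X S) ∧ IsGFlatCofibration (fatDiagonalGι X S) := by
    intro X hX
    have hfree : IsFree (fromPoint X.V) :=
      (isFlatCofibration_iff_isFree _).1 ((isGFlatCofibration_iff (fromPointG X)).1 hX)
    exact ⟨(isGFlatCofibration_iff (fromPointG (powerG X S))).2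
        ((isFlatCofibration_iff_isFree _).2 (isFree_power hfree S)),
      (isGFlatCofibration_iff (fatDiagonalGι X S)).2
        ((isFlatCofibration_iff_isFree _).2 (isFree_fatDiagonal_ι hfree S))⟩
  exact ⟨key, key _ ((isGFlatCofibration_iff (fromPointG (Action.trivial G sphereSpectrum.{u}))).2
    ((isFlatCofibration_iff_isFree _).2 isFree_fromPoint_sphereSpectrum))⟩
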